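/- Setting. Let $n\in\{2,3\}$, let $\Omega\subset\mathbb R^n$ be open and bounded (for instance a bounded Lipschitz domain), $T>0$, $J=[0,T]$. Write $\mathbb V=\mathbb R^n$, $\mathbb M,\mathbb S,\mathbb K$ for all, symmetric, skew-symmetric $n\times n$ matrices (Frobenius inner product), $(\cdot,\cdot)$ and $\|\cdot\|_0$ for the inner product and norm of $L^2(\Omega;\mathbb X)$, $\|\cdot\|_m$ for the $H^m(\Omega;\mathbb X)$-norm, $\|\cdot\|_{\mathrm{div}}=(\|\cdot\|_0^2+\|\operatorname{div}\cdot\|_0^2)^{1/2}$ (row-wise divergence for matrices), and $$\Sigma=H(\mathrm{div},\Omega;\mathbb M),\quad V=L^2(\Omega;\mathbb V),\quad \Gamma=L^2(\Omega;\mathbb K),\quad W=H(\mathrm{div},\Omega),\quad Q=L^2(\Omega).$$ Norms $L^q\mathcal X$, $W^{1,q}\mathcal X$ are those of $L^q(J;\mathcal X)$, $W^{1,q}(J;\mathcal X)$, with $\|f\|_{W^{1,q}\mathcal X}=\|f\|_{L^q\mathcal X}+\|\dot f\|_{L^q\mathcal X}$ and the value $\infty$ outside the space; $\|f,g\|=\|f\|+\|g\|$.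 Coefficients (measurable functions of $x\in\Omega$). $\mathcal C$ is a symmetric, bounded, uniformly positive definite linear map $\mathbb S\to\mathbb S$; $\mathcal A=\mathcal C^{-1}$ on $\mathbb S$ and $\mathcal A$ is a fixed positive constant times the identity on $\mathbb K$; $\kappa$ is a symmetric, bounded, uniformly positive definite matrix; $s_0\ge0$ and $\alpha>0$ are bounded. Put $\|\tau\|_{\mathcal A}=(\mathcal A\tau,\tau)^{1/2}$. Problems. The exact solution $(\sigma,u,\gamma,z,p)$, with $(\sigma,p)\in C^1(J;\Sigma\times Q)$ and $(u,\gamma,z)\in C^0(J;V\times\Gamma\times W)$, satisfies for all $t\in J$ $$\begin{aligned}(\mathcal A(\sigma+\alpha p I),\tau)+(u,\operatorname{div}\tau)+(\gamma,\tau)&=0 &&\forall\tau\in\Sigma,\\ (\operatorname{div}\sigma,v)+(\sigma,\eta)&=-(f,v)&&\forall (v,\eta)\in V\times\Gamma,\\ (\kappa^{-1}z,w)+(p,\operatorname{div}w)&=0&&\forall w\in W,\\ (s_0\dot p,q)+(\mathcal A(\dot\sigma+\alpha\dot p I),\alpha qI)-(\operatorname{div}z,q)&=(g,q)&&\forall q\in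 Q.\end{aligned}$$ The semidiscrete solution $(\sigma_h,u_h,\gamma_h,z_h,p_h)$ has the same regularity in time and satisfies the same equations (same $f$, $g$) with trial and test spaces replaced by finite-dimensional subspaces $\Sigma_h\subset\Sigma$, $V_h\subset V$, $\Gamma_h\subset\Gamma$, $W_h\subset W$, $Q_h\subset Q$. Finite element assumptions. Let $r'\ge1$ and $r'\in\{r,r-1\}$. With a constant $C_1$ independent of the mesh and with mesh size $h>0$: * Approximation: for $1\le m\le r$ the $L^2$-distance of an $H^m$ function $\xi$ in $\Sigma$, $\Gamma$, $W$, $Q$ (with values in $\mathbb M,\mathbb K,\mathbb V,\mathbb R$) to $\Sigma_h,\Gamma_h,W_h,Q_h$, respectively, is at most $C_1h^m\|\xi\|_m$; the same for $V_h$ for $1\le m\le r'$. * (S1) $\operatorname{div}\Sigma_h=V_h$ and $\operatorname{div}W_h=Q_h$. * (S2) There are bounded linear maps $\Pi_h^\Sigma:H^1(\Omega;\mathbb M)\to\Sigma_h$ and $\Pi_h^W:H^1(\Omega;\mathbb V)\to W_h$ with $\operatorname{div}\Pi_h^\Sigma\tau=P_h^V\operatorname{div}\tau$, $\operatorname{div}\Pi_h^Ww=P_h^Q\operatorname{div}w$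 ($P_h^V,P_h^Q$ the $L^2$ projections onto $V_h,Q_h$), $\|\tau-\Pi_h^\Sigma\tau\|_0\le C_1h^m\|\tau\|_m$ and $\|w-\Pi_h^Ww\|_0\le C_1h^m\|w\|_m$ for $1\le m\le r$. * (S3) For every $q\in Q_h$ there is $w\in W_h$ with $\operatorname{div}w=q$ and $\|w\|_{\mathrm{div}}\le C_1\|q\|_0$. * (S4) For every $(v,\eta)\in V_h\times\Gamma_h$ there is $\tau\in\Sigma_h$ with $\operatorname{div}\tau=v$, $(\tau,\eta')=(\eta,\eta')$ for all $\eta'\in\Gamma_h$, and $\|\tau\|_{\mathrm{div}}\le C_1(\|v\|_0+\|\eta\|_0)$. Bounds. Put $$M_m=\max\{\|\sigma,p,\gamma\|_{W^{1,1}H^m},\ \|z\|_{L^2H^m}\},\qquad N_m=\|\sigma,p,\gamma\|_{W^{1,2}H^m}+\|z\|_{W^{1,1}H^m}.$$ Corollary. Given $\Omega$, $T$, the coefficients, $r$, $r'$ and constants $C_0,C_1$, there is a constant $c>0$, independent of $h$, of the finite element spaces and of the exact and semidiscrete solutions, such that for every $h>0$, all spaces as above, all exact and semidiscrete solutions, and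 every integer $1\le m\le r$ for which the numerical initial data satisfy $$\|\sigma(0)-\sigma_h(0),\,p(0)-p_h(0)\|_0\le C_0h^mM_m,\qquad \|z(0)-z_h(0)\|_0\le C_0h^mN_m,$$ the errors $e_\sigma=\sigma-\sigma_h$, $e_u=u-u_h$, $e_\gamma=\gamma-\gamma_h$, $e_z=z-z_h$, $e_p=p-p_h$ satisfy $$\begin{aligned} \|e_\sigma+\alpha e_pI\|_{L^\infty L^2_{\mathcal A}}&\le c\,h^mM_m, & \|e_\sigma\|_{L^\infty L^2}&\le c\,h^mN_m, & \|e_\gamma\|_{L^\infty L^2}&\le c\,h^mM_m,\\ \|e_z\|_{L^\infty L^2}&\le c\,h^mN_m, & \|e_p\|_{L^\infty L^2}&\le c\,h^mN_m, \end{aligned}$$ and, if moreover $m\le r'$, $$\|e_u\|_{L^\infty L^2}\le c\,h^m\bigl(M_m+\|u\|_{L^\infty H^m}\bigr),$$ and even $$\|e_u\|_{L^\infty L^2}\le c\,h^mM_m$$ if $m\le r'$ and the entries of $\mathcal A$ and the function $\alpha$ belong to $W^{m-1,\infty}(\Omega)$ (no extra condition for $m=1$). -/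

import Mathlib

open MeasureTheory Set
open scoped ENNReal ContDiff InnerProductSpace Matrix

noncomputable section

namespace Biot

/-! ### Vectors, matrices, Lebesgue spaces -/

/-- The space `ℝⁿ` of vectors with the Euclidean inner product. -/
abbrev Vec (n : ℕ) := EuclideanSpace ℝ (Fin n)

/-- The space of `n × n` real matrices with the Frobenius inner product; `τ (i, j)` is the entry in
row `i` and column `j`. -/
abbrev Mat (n : ℕ) := EuclideanSpace ℝ (Fin n × Fin n)

/-- The identity matrix. -/
def idMat (n : ℕ) : Mat n := WithLp.toLp 2 fun ij => if ij.1 = ij.2 then 1 else 0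

def IsSym {n : ℕ} (τ : Mat n) : Prop := ∀ i j, τ (i, j) = τ (j, i)

def IsSkew {n : ℕ} (τ : Mat n) : Prop := ∀ i j, τ (i, j) = -τ (j, i)

/-- `L²(Ω; X)`. -/
abbrev L2 {n : ℕ} (Ω : Set (Vec n)) (X : Type*) [NormedAddCommGroup X] :=
  Lp X 2 (volume.restrict Ω)

/-- `L²(Ω; 𝕂)`, the square integrable fields of skew-symmetric matrices. -/
def skewFields {n : ℕ} (Ω : Set (Vec n)) : Submodule ℝ (L2 Ω (Mat n)) where
  carrier := {η | ∀ᵐ x ∂(volume.restrict Ω), IsSkew (η x)}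
  zero_mem' := by
    filter_upwards [Lp.coeFn_zero (Mat n) 2 (volume.restrict Ω)] with x hx i j
    rw [hx]; simp
  add_mem' := by
    intro a b ha hb
    filter_upwards [ha, hb, Lp.coeFn_add a b] with x h1 h2 hx i j
    simp only [hx, Pi.add_apply, PiLp.add_apply]
    rw [h1 i j, h2 i j]; ring
  smul_mem' := by
    intro c a ha
    filter_upwards [ha, Lp.coeFn_smul c a] with x h1 hx i j
    simp only [hx, Pi.smul_apply, PiLp.smul_apply, smul_eq_mul]
    rw [h1 i j]; ring

/-! ### Test functions and weak derivatives -/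

/-- `φ ∈ C_c^∞(Ω)`. -/
def IsTest {n : ℕ} (Ω : Set (Vec n)) (φ : Vec n → ℝ) : Prop :=
  ContDiff ℝ ∞ φ ∧ HasCompactSupport φ ∧ tsupport φ ⊆ Ω

/-- The classical partial derivative `∂φ/∂x_i`. -/
def pd {n : ℕ} (i : Fin n) (φ : Vec n → ℝ) : Vec n → ℝ :=
  fun x => fderiv ℝ φ x (EuclideanSpace.single i 1)

/-- The classical derivative `∂^a φ` for a multi-index `a`. -/
def mpd {n : ℕ} (a : Fin n → ℕ) (φ : Vec n → ℝ) : Vec n → ℝ :=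
  (List.finRange n).foldr (fun i ψ => (pd i)^[a i] ψ) φ

/-- `g` is the weak derivative `∂^a f` on `Ω`. -/
def IsWeakDeriv {n : ℕ} (Ω : Set (Vec n)) {X : Type*} [NormedAddCommGroup X] [NormedSpace ℝ X]
    (a : Fin n → ℕ) (f g : Vec n → X) : Prop :=
  ∀ φ : Vec n → ℝ, IsTest Ω φ →
    ∫ x in Ω, mpd a φ x • f x = (-1 : ℝ) ^ (∑ i, a i) • ∫ x in Ω, φ x • g x

/-- `b ∈ W^{k,∞}(Ω)` for a real function `b`: all weak derivatives up to order `k` are bounded. -/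
def MemWInfty {n : ℕ} (Ω : Set (Vec n)) (k : ℕ) (b : Vec n → ℝ) : Prop :=
  ∀ a : Fin n → ℕ, ∑ i, a i ≤ k →
    ∃ g : Vec n → ℝ, MemLp g ∞ (volume.restrict Ω) ∧ IsWeakDeriv Ω a b g

section TestFunctionFacts

variable {n : ℕ}

theorem pd_reg {φ : Vec n → ℝ} (i : Fin n) (h : ContDiff ℝ ∞ φ ∧ HasCompactSupport φ) :
    ContDiff ℝ ∞ (pd i φ) ∧ HasCompactSupport (pd i φ) :=
  ⟨(h.1.fderiv_right (m := ∞) (by simp)).clm_apply contDiff_const, h.2.fderiv_apply ℝ _⟩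

theorem mpd_reg {φ : Vec n → ℝ} (a : Fin n → ℕ) (h : ContDiff ℝ ∞ φ ∧ HasCompactSupport φ) :
    ContDiff ℝ ∞ (mpd a φ) ∧ HasCompactSupport (mpd a φ) := by
  unfold mpd
  induction List.finRange n with
  | nil => simpa using h
  | cons i l ih =>
    simp only [List.foldr_cons]
    generalize a i = k
    induction k with
    | zero => simpa using ih
    | succ k ihk => rw [Function.iterate_succ_apply']; exact pd_reg i ihk

theorem memLp_reg {φ : Vec n → ℝ} (Ω : Set (Vec n)) (h : ContDiff ℝ ∞ φ ∧ HasCompactSupport φ) :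
    MemLp φ 2 (volume.restrict Ω) :=
  (h.1.continuous.memLp_of_hasCompactSupport h.2).restrict Ω

/-- `f ↦ ∫_Ω φ f` as a continuous linear map on `L²(Ω; X)`. -/
def pairL (Ω : Set (Vec n)) (X : Type*) [NormedAddCommGroup X] [NormedSpace ℝ X] [CompleteSpace X]
    (φ : Vec n → ℝ) (h : MemLp φ 2 (volume.restrict Ω)) : L2 Ω X →L[ℝ] X :=
  (ContinuousLinearMap.lsmul ℝ ℝ : ℝ →L[ℝ] X →L[ℝ] X).lpPairing (volume.restrict Ω) 2 2 h.toLp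

theorem pairL_apply (Ω : Set (Vec n)) {X : Type*} [NormedAddCommGroup X] [NormedSpace ℝ X]
    [CompleteSpace X] (φ : Vec n → ℝ) (h : MemLp φ 2 (volume.restrict Ω)) (f : L2 Ω X) :
    pairL Ω X φ h f = ∫ x in Ω, φ x • f x := by
  unfold pairL
  rw [ContinuousLinearMap.lpPairing_eq_integral]
  refine integral_congr_ae ?_
  filter_upwards [h.coeFn_toLp] with x hx
  simp [hx]

end TestFunctionFacts

/-! ### The Sobolev spaces `H^m(Ω; X)` -/

/-- Multi-indices of order at most `m`. -/
abbrev MIdx (n m : ℕ) := {a : Fin n → Fin (m + 1) // ∑ i, (a i : ℕ) ≤ m}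

def MIdx.zero (n m : ℕ) : MIdx n m := ⟨fun _ => 0, by simp⟩

/-- `H^m(Ω; X)`: an element is the family `(∂^a f)_{|a| ≤ m}` of the square integrable weak
derivatives of a function `f ∈ L²(Ω; X)`; the norm is `(∑_{|a| ≤ m} ‖∂^a f‖₀²)^{1/2}`. -/
def Hm {n : ℕ} (Ω : Set (Vec n)) (m : ℕ) (X : Type*) [NormedAddCommGroup X] [NormedSpace ℝ X]
    [CompleteSpace X] : Submodule ℝ (PiLp 2 fun _ : MIdx n m => L2 Ω X) where
  carrier := {F | ∀ a : MIdx n m, IsWeakDeriv Ω (fun i => (a.1 i : ℕ)) (F (MIdx.zero n m)) (F a)}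
  zero_mem' := by
    intro a φ h
    have h1 := pairL_apply Ω (X := X) _ (memLp_reg Ω (mpd_reg (fun i => (a.1 i : ℕ)) ⟨h.1, h.2.1⟩))
    have h2 := pairL_apply Ω (X := X) _ (memLp_reg Ω ⟨h.1, h.2.1⟩)
    rw [← h1, ← h2]; simp
  add_mem' := by
    intro F G hF hG a φ h
    have h1 := pairL_apply Ω (X := X) _ (memLp_reg Ω (mpd_reg (fun i => (a.1 i : ℕ)) ⟨h.1, h.2.1⟩))
    have h2 := pairL_apply Ω (X := X) _ (memLp_reg Ω ⟨h.1, h.2.1⟩)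
    have hf := hF a φ h
    have hg := hG a φ h
    rw [← h1, ← h2] at *
    simp only [PiLp.add_apply, map_add, smul_add]
    rw [hf, hg]
  smul_mem' := by
    intro c F hF a φ h
    have h1 := pairL_apply Ω (X := X) _ (memLp_reg Ω (mpd_reg (fun i => (a.1 i : ℕ)) ⟨h.1, h.2.1⟩))
    have h2 := pairL_apply Ω (X := X) _ (memLp_reg Ω ⟨h.1, h.2.1⟩)
    have hf := hF a φ h
    rw [← h1, ← h2] at *
    simp only [PiLp.smul_apply, map_smul]
    rw [hf, smul_comm]

/-- The inclusion `H^m(Ω; X) → L²(Ω; X)`. -/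
def hmFn {n : ℕ} {Ω : Set (Vec n)} {m : ℕ} {X : Type*} [NormedAddCommGroup X] [NormedSpace ℝ X]
    [CompleteSpace X] (F : Hm Ω m X) : L2 Ω X := F.1 (MIdx.zero n m)

instance {n : ℕ} (Ω : Set (Vec n)) (m : ℕ) (X : Type*) [NormedAddCommGroup X] [NormedSpace ℝ X]
    [CompleteSpace X] : CompleteSpace (Hm Ω m X) := by
  have hc : IsClosed (Hm Ω m X : Set (PiLp 2 fun _ : MIdx n m => L2 Ω X)) := by
    have he : (Hm Ω m X : Set (PiLp 2 fun _ : MIdx n m => L2 Ω X)) =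
        ⋂ a : MIdx n m, ⋂ φ : Vec n → ℝ, ⋂ h : IsTest Ω φ,
          {F | pairL Ω X _ (memLp_reg Ω (mpd_reg (fun i => (a.1 i : ℕ)) ⟨h.1, h.2.1⟩))
                (F (MIdx.zero n m)) =
              (-1 : ℝ) ^ (∑ i, (a.1 i : ℕ)) • pairL Ω X _ (memLp_reg Ω ⟨h.1, h.2.1⟩) (F a)} := by
      ext F
      simp only [mem_iInter, Set.mem_ofPred_eq, pairL_apply]
      rfl
    rw [he]
    refine isClosed_iInter fun a => isClosed_iInter fun φ => isClosed_iInter fun h => ?_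
    exact isClosed_eq (by fun_prop) (by fun_prop)
  exact hc.completeSpace_coe

/-- The norm `‖f‖_m` of a function `f ∈ L²(Ω; X)`, with the value `∞` if `f ∉ H^m(Ω; X)`. -/
def hmNorm {n : ℕ} {Ω : Set (Vec n)} {X : Type*} [NormedAddCommGroup X] [NormedSpace ℝ X]
    [CompleteSpace X] (m : ℕ) (f : L2 Ω X) : ℝ≥0∞ :=
  ⨅ (F : Hm Ω m X) (_ : hmFn F = f), ‖F‖ₑ

/-! ### The spaces `H(div)` -/

/-- `H(div, Ω)`: an element is a pair `(w, div w)` of square integrable fields, `div w` being the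
weak divergence of `w`; the norm is `(‖w‖₀² + ‖div w‖₀²)^{1/2}`. -/
def HdivVec {n : ℕ} (Ω : Set (Vec n)) : Submodule ℝ (WithLp 2 (L2 Ω (Vec n) × L2 Ω ℝ)) where
  carrier := {y | ∀ φ : Vec n → ℝ, IsTest Ω φ →
    ∫ x in Ω, φ x • y.snd x = -∑ j, (∫ x in Ω, pd j φ x • y.fst x) j}
  zero_mem' := by
    intro φ h
    have h1 := pairL_apply Ω (X := ℝ) _ (memLp_reg Ω ⟨h.1, h.2.1⟩)
    have h2 := fun j => pairL_apply Ω (X := Vec n) _ (memLp_reg Ω (pd_reg j ⟨h.1, h.2.1⟩))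
    simp only [← h1, ← h2]; simp
  add_mem' := by
    intro a b ha hb φ h
    have h1 := pairL_apply Ω (X := ℝ) _ (memLp_reg Ω ⟨h.1, h.2.1⟩)
    have h2 := fun j => pairL_apply Ω (X := Vec n) _ (memLp_reg Ω (pd_reg j ⟨h.1, h.2.1⟩))
    have ha' := ha φ h
    have hb' := hb φ h
    simp only [← h1, ← h2] at *
    simp only [WithLp.add_fst, WithLp.add_snd, map_add, PiLp.add_apply, Finset.sum_add_distrib]
    rw [ha', hb']; ring
  smul_mem' := by
    intro c a ha φ h
    have h1 := pairL_apply Ω (X := ℝ) _ (memLp_reg Ω ⟨h.1, h.2.1⟩)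
    have h2 := fun j => pairL_apply Ω (X := Vec n) _ (memLp_reg Ω (pd_reg j ⟨h.1, h.2.1⟩))
    have ha' := ha φ h
    simp only [← h1, ← h2] at *
    simp only [WithLp.smul_fst, WithLp.smul_snd, map_smul, PiLp.smul_apply, smul_eq_mul,
      ← Finset.mul_sum]
    rw [ha']; ring

/-- `H(div, Ω; 𝕄)`: an element is a pair `(τ, div τ)` of square integrable fields, `div τ` being the
weak row-wise divergence of `τ`; the norm is `(‖τ‖₀² + ‖div τ‖₀²)^{1/2}`. -/
def HdivMat {n : ℕ} (Ω : Set (Vec n)) :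
    Submodule ℝ (WithLp 2 (L2 Ω (Mat n) × L2 Ω (Vec n))) where
  carrier := {y | ∀ φ : Vec n → ℝ, IsTest Ω φ → ∀ i : Fin n,
    (∫ x in Ω, φ x • y.snd x) i = -∑ j, (∫ x in Ω, pd j φ x • y.fst x) (i, j)}
  zero_mem' := by
    intro φ h i
    have h1 := pairL_apply Ω (X := Vec n) _ (memLp_reg Ω ⟨h.1, h.2.1⟩)
    have h2 := fun j => pairL_apply Ω (X := Mat n) _ (memLp_reg Ω (pd_reg j ⟨h.1, h.2.1⟩))
    simp only [← h1, ← h2]; simp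
  add_mem' := by
    intro a b ha hb φ h i
    have h1 := pairL_apply Ω (X := Vec n) _ (memLp_reg Ω ⟨h.1, h.2.1⟩)
    have h2 := fun j => pairL_apply Ω (X := Mat n) _ (memLp_reg Ω (pd_reg j ⟨h.1, h.2.1⟩))
    have ha' := ha φ h i
    have hb' := hb φ h i
    simp only [← h1, ← h2] at *
    simp only [WithLp.add_fst, WithLp.add_snd, map_add, PiLp.add_apply, Finset.sum_add_distrib]
    rw [ha', hb']; ring
  smul_mem' := by
    intro c a ha φ h i
    have h1 := pairL_apply Ω (X := Vec n) _ (memLp_reg Ω ⟨h.1, h.2.1⟩)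
    have h2 := fun j => pairL_apply Ω (X := Mat n) _ (memLp_reg Ω (pd_reg j ⟨h.1, h.2.1⟩))
    have ha' := ha φ h i
    simp only [← h1, ← h2] at *
    simp only [WithLp.smul_fst, WithLp.smul_snd, map_smul, PiLp.smul_apply, smul_eq_mul,
      ← Finset.mul_sum]
    rw [ha']; ring

/-- The inclusion `H(div, Ω) → L²(Ω; 𝕍)`. -/
def vfn {n : ℕ} (Ω : Set (Vec n)) : HdivVec Ω →ₗ[ℝ] L2 Ω (Vec n) where
  toFun w := w.1.fst
  map_add' _ _ := rfl
  map_smul' _ _ := rfl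

/-- The divergence `H(div, Ω) → L²(Ω)`. -/
def vdiv {n : ℕ} (Ω : Set (Vec n)) : HdivVec Ω →ₗ[ℝ] L2 Ω ℝ where
  toFun w := w.1.snd
  map_add' _ _ := rfl
  map_smul' _ _ := rfl

/-- The inclusion `H(div, Ω; 𝕄) → L²(Ω; 𝕄)`. -/
def mfn {n : ℕ} (Ω : Set (Vec n)) : HdivMat Ω →ₗ[ℝ] L2 Ω (Mat n) where
  toFun τ := τ.1.fst
  map_add' _ _ := rfl
  map_smul' _ _ := rfl

/-- The row-wise divergence `H(div, Ω; 𝕄) → L²(Ω; 𝕍)`. -/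
def mdiv {n : ℕ} (Ω : Set (Vec n)) : HdivMat Ω →ₗ[ℝ] L2 Ω (Vec n) where
  toFun τ := τ.1.snd
  map_add' _ _ := rfl
  map_smul' _ _ := rfl

/-! ### Space-time norms on `J = [0, T]` -/

/-- Lebesgue measure on `J = [0, T]`. -/
def timeMeasure (T : ℝ) : Measure ℝ := volume.restrict (Icc 0 T)

/-- The norm of `L^q(J; H^m(Ω; X))`, with the value `∞` on functions outside this space. -/
def normLqHm {n : ℕ} {Ω : Set (Vec n)} {X : Type*} [NormedAddCommGroup X] [NormedSpace ℝ X]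
    [CompleteSpace X] (T : ℝ) (q : ℝ≥0∞) (m : ℕ) (f : ℝ → L2 Ω X) : ℝ≥0∞ :=
  ⨅ (F : ℝ → Hm Ω m X) (_ : AEStronglyMeasurable F (timeMeasure T))
    (_ : ∀ᵐ t ∂(timeMeasure T), hmFn (F t) = f t), eLpNorm F q (timeMeasure T)

/-- `F ∈ W^{1,q}(J; H)` with time derivative `F'`: the function `F` is the integral of
`F' ∈ L^q(J; H)`. -/
def IsW1 {H : Type*} [NormedAddCommGroup H] [NormedSpace ℝ H] (T : ℝ) (q : ℝ≥0∞)
    (F F' : ℝ → H) : Prop :=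
  MemLp F' q (timeMeasure T) ∧ ∀ t ∈ Icc 0 T, F t = F 0 + ∫ s in (0 : ℝ)..t, F' s

/-- The norm `‖f‖ + ‖ḟ‖` (both in `L^q(J; H^m)`) of `W^{1,q}(J; H^m(Ω; X))`, with the value `∞`
on functions outside this space. -/
def normW1qHm {n : ℕ} {Ω : Set (Vec n)} {X : Type*} [NormedAddCommGroup X] [NormedSpace ℝ X]
    [CompleteSpace X] (T : ℝ) (q : ℝ≥0∞) (m : ℕ) (f : ℝ → L2 Ω X) : ℝ≥0∞ :=
  ⨅ (F : ℝ → Hm Ω m X) (F' : ℝ → Hm Ω m X) (_ : IsW1 T q F F')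
    (_ : ∀ t ∈ Icc 0 T, hmFn (F t) = f t),
    eLpNorm F q (timeMeasure T) + eLpNorm F' q (timeMeasure T)

/-- The norm of `L^∞(J; L²(Ω; X))`. -/
def normLinftyL2 {n : ℕ} {Ω : Set (Vec n)} {X : Type*} [NormedAddCommGroup X]
    (T : ℝ) (f : ℝ → L2 Ω X) : ℝ≥0∞ :=
  eLpNorm f ∞ (timeMeasure T)

/-! ### Material parameters -/

/-- The material parameters of the poroelastic medium, as functions of the position: the stiffness
tensor `C` (on symmetric matrices), the compliance tensor `A` extended to all matrices, the hydraulic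
conductivity tensor `κ`, the constrained specific storage coefficient `s₀`, the Biot--Willis
coefficient `α`. -/
structure Coeffs (n : ℕ) where
  C : Vec n → Mat n →L[ℝ] Mat n
  A : Vec n → Mat n →L[ℝ] Mat n
  κ : Vec n → Matrix (Fin n) (Fin n) ℝ
  s₀ : Vec n → ℝ
  α : Vec n → ℝ

/-- The conditions on the material parameters: all are measurable and bounded on `Ω`; `C` is a
symmetric uniformly positive definite map of the symmetric matrices, `A` is its inverse on symmetric
matrices and a fixed positive multiple of the identity on skew-symmetric matrices; `κ` is symmetric
and uniformly positive definite; `s₀ ≥ 0` and `α > 0`. -/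
structure Coeffs.Admissible {n : ℕ} (D : Coeffs n) (Ω : Set (Vec n)) : Prop where
  meas_C : ∀ τ, Measurable fun x => D.C x τ
  meas_A : ∀ τ, Measurable fun x => D.A x τ
  meas_κ : ∀ i j, Measurable fun x => D.κ x i j
  meas_s₀ : Measurable D.s₀
  meas_α : Measurable D.α
  C_sym : ∀ x ∈ Ω, ∀ τ, IsSym τ → IsSym (D.C x τ)
  C_selfadjoint : ∀ x ∈ Ω, ∀ τ ξ, IsSym τ → IsSym ξ → ⟪D.C x τ, ξ⟫_ℝ = ⟪τ, D.C x ξ⟫_ℝ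
  C_bounds : ∃ c₀ > 0, ∃ c₁, ∀ x ∈ Ω, ∀ τ, IsSym τ →
    c₀ * ‖τ‖ ^ 2 ≤ ⟪D.C x τ, τ⟫_ℝ ∧ ⟪D.C x τ, τ⟫_ℝ ≤ c₁ * ‖τ‖ ^ 2
  A_sym : ∀ x ∈ Ω, ∀ τ, IsSym τ → IsSym (D.A x τ) ∧ D.C x (D.A x τ) = τ
  A_skew : ∃ a > 0, ∀ x ∈ Ω, ∀ η, IsSkew η → D.A x η = (a : ℝ) • η
  κ_symm : ∀ x ∈ Ω, (D.κ x).IsSymm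
  κ_bounds : ∃ k₀ > 0, ∃ k₁, ∀ x ∈ Ω, ∀ v : Fin n → ℝ,
    k₀ * (v ⬝ᵥ v) ≤ v ⬝ᵥ (D.κ x *ᵥ v) ∧ v ⬝ᵥ (D.κ x *ᵥ v) ≤ k₁ * (v ⬝ᵥ v)
  s₀_bounds : ∃ s₁, ∀ x ∈ Ω, 0 ≤ D.s₀ x ∧ D.s₀ x ≤ s₁
  α_bounds : ∃ α₁, ∀ x ∈ Ω, 0 < D.α x ∧ D.α x ≤ α₁

/-- The entries of `A` and the function `α` belong to `W^{k,∞}(Ω)`. -/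
def Coeffs.RegularUpTo {n : ℕ} (D : Coeffs n) (Ω : Set (Vec n)) (k : ℕ) : Prop :=
  (∀ e e' : Fin n × Fin n, MemWInfty Ω k fun x => D.A x (EuclideanSpace.single e 1) e') ∧
    MemWInfty Ω k D.α

/-- The form `(A (σ + α p I), τ + α q I)`. -/
def formA {n : ℕ} {Ω : Set (Vec n)} (D : Coeffs n) (σ : L2 Ω (Mat n)) (p : L2 Ω ℝ)
    (τ : L2 Ω (Mat n)) (q : L2 Ω ℝ) : ℝ :=
  ∫ x in Ω, ⟪D.A x (σ x + (D.α x * p x) • idMat n), τ x + (D.α x * q x) • idMat n⟫_ℝ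

/-- The form `(κ⁻¹ z, w)`. -/
def formκ {n : ℕ} {Ω : Set (Vec n)} (D : Coeffs n) (z w : L2 Ω (Vec n)) : ℝ :=
  ∫ x in Ω, ((D.κ x)⁻¹ *ᵥ (z x).ofLp) ⬝ᵥ (w x).ofLp

/-- The form `(s₀ p, q)`. -/
def formS {n : ℕ} {Ω : Set (Vec n)} (D : Coeffs n) (p q : L2 Ω ℝ) : ℝ :=
  ∫ x in Ω, D.s₀ x * p x * q x

/-- The norm `‖σ + α p I‖_A = (A (σ + α p I), σ + α p I)^{1/2}`. -/
def energyNorm {n : ℕ} {Ω : Set (Vec n)} (D : Coeffs n) (σ : L2 Ω (Mat n)) (p : L2 Ω ℝ) : ℝ :=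
  √(formA D σ p σ p)

/-! ### The variational formulation and its semidiscretization -/

/-- A tuple of spaces `Σ ⊆ H(div, Ω; 𝕄)`, `V ⊆ L²(Ω; 𝕍)`, `Γ ⊆ L²(Ω; 𝕄)`, `W ⊆ H(div, Ω)`,
`Q ⊆ L²(Ω)`. -/
structure Spaces {n : ℕ} (Ω : Set (Vec n)) where
  S : Submodule ℝ (HdivMat Ω)
  V : Submodule ℝ (L2 Ω (Vec n))
  G : Submodule ℝ (L2 Ω (Mat n))
  W : Submodule ℝ (HdivVec Ω)
  Q : Submodule ℝ (L2 Ω ℝ)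

/-- The spaces of the continuous problem. -/
def fullSpaces {n : ℕ} (Ω : Set (Vec n)) : Spaces Ω := ⟨⊤, ⊤, skewFields Ω, ⊤, ⊤⟩

/-- The unknowns (stress, displacement, rotation, flux, pressure) as functions of time; only their
values on `J = [0, T]` matter. -/
structure Fields {n : ℕ} (Ω : Set (Vec n)) where
  σ : ℝ → HdivMat Ω
  u : ℝ → L2 Ω (Vec n)
  γ : ℝ → L2 Ω (Mat n)
  z : ℝ → HdivVec Ω
  p : ℝ → L2 Ω ℝ

/-- The time derivative on `J = [0, T]`, one-sided at the end points. -/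
def dt {H : Type*} [NormedAddCommGroup H] [NormedSpace ℝ H] (T : ℝ) (F : ℝ → H) (t : ℝ) : H :=
  derivWithin F (Icc 0 T) t

/-- `(σ, u, γ, z, p)` solves the four-field variational formulation of Biot's consolidation model
with trial and test spaces `Y`, body force `f` and source density `g`. With `Y = fullSpaces Ω` this is
the continuous problem, with finite element spaces it is the semidiscrete problem. -/
structure IsSolution {n : ℕ} {Ω : Set (Vec n)} (D : Coeffs n) (T : ℝ) (Y : Spaces Ω)
    (f : ℝ → L2 Ω (Vec n)) (g : ℝ → L2 Ω ℝ) (s : Fields Ω) : Prop where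
  σ_mem : ∀ t ∈ Icc 0 T, s.σ t ∈ Y.S
  u_mem : ∀ t ∈ Icc 0 T, s.u t ∈ Y.V
  γ_mem : ∀ t ∈ Icc 0 T, s.γ t ∈ Y.G
  z_mem : ∀ t ∈ Icc 0 T, s.z t ∈ Y.W
  p_mem : ∀ t ∈ Icc 0 T, s.p t ∈ Y.Q
  σ_reg : ContDiffOn ℝ 1 s.σ (Icc 0 T)
  p_reg : ContDiffOn ℝ 1 s.p (Icc 0 T)
  u_reg : ContinuousOn s.u (Icc 0 T)
  γ_reg : ContinuousOn s.γ (Icc 0 T)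
  z_reg : ContinuousOn s.z (Icc 0 T)
  eq1 : ∀ t ∈ Icc 0 T, ∀ τ ∈ Y.S,
    formA D (mfn Ω (s.σ t)) (s.p t) (mfn Ω τ) 0 + ⟪s.u t, mdiv Ω τ⟫_ℝ + ⟪s.γ t, mfn Ω τ⟫_ℝ = 0
  eq2 : ∀ t ∈ Icc 0 T, ∀ v ∈ Y.V, ∀ η ∈ Y.G,
    ⟪mdiv Ω (s.σ t), v⟫_ℝ + ⟪mfn Ω (s.σ t), η⟫_ℝ = -⟪f t, v⟫_ℝ
  eq3 : ∀ t ∈ Icc 0 T, ∀ w ∈ Y.W,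
    formκ D (vfn Ω (s.z t)) (vfn Ω w) + ⟪s.p t, vdiv Ω w⟫_ℝ = 0
  eq4 : ∀ t ∈ Icc 0 T, ∀ q ∈ Y.Q,
    formS D (dt T s.p t) q + formA D (mfn Ω (dt T s.σ t)) (dt T s.p t) 0 q
      - ⟪vdiv Ω (s.z t), q⟫_ℝ = ⟪g t, q⟫_ℝ

/-! ### Assumptions on the finite element spaces -/

/-- The space `Ξh` approximates the functions in `Ξ` to order `k` in the `L²` norm, with constant
`c`: the distance of `f ∈ Ξ` to `Ξh` is at most `c h^m ‖f‖_m` for `1 ≤ m ≤ k`. -/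
def ApproxOrder {n : ℕ} {Ω : Set (Vec n)} {X : Type*} [NormedAddCommGroup X] [NormedSpace ℝ X]
    [CompleteSpace X] (Ξ Ξh : Submodule ℝ (L2 Ω X)) (h c : ℝ) (k : ℕ) : Prop :=
  ∀ m : ℕ, 1 ≤ m → m ≤ k → ∀ f ∈ Ξ,
    Metric.infEDist f Ξh ≤ ENNReal.ofReal (c * h ^ m) * hmNorm m f

/-- The assumptions on finite element spaces `Y` with mesh size `h`, all with the same constant `c`,
which does not depend on the mesh. -/
structure Stable {n : ℕ} {Ω : Set (Vec n)} (Y : Spaces Ω) (h c : ℝ) (r r' : ℕ) : Prop where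
  finite_S : FiniteDimensional ℝ Y.S
  finite_V : FiniteDimensional ℝ Y.V
  finite_G : FiniteDimensional ℝ Y.G
  finite_W : FiniteDimensional ℝ Y.W
  finite_Q : FiniteDimensional ℝ Y.Q
  G_skew : Y.G ≤ skewFields Ω
  /-- approximation orders -/
  order_S : ApproxOrder ⊤ (Y.S.map (mfn Ω)) h c r
  order_V : ApproxOrder ⊤ Y.V h c r'
  order_G : ApproxOrder (skewFields Ω) Y.G h c r
  order_W : ApproxOrder ⊤ (Y.W.map (vfn Ω)) h c r
  order_Q : ApproxOrder ⊤ Y.Q h c r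
  /-- `div Σ_h = V_h` and `div W_h = Q_h` -/
  div_S : Y.S.map (mdiv Ω) = Y.V
  div_W : Y.W.map (vdiv Ω) = Y.Q
  /-- bounded interpolation operators compatible with the divergence, that is,
  `div Π_Σ τ = P_V div τ` and `div Π_W w = P_Q div w` with the `L²` projections `P_V`, `P_Q` -/
  interp_S : ∃ P : Hm Ω 1 (Mat n) →L[ℝ] HdivMat Ω, (∀ F, P F ∈ Y.S) ∧
    (∀ F, ∀ τ : HdivMat Ω, mfn Ω τ = hmFn F → ∀ v ∈ Y.V, ⟪mdiv Ω (P F), v⟫_ℝ = ⟪mdiv Ω τ, v⟫_ℝ) ∧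
    ∀ m : ℕ, 1 ≤ m → m ≤ r → ∀ F,
      ‖hmFn F - mfn Ω (P F)‖ₑ ≤ ENNReal.ofReal (c * h ^ m) * hmNorm m (hmFn F)
  interp_W : ∃ P : Hm Ω 1 (Vec n) →L[ℝ] HdivVec Ω, (∀ F, P F ∈ Y.W) ∧
    (∀ F, ∀ w : HdivVec Ω, vfn Ω w = hmFn F → ∀ q ∈ Y.Q, ⟪vdiv Ω (P F), q⟫_ℝ = ⟪vdiv Ω w, q⟫_ℝ) ∧
    ∀ m : ℕ, 1 ≤ m → m ≤ r → ∀ F,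
      ‖hmFn F - vfn Ω (P F)‖ₑ ≤ ENNReal.ofReal (c * h ^ m) * hmNorm m (hmFn F)
  /-- inf-sup conditions -/
  infsup_W : ∀ q ∈ Y.Q, ∃ w ∈ Y.W, vdiv Ω w = q ∧ ‖w‖ ≤ c * ‖q‖
  infsup_S : ∀ v ∈ Y.V, ∀ η ∈ Y.G, ∃ τ ∈ Y.S, mdiv Ω τ = v ∧
    (∀ η' ∈ Y.G, ⟪mfn Ω τ, η'⟫_ℝ = ⟪η, η'⟫_ℝ) ∧ ‖τ‖ ≤ c * (‖v‖ + ‖η‖)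

/-! ### The norms of the exact solution in the error bounds -/

/-- `max {‖σ, p, γ‖_{W^{1,1} H^m}, ‖z‖_{L² H^m}}`. -/
def boundMax {n : ℕ} {Ω : Set (Vec n)} (T : ℝ) (m : ℕ) (s : Fields Ω) : ℝ≥0∞ :=
  max (normW1qHm T 1 m (fun t => mfn Ω (s.σ t)) + normW1qHm T 1 m s.p + normW1qHm T 1 m s.γ)
    (normLqHm T 2 m fun t => vfn Ω (s.z t))

/-- `‖σ, p, γ‖_{W^{1,2} H^m} + ‖z‖_{W^{1,1} H^m}`. -/
def boundSum {n : ℕ} {Ω : Set (Vec n)} (T : ℝ) (m : ℕ) (s : Fields Ω) : ℝ≥0∞ :=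
  normW1qHm T 2 m (fun t => mfn Ω (s.σ t)) + normW1qHm T 2 m s.p + normW1qHm T 2 m s.γ
    + normW1qHm T 1 m fun t => vfn Ω (s.z t)

/-- The numerical initial data are accurate of order `h^m`, relative to the size of the exact
solution. -/
def InitialAccuracy {n : ℕ} {Ω : Set (Vec n)} (T h c : ℝ) (m : ℕ) (s sh : Fields Ω) : Prop :=
  ‖mfn Ω (s.σ 0) - mfn Ω (sh.σ 0)‖ₑ + ‖s.p 0 - sh.p 0‖ₑ
      ≤ ENNReal.ofReal (c * h ^ m) * boundMax T m s ∧
    ‖vfn Ω (s.z 0) - vfn Ω (sh.z 0)‖ₑ ≤ ENNReal.ofReal (c * h ^ m) * boundSum T m s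

end Biot

end

open MeasureTheory Set
open scoped ENNReal ContDiff InnerProductSpace Matrix

noncomputable section

namespace Biot

open Filter
open scoped Topology

/-! ### Absolutely continuous functions of time -/

section Time

variable {H : Type*} [NormedAddCommGroup H] {T : ℝ}

/-! The proof separates approximation from stability. The exact solution is compared with discrete
functions: a stress `L σ` in Σ_h with the discrete divergence and the weak skew part of σ
(`Discretization.exists_interpolation`), the L² projections of p, γ and u, and the interpolant Π_W
z. The differences θ_σ = Lσ − σ_h, θ_p = P_Q p − p_h and ζ = Π_W z − z_h satisfy the error equations
with approximation errors as data, and θ_σ lies in the discrete kernel: it has zero divergence and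
is orthogonal to Γ_h.

First energy estimate. The stress equation is differentiated in time and tested with θ_σ. On the
kernel the displacements and γ_h drop out, and only γ' − P_Γ γ' is left of the rotation. When the
mass equation tested with θ_p and Darcy's law tested with ζ are added, the coupling terms cancel,
because Π_W preserves the discrete divergence and div W_h ⊆ Q_h. The rotation residual is skew,
hence orthogonal to αθ_p I, so all stress terms are tested with ψ = θ_σ + αθ_p I. The energy Y =
‖ψ‖_A² + (s₀θ_p, θ_p) then obeys Y' ≤ 2g√Y + k, where g collects the residuals of the time
derivatives and k the squared flux residual, which the dissipation absorbs. Evaluation at the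
maximum of Y (`sqrt_le_of_deriv_le`) needs only g, k ∈ L¹(J) and involves no exponential; this
yields the norms in M_m. No positive lower bound of s₀ enters.

Second energy estimate. Darcy's law is differentiated as well, and the test functions are θ_σ', θ_p'
and ζ. Now ‖ψ'‖_A² absorbs the residuals, which therefore have to be square integrable in time,
while the flux residual is needed only in W^{1,1}; this yields the norms in N_m.

The inf-sup conditions do the rest: rotation and displacement are controlled by σ + αpI, the
pressure by the flux, and the stress is recovered by subtracting αpI.

For the last bound of the displacement, A(σ + αpI) + γ is the weak gradient of u. The product rule
for coefficients in W^{m−1,∞} and a Poincaré inequality bound ‖u‖_m by M_m; the weak boundary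
condition on u is contained in the fact that every τ ∈ H(div) is an admissible test function.

The energy argument is carried out for bounded operators on abstract inner product spaces. Possibly
infinite norms are treated by proving each estimate for every real K above the norm
(`le_mul_of_forall_lt`). -/

instance (T : ℝ) : IsFiniteMeasure (timeMeasure T) := by
  unfold timeMeasure; infer_instance

/-- Every sum of increments of `f` is dominated by the same sum for `g`. This transfers absolute
continuity from a scalar primitive to vector-valued functions and on to quadratic forms. -/
theorem absolutelyContinuous_of_dist_le {X Y : Type*} [PseudoMetricSpace X] [PseudoMetricSpace Y]
    {f : ℝ → X} {g : ℝ → Y} {a b C : ℝ} (hg : AbsolutelyContinuousOnInterval g a b)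
    (h : ∀ s ∈ uIcc a b, ∀ t ∈ uIcc a b, dist (f s) (f t) ≤ C * dist (g s) (g t)) :
    AbsolutelyContinuousOnInterval f a b := by
  rw [absolutelyContinuousOnInterval_iff] at hg ⊢
  intro ε hε
  -- `C` may vanish or be negative; `|C| + 1` is a positive substitute by which one can divide.
  obtain ⟨δ, hδ, h2⟩ := hg (ε / (|C| + 1)) (by positivity)
  refine ⟨δ, hδ, fun E hE hs => ?_⟩
  have h3 := h2 E hE hs
  have h5 : (0 : ℝ) ≤ ∑ i ∈ Finset.range E.1, dist (g (E.2 i).1) (g (E.2 i).2) :=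
    Finset.sum_nonneg fun _ _ => dist_nonneg
  calc ∑ i ∈ Finset.range E.1, dist (f (E.2 i).1) (f (E.2 i).2)
      ≤ ∑ i ∈ Finset.range E.1, C * dist (g (E.2 i).1) (g (E.2 i).2) :=
        Finset.sum_le_sum fun i hi => h _ (hE.1 i hi).1 _ (hE.1 i hi).2
    _ = C * ∑ i ∈ Finset.range E.1, dist (g (E.2 i).1) (g (E.2 i).2) := by rw [Finset.mul_sum]
    _ ≤ (|C| + 1) * ∑ i ∈ Finset.range E.1, dist (g (E.2 i).1) (g (E.2 i).2) := by
        gcongr; linarith [le_abs_self C]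
    _ < (|C| + 1) * (ε / (|C| + 1)) := by gcongr
    _ = ε := by field_simp

/-- An absolutely continuous function is bounded on the interval, and a bounded quadratic form is
Lipschitz on bounded sets. -/
theorem absolutelyContinuous_quadratic {H : Type*} [NormedAddCommGroup H] [InnerProductSpace ℝ H]
    (B : H →L[ℝ] H) {x : ℝ → H} {a b : ℝ} (hx : AbsolutelyContinuousOnInterval x a b) :
    AbsolutelyContinuousOnInterval (fun t => ⟪B (x t), x t⟫_ℝ) a b := by
  obtain ⟨C, hC⟩ := hx.exists_bound
  refine absolutelyContinuous_of_dist_le (C := 2 * (‖B‖ * C)) hx fun s hs t ht => ?_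
  have e : ⟪B (x s), x s⟫_ℝ - ⟪B (x t), x t⟫_ℝ
      = ⟪B (x s), x s - x t⟫_ℝ + ⟪B (x s - x t), x t⟫_ℝ := by
    simp only [map_sub, inner_sub_left, inner_sub_right]; ring
  have hC0 : 0 ≤ C := (norm_nonneg _).trans (hC s hs)
  rw [Real.dist_eq, dist_eq_norm, e]
  refine (abs_add_le _ _).trans ?_
  have h1 : |⟪B (x s), x s - x t⟫_ℝ| ≤ ‖B‖ * C * ‖x s - x t‖ := by
    refine (abs_real_inner_le_norm _ _).trans ?_
    gcongr
    exact (B.le_opNorm _).trans (by gcongr; exact hC s hs)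
  have h2 : |⟪B (x s - x t), x t⟫_ℝ| ≤ ‖B‖ * C * ‖x s - x t‖ := by
    refine (abs_real_inner_le_norm _ _).trans ?_
    calc ‖B (x s - x t)‖ * ‖x t‖ ≤ (‖B‖ * ‖x s - x t‖) * C :=
          mul_le_mul (B.le_opNorm _) (hC t ht) (norm_nonneg _) (by positivity)
      _ = _ := by ring
  linarith

theorem intervalIntegrable_of_timeMeasure {f : ℝ → H} (hT : 0 ≤ T)
    (hf : Integrable f (timeMeasure T)) : IntervalIntegrable f volume 0 T := by
  rw [intervalIntegrable_iff_integrableOn_Icc_of_le hT]; exact hf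

theorem ae_timeMeasure {P : ℝ → Prop} :
    (∀ᵐ t ∂(timeMeasure T), P t) ↔ ∀ᵐ t, t ∈ Icc 0 T → P t :=
  ae_restrict_iff' measurableSet_Icc

/-- The end points form a null set, so the one-sided derivatives there play no role and two-sided
derivatives may be used almost everywhere. -/
theorem ae_timeMeasure_mem_Ioo : ∀ᵐ t ∂(timeMeasure T), t ∈ Ioo 0 T := by
  rw [ae_timeMeasure]
  have h₁ : ∀ᵐ x : ℝ, x ≠ 0 := by simp [ae_iff, measure_singleton]
  have h₂ : ∀ᵐ x : ℝ, x ≠ T := by simp [ae_iff, measure_singleton]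
  filter_upwards [h₁, h₂] with t h1 h2 h3
  exact ⟨lt_of_le_of_ne h3.1 (Ne.symm h1), lt_of_le_of_ne h3.2 h2⟩

variable [NormedSpace ℝ H]

theorem IsW1.integrable {q : ℝ≥0∞} (hq : 1 ≤ q) {F F' : ℝ → H} (h : IsW1 T q F F') :
    Integrable F' (timeMeasure T) := h.1.integrable hq

theorem IsW1.norm_sub_le {q : ℝ≥0∞} (hq : 1 ≤ q) (hT : 0 ≤ T) {F F' : ℝ → H}
    (h : IsW1 T q F F') {s t : ℝ} (hs : s ∈ Icc 0 T) (ht : t ∈ Icc 0 T) :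
    ‖F s - F t‖ ≤ |∫ r in s..t, ‖F' r‖| := by
  have hi := intervalIntegrable_of_timeMeasure hT (h.integrable hq)
  have hs' : IntervalIntegrable F' volume 0 s := hi.mono_set (by
    rw [uIcc_of_le hT, uIcc_of_le hs.1]; exact Icc_subset_Icc_right hs.2)
  have ht' : IntervalIntegrable F' volume 0 t := hi.mono_set (by
    rw [uIcc_of_le hT, uIcc_of_le ht.1]; exact Icc_subset_Icc_right ht.2)
  rw [h.2 s hs, h.2 t ht, add_sub_add_left_eq_sub,
    intervalIntegral.integral_interval_sub_left hs' ht', intervalIntegral.integral_symm, norm_neg]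
  exact intervalIntegral.norm_integral_le_abs_integral_norm

/-- The increments of `F` are dominated by those of the scalar primitive of `‖F'‖`. -/
theorem IsW1.absolutelyContinuous {q : ℝ≥0∞} (hq : 1 ≤ q) (hT : 0 ≤ T) {F F' : ℝ → H}
    (h : IsW1 T q F F') : AbsolutelyContinuousOnInterval F 0 T := by
  have hi := intervalIntegrable_of_timeMeasure hT (h.integrable hq)
  have hg := hi.norm.absolutelyContinuousOnInterval_intervalIntegral (c := 0) (by simp)
  refine absolutelyContinuous_of_dist_le (C := 1) hg fun s hs t ht => ?_
  rw [uIcc_of_le hT] at hs ht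
  have hs' : IntervalIntegrable (fun x => ‖F' x‖) volume 0 s := hi.norm.mono_set (by
    rw [uIcc_of_le hT, uIcc_of_le hs.1]; exact Icc_subset_Icc_right hs.2)
  have ht' : IntervalIntegrable (fun x => ‖F' x‖) volume 0 t := hi.norm.mono_set (by
    rw [uIcc_of_le hT, uIcc_of_le ht.1]; exact Icc_subset_Icc_right ht.2)
  rw [one_mul, dist_comm (∫ v in (0 : ℝ)..s, _), Real.dist_eq,
    intervalIntegral.integral_interval_sub_left ht' hs', dist_eq_norm]
  exact h.norm_sub_le hq hT hs ht

theorem IsW1.ae_hasDerivAt [CompleteSpace H] {q : ℝ≥0∞} (hq : 1 ≤ q) (hT : 0 ≤ T) {F F' : ℝ → H}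
    (h : IsW1 T q F F') : ∀ᵐ t ∂(timeMeasure T), HasDerivAt F (F' t) t := by
  have hi := intervalIntegrable_of_timeMeasure hT (h.integrable hq)
  have h1 := ae_timeMeasure.2 (by rw [← uIcc_of_le hT]; exact hi.ae_hasDerivAt_integral)
  filter_upwards [h1, ae_timeMeasure_mem_Ioo] with t h1 h2
  have h3 := (h1 0 (by simp)).const_add (F 0)
  refine h3.congr_of_eventuallyEq ?_
  filter_upwards [Ioo_mem_nhds h2.1 h2.2] with s hs
  exact h.2 s ⟨hs.1.le, hs.2.le⟩

theorem IsW1.norm_sub_le_integral {q : ℝ≥0∞} (hq : 1 ≤ q) (hT : 0 ≤ T) {F F' : ℝ → H}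
    (h : IsW1 T q F F') {s t : ℝ} (hs : s ∈ Icc 0 T) (ht : t ∈ Icc 0 T) :
    ‖F s - F t‖ ≤ ∫ r, ‖F' r‖ ∂(timeMeasure T) := by
  refine (h.norm_sub_le hq hT hs ht).trans ?_
  rw [intervalIntegral.abs_integral_eq_abs_integral_uIoc,
    abs_of_nonneg (integral_nonneg fun _ => norm_nonneg _), timeMeasure]
  refine setIntegral_mono_set (h.integrable hq).norm (ae_of_all _ fun _ => norm_nonneg _) ?_
  refine (uIoc_subset_uIcc.trans ?_).eventuallyLE
  exact uIcc_subset_Icc hs ht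

theorem IsW1.continuousOn {q : ℝ≥0∞} (hq : 1 ≤ q) (hT : 0 ≤ T) {F F' : ℝ → H}
    (h : IsW1 T q F F') : ContinuousOn F (Icc 0 T) := by
  simpa [uIcc_of_le hT] using (h.absolutelyContinuous hq hT).continuousOn

/-- The one-dimensional Sobolev inequality for `W^{1,1}(J; H)`. -/
theorem IsW1.norm_le {q : ℝ≥0∞} (hq : 1 ≤ q) (hT : 0 < T) {F F' : ℝ → H}
    (h : IsW1 T q F F') {t : ℝ} (ht : t ∈ Icc 0 T) :
    T * ‖F t‖ ≤ ∫ r, ‖F r‖ ∂(timeMeasure T) + T * ∫ r, ‖F' r‖ ∂(timeMeasure T) := by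
  set K := ∫ r, ‖F' r‖ ∂(timeMeasure T)
  have hm : ∫ _r, ‖F t‖ ∂(timeMeasure T) = T * ‖F t‖ := by
    simp [timeMeasure, hT.le]
  have hm2 : ∫ _r, K ∂(timeMeasure T) = T * K := by
    simp [timeMeasure, hT.le]
  have hF : Integrable (fun r => ‖F r‖) (timeMeasure T) :=
    ((h.continuousOn hq hT.le).norm).integrableOn_compact isCompact_Icc
  -- The inequality `‖F t‖ ≤ ‖F s‖ + K` is integrated over `s ∈ J`.
  rw [← hm, ← hm2, ← integral_add hF (integrable_const _)]
  refine integral_mono_ae (integrable_const _) (hF.add (integrable_const _)) ?_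
  rw [EventuallyLE, ae_timeMeasure]
  refine ae_of_all _ fun s hs => ?_
  have h1 := h.norm_sub_le_integral hq hT.le ht hs
  have h2 := norm_sub_norm_le (F t) (F s)
  linarith

theorem IsW1.map {H' : Type*} [NormedAddCommGroup H'] [NormedSpace ℝ H'] [CompleteSpace H]
    [CompleteSpace H'] {q : ℝ≥0∞} (hq : 1 ≤ q) (hT : 0 ≤ T) (L : H →L[ℝ] H') {F F' : ℝ → H}
    (h : IsW1 T q F F') : IsW1 T q (fun t => L (F t)) fun t => L (F' t) := by
  refine ⟨L.comp_memLp' h.1, fun t ht => ?_⟩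
  have hi := intervalIntegrable_of_timeMeasure hT (h.integrable hq)
  have ht' : IntervalIntegrable F' volume 0 t := hi.mono_set (by
    rw [uIcc_of_le hT, uIcc_of_le ht.1]; exact Icc_subset_Icc_right ht.2)
  simp only
  rw [h.2 t ht, map_add, L.intervalIntegral_comp_comm ht']

/-- A differential inequality `Y' ≤ 2 g √Y + k` bounds `√Y`. -/
theorem sqrt_le_of_deriv_le (hT : 0 ≤ T) {Y g k : ℝ → ℝ}
    (hY : AbsolutelyContinuousOnInterval Y 0 T) (hY0 : ∀ t ∈ Icc 0 T, 0 ≤ Y t)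
    (hg : Integrable g (timeMeasure T)) (hk : Integrable k (timeMeasure T))
    (hg0 : ∀ t, 0 ≤ g t) (hk0 : ∀ t, 0 ≤ k t)
    (h : ∀ᵐ t ∂(timeMeasure T), deriv Y t ≤ 2 * g t * √(Y t) + k t) {t : ℝ} (ht : t ∈ Icc 0 T) :
    √(Y t) ≤ √(Y 0) + 2 * ∫ s, g s ∂(timeMeasure T) + √(∫ s, k s ∂(timeMeasure T)) := by
  have hc : ContinuousOn Y (Icc 0 T) := by simpa [uIcc_of_le hT] using hY.continuousOn
  -- Integration up to the time `t₁` at which `Y` is largest lets √Y be replaced by its maximum `M`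
  -- under the integral, which leaves the quadratic inequality `M² ≤ Y 0 + 2GM + K`.
  obtain ⟨t₁, ht₁, hmax⟩ := isCompact_Icc.exists_isMaxOn ⟨t, ht⟩ hc
  have hmax' : ∀ s ∈ Icc 0 T, √(Y s) ≤ √(Y t₁) := fun s hs => Real.sqrt_le_sqrt (hmax hs)
  set G := ∫ s, g s ∂(timeMeasure T)
  set K := ∫ s, k s ∂(timeMeasure T)
  set M := √(Y t₁)
  have hG : 0 ≤ G := integral_nonneg hg0
  have hK : 0 ≤ K := integral_nonneg hk0
  have hsub : uIcc 0 t₁ ⊆ uIcc 0 T := by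
    rw [uIcc_of_le ht₁.1, uIcc_of_le hT]; exact Icc_subset_Icc_right ht₁.2
  have hY1 := hY.mono hsub
  have hftc := hY1.integral_deriv_eq_sub
  have hle : Y t₁ - Y 0 ≤ 2 * G * M + K := by
    rw [← hftc, intervalIntegral.integral_of_le ht₁.1]
    have hi : Integrable (fun s => 2 * g s * M + k s) (timeMeasure T) :=
      ((hg.const_mul 2).mul_const M).add hk
    have hs : Ioc 0 t₁ ⊆ Icc 0 T := Ioc_subset_Icc_self.trans (Icc_subset_Icc_right ht₁.2)
    have e : ∫ s, (2 * g s * M + k s) ∂(timeMeasure T) = 2 * G * M + K := by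
      rw [integral_add ((hg.const_mul 2).mul_const M) hk, integral_mul_const, integral_const_mul]
    rw [← e]
    calc ∫ s in Ioc 0 t₁, deriv Y s ≤ ∫ s in Ioc 0 t₁, (2 * g s * M + k s) := by
          refine integral_mono_ae ?_ (hi.mono_measure (Measure.restrict_mono hs le_rfl)) ?_
          · exact (intervalIntegrable_iff_integrableOn_Ioc_of_le ht₁.1).1
              hY1.intervalIntegrable_deriv
          · rw [EventuallyLE, ae_restrict_iff' measurableSet_Ioc]
            filter_upwards [ae_timeMeasure.1 h] with s h1 h2
            refine (h1 (hs h2)).trans ?_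
            have := hmax' s (hs h2)
            have := hg0 s
            gcongr
      _ ≤ _ := setIntegral_mono_set hi
          (ae_of_all _ fun s => add_nonneg
            (mul_nonneg (mul_nonneg zero_le_two (hg0 s)) (Real.sqrt_nonneg _)) (hk0 s))
          hs.eventuallyLE
  have hM2 : M ^ 2 = Y t₁ := Real.sq_sqrt (hY0 _ ht₁)
  have h0 : √(Y 0) ^ 2 = Y 0 := Real.sq_sqrt (hY0 _ (left_mem_Icc.2 hT))
  have hK2 : √K ^ 2 = K := Real.sq_sqrt hK
  have a0 := Real.sqrt_nonneg (Y 0)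
  have a1 := Real.sqrt_nonneg K
  refine (hmax' t ht).trans ?_
  -- If `M > √(Y 0) + 2G + √K`, then `M(M − 2G) > (√(Y 0) + √K)² ≥ Y 0 + K`, which contradicts the
  -- quadratic inequality.
  by_contra! hcon
  have hMpos : 0 ≤ M := Real.sqrt_nonneg _
  nlinarith [mul_nonneg a0 a1, mul_nonneg a0 hG, mul_nonneg a1 hG]

end Time

/-! ### The energy of an abstract poroelastic system -/

/-- The operators of the variational formulation: `A` and `K` represent the elastic energy and the
resistance to flow, `S` the storage, and `P` maps a pressure to the corresponding stress. -/
structure Operators (E F Q : Type*) [NormedAddCommGroup E] [InnerProductSpace ℝ E]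
    [NormedAddCommGroup F] [InnerProductSpace ℝ F] [NormedAddCommGroup Q] [InnerProductSpace ℝ Q]
    where
  A : E →L[ℝ] E
  K : F →L[ℝ] F
  S : Q →L[ℝ] Q
  P : Q →L[ℝ] E
  skew : Submodule ℝ E
  A_symm : ∀ x y, ⟪A x, y⟫_ℝ = ⟪A y, x⟫_ℝ
  K_symm : ∀ x y, ⟪K x, y⟫_ℝ = ⟪K y, x⟫_ℝ
  S_symm : ∀ x y, ⟪S x, y⟫_ℝ = ⟪S y, x⟫_ℝ
  a : ℝ
  a_pos : 0 < a
  A_coercive : ∀ x, a * ‖x‖ ^ 2 ≤ ⟪A x, x⟫_ℝ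
  k : ℝ
  k_pos : 0 < k
  K_coercive : ∀ x, k * ‖x‖ ^ 2 ≤ ⟪K x, x⟫_ℝ
  S_nonneg : ∀ x, 0 ≤ ⟪S x, x⟫_ℝ
  skew_closed : IsClosed (skew : Set E)
  skew_orth : ∀ η ∈ skew, ∀ q, ⟪η, P q⟫_ℝ = 0

section Algebra

variable {E F Q : Type*} [NormedAddCommGroup E] [InnerProductSpace ℝ E]
  [NormedAddCommGroup F] [InnerProductSpace ℝ F] [NormedAddCommGroup Q] [InnerProductSpace ℝ Q]

/-- The discriminant of the nonnegative quadratic `c ↦ ⟪B (x + c y), x + c y⟫` is not positive.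
Definiteness is not needed, so the inequality also covers the storage form, which degenerates where
s₀ vanishes. -/
theorem inner_map_le_sqrt_mul_sqrt {H : Type*} [NormedAddCommGroup H] [InnerProductSpace ℝ H]
    (B : H →L[ℝ] H) (hs : ∀ x y, ⟪B x, y⟫_ℝ = ⟪B y, x⟫_ℝ) (h0 : ∀ x, 0 ≤ ⟪B x, x⟫_ℝ) (x y : H) :
    |⟪B x, y⟫_ℝ| ≤ √⟪B x, x⟫_ℝ * √⟪B y, y⟫_ℝ := by
  rw [← Real.sqrt_mul (h0 x)]
  apply Real.abs_le_sqrt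
  have h (c : ℝ) : 0 ≤ ⟪B y, y⟫_ℝ * (c * c) + (2 * ⟪B x, y⟫_ℝ) * c + ⟪B x, x⟫_ℝ := by
    have := h0 (x + c • y)
    simp only [map_add, map_smul, inner_add_left, inner_add_right, real_inner_smul_left,
      real_inner_smul_right, hs y x] at this
    linarith
  have := discrim_le_zero h
  rw [discrim] at this
  nlinarith

theorem inner_map_self_le {H : Type*} [NormedAddCommGroup H] [InnerProductSpace ℝ H]
    (B : H →L[ℝ] H) (x : H) : ⟪B x, x⟫_ℝ ≤ ‖B‖ * ‖x‖ ^ 2 := by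
  refine (real_inner_le_norm _ _).trans ?_
  have := B.le_opNorm x
  nlinarith [norm_nonneg x]

theorem sqrt_inner_map_self_le {H : Type*} [NormedAddCommGroup H] [InnerProductSpace ℝ H]
    (B : H →L[ℝ] H) (x : H) : √⟪B x, x⟫_ℝ ≤ √‖B‖ * ‖x‖ := by
  refine (Real.sqrt_le_sqrt (inner_map_self_le B x)).trans ?_
  rw [Real.sqrt_mul (norm_nonneg _), Real.sqrt_sq (norm_nonneg _)]

namespace Operators

variable (O : Operators E F Q)

theorem A_nonneg (x : E) : 0 ≤ ⟪O.A x, x⟫_ℝ :=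
  le_trans (mul_nonneg O.a_pos.le (sq_nonneg _)) (O.A_coercive x)

theorem K_nonneg (x : F) : 0 ≤ ⟪O.K x, x⟫_ℝ :=
  le_trans (mul_nonneg O.k_pos.le (sq_nonneg _)) (O.K_coercive x)

theorem norm_le_sqrt_A (x : E) : ‖x‖ ≤ (√O.a)⁻¹ * √⟪O.A x, x⟫_ℝ := by
  have h := Real.sqrt_le_sqrt (O.A_coercive x)
  rw [Real.sqrt_mul O.a_pos.le, Real.sqrt_sq (norm_nonneg _)] at h
  rw [inv_mul_eq_div, le_div_iff₀ (Real.sqrt_pos.2 O.a_pos)]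
  linarith

theorem norm_le_sqrt_K (x : F) : ‖x‖ ≤ (√O.k)⁻¹ * √⟪O.K x, x⟫_ℝ := by
  have h := Real.sqrt_le_sqrt (O.K_coercive x)
  rw [Real.sqrt_mul O.k_pos.le, Real.sqrt_sq (norm_nonneg _)] at h
  rw [inv_mul_eq_div, le_div_iff₀ (Real.sqrt_pos.2 O.k_pos)]
  linarith

/-- The stress `σ + α p I`. -/
def eff (σ : E) (p : Q) : E := σ + O.P p

/-- The energy `(A ψ, ψ) + (S θ, θ)`. -/
def energy (ψ : E) (θ : Q) : ℝ := ⟪O.A ψ, ψ⟫_ℝ + ⟪O.S θ, θ⟫_ℝ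

theorem sqrt_A_le_energy (ψ : E) (θ : Q) : √⟪O.A ψ, ψ⟫_ℝ ≤ √(O.energy ψ θ) :=
  Real.sqrt_le_sqrt (le_add_of_nonneg_right (O.S_nonneg θ))

theorem sqrt_S_le_energy (ψ : E) (θ : Q) : √⟪O.S θ, θ⟫_ℝ ≤ √(O.energy ψ θ) :=
  Real.sqrt_le_sqrt (le_add_of_nonneg_left (O.A_nonneg ψ))

theorem energy_nonneg (ψ : E) (θ : Q) : 0 ≤ O.energy ψ θ := add_nonneg (O.A_nonneg ψ) (O.S_nonneg θ)

theorem sqrt_energy_le (ψ : E) (θ : Q) :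
    √(O.energy ψ θ) ≤ √‖O.A‖ * ‖ψ‖ + √‖O.S‖ * ‖θ‖ := by
  refine le_trans ?_ (add_le_add (sqrt_inner_map_self_le _ _) (sqrt_inner_map_self_le _ _))
  have h1 := Real.sq_sqrt (O.A_nonneg ψ)
  have h2 := Real.sq_sqrt (O.S_nonneg θ)
  have h3 := Real.sqrt_nonneg ⟪O.A ψ, ψ⟫_ℝ
  have h4 := Real.sqrt_nonneg ⟪O.S θ, θ⟫_ℝ
  refine Real.sqrt_le_iff.2 ⟨by positivity, ?_⟩
  unfold energy
  nlinarith [mul_nonneg h3 h4]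

/-- The constant in the energy estimates. -/
def const : ℝ := √‖O.A‖ + (√O.a)⁻¹ + √‖O.S‖ + ‖O.K‖ + √‖O.K‖ + 1

theorem const_pos : 0 < O.const := by unfold const; positivity

/-- The dissipation inequality for the energy `(A ψ, ψ) + (S θ, θ)`. -/
theorem energy_dissipation {ψ ψ' r rγ : E} {θ θ' ρ' : Q} {ζ ρ : F}
    (h : ⟪O.A (ψ' + r), ψ⟫_ℝ + ⟪rγ, ψ⟫_ℝ + ⟪O.S (θ' + ρ'), θ⟫_ℝ + ⟪O.K (ζ + ρ), ζ⟫_ℝ = 0) :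
    2 * (⟪O.A ψ', ψ⟫_ℝ + ⟪O.S θ', θ⟫_ℝ) ≤
      2 * (O.const * (‖r‖ + ‖rγ‖ + ‖ρ'‖)) * √(O.energy ψ θ) + O.const * ‖ρ‖ ^ 2 := by
  simp only [map_add, inner_add_left] at h
  have e1 := O.sqrt_A_le_energy ψ θ
  have e2 := O.sqrt_S_le_energy ψ θ
  set M := √(O.energy ψ θ)
  have hM : 0 ≤ M := Real.sqrt_nonneg _
  have h1 : |⟪O.A r, ψ⟫_ℝ| ≤ √‖O.A‖ * ‖r‖ * M :=
    (inner_map_le_sqrt_mul_sqrt _ O.A_symm O.A_nonneg _ _).trans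
      (mul_le_mul (sqrt_inner_map_self_le _ _) e1 (Real.sqrt_nonneg _) (by positivity))
  have h2 : |⟪O.S ρ', θ⟫_ℝ| ≤ √‖O.S‖ * ‖ρ'‖ * M :=
    (inner_map_le_sqrt_mul_sqrt _ O.S_symm O.S_nonneg _ _).trans
      (mul_le_mul (sqrt_inner_map_self_le _ _) e2 (Real.sqrt_nonneg _) (by positivity))
  have h3 : |⟪rγ, ψ⟫_ℝ| ≤ (√O.a)⁻¹ * ‖rγ‖ * M := by
    refine (abs_real_inner_le_norm _ _).trans ?_
    calc ‖rγ‖ * ‖ψ‖ ≤ ‖rγ‖ * ((√O.a)⁻¹ * M) := by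
          gcongr
          exact (O.norm_le_sqrt_A ψ).trans (by gcongr)
      _ = _ := by ring
  -- Completing the square with `ζ + ρ`: the dissipation absorbs the mixed term, so the flux
  -- residual enters only through `‖ρ‖²`.
  have h4 : -(2 * ⟪O.K ζ, ζ⟫_ℝ + 2 * ⟪O.K ρ, ζ⟫_ℝ) ≤ ‖O.K‖ * ‖ρ‖ ^ 2 := by
    have a1 := O.K_nonneg (ζ + ρ)
    have a2 := O.K_nonneg ζ
    have a3 := inner_map_self_le O.K ρ
    simp only [map_add, inner_add_left, inner_add_right, O.K_symm ζ ρ] at a1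
    linarith
  have h5 : ‖O.K‖ * ‖ρ‖ ^ 2 ≤ O.const * ‖ρ‖ ^ 2 := by
    gcongr
    have : 0 ≤ √‖O.A‖ + (√O.a)⁻¹ + √‖O.S‖ + √‖O.K‖ + 1 := by positivity
    unfold const; linarith
  have h6 : √‖O.A‖ * ‖r‖ * M + (√O.a)⁻¹ * ‖rγ‖ * M + √‖O.S‖ * ‖ρ'‖ * M
      ≤ O.const * (‖r‖ + ‖rγ‖ + ‖ρ'‖) * M := by
    have c1 : √‖O.A‖ ≤ O.const := by
      have : 0 ≤ (√O.a)⁻¹ + √‖O.S‖ + ‖O.K‖ + √‖O.K‖ + 1 := by positivity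
      unfold const; linarith
    have c2 : (√O.a)⁻¹ ≤ O.const := by
      have : 0 ≤ √‖O.A‖ + √‖O.S‖ + ‖O.K‖ + √‖O.K‖ + 1 := by positivity
      unfold const; linarith
    have c3 : √‖O.S‖ ≤ O.const := by
      have : 0 ≤ √‖O.A‖ + (√O.a)⁻¹ + ‖O.K‖ + √‖O.K‖ + 1 := by positivity
      unfold const; linarith
    have : O.const * (‖r‖ + ‖rγ‖ + ‖ρ'‖) * M
      = O.const * ‖r‖ * M + O.const * ‖rγ‖ * M + O.const * ‖ρ'‖ * M := by ring
    rw [this]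
    gcongr
  have := neg_abs_le ⟪O.A r, ψ⟫_ℝ
  have := neg_abs_le ⟪O.S ρ', θ⟫_ℝ
  have := neg_abs_le ⟪rγ, ψ⟫_ℝ
  linarith

/-- The dissipation inequality for the flux energy `(K ζ, ζ)`. -/
theorem flux_dissipation {ψ' r rγ : E} {θ' ρ' : Q} {ζ ζ' ρ : F}
    (h : ⟪O.A (ψ' + r), ψ'⟫_ℝ + ⟪rγ, ψ'⟫_ℝ + ⟪O.S (θ' + ρ'), θ'⟫_ℝ + ⟪O.K (ζ' + ρ), ζ⟫_ℝ = 0) :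
    2 * ⟪O.K ζ', ζ⟫_ℝ ≤
      2 * (O.const * ‖ρ‖) * √⟪O.K ζ, ζ⟫_ℝ + O.const ^ 2 * (‖r‖ + ‖rγ‖ + ‖ρ'‖) ^ 2 := by
  simp only [map_add, inner_add_left] at h
  have h1 : -(⟪O.A r, ψ'⟫_ℝ) ≤ √‖O.A‖ * ‖r‖ * √⟪O.A ψ', ψ'⟫_ℝ :=
    (neg_le_abs _).trans <| (inner_map_le_sqrt_mul_sqrt _ O.A_symm O.A_nonneg _ _).trans
      (by gcongr; exact sqrt_inner_map_self_le _ _)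
  have h2 : -(⟪O.S ρ', θ'⟫_ℝ) ≤ √‖O.S‖ * ‖ρ'‖ * √⟪O.S θ', θ'⟫_ℝ :=
    (neg_le_abs _).trans <| (inner_map_le_sqrt_mul_sqrt _ O.S_symm O.S_nonneg _ _).trans
      (by gcongr; exact sqrt_inner_map_self_le _ _)
  have h4 : -(⟪O.K ρ, ζ⟫_ℝ) ≤ √‖O.K‖ * ‖ρ‖ * √⟪O.K ζ, ζ⟫_ℝ :=
    (neg_le_abs _).trans <| (inner_map_le_sqrt_mul_sqrt _ O.K_symm O.K_nonneg _ _).trans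
      (by gcongr; exact sqrt_inner_map_self_le _ _)
  have h3 : -(⟪rγ, ψ'⟫_ℝ) ≤ (√O.a)⁻¹ * ‖rγ‖ * √⟪O.A ψ', ψ'⟫_ℝ := by
    refine (neg_le_abs _).trans <| (abs_real_inner_le_norm _ _).trans ?_
    calc ‖rγ‖ * ‖ψ'‖ ≤ ‖rγ‖ * ((√O.a)⁻¹ * √⟪O.A ψ', ψ'⟫_ℝ) := by
          gcongr; exact O.norm_le_sqrt_A ψ'
      _ = _ := by ring
  have hA := Real.sq_sqrt (O.A_nonneg ψ')
  have hS := Real.sq_sqrt (O.S_nonneg θ')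
  have hζ := Real.sqrt_nonneg ⟪O.K ζ, ζ⟫_ℝ
  set x := √⟪O.A ψ', ψ'⟫_ℝ
  set y := √⟪O.S θ', θ'⟫_ℝ
  have c1 : √‖O.A‖ * ‖r‖ + (√O.a)⁻¹ * ‖rγ‖ + √‖O.S‖ * ‖ρ'‖ ≤ O.const * (‖r‖ + ‖rγ‖ + ‖ρ'‖) := by
    unfold const
    have : 0 ≤ ‖O.K‖ + √‖O.K‖ + 1 := by positivity
    have a1 : 0 ≤ √‖O.A‖ := by positivity
    have a2 : 0 ≤ (√O.a)⁻¹ := by positivity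
    have a3 : 0 ≤ √‖O.S‖ := by positivity
    nlinarith [norm_nonneg r, norm_nonneg rγ, norm_nonneg ρ', mul_nonneg a1 (norm_nonneg rγ),
      mul_nonneg a1 (norm_nonneg ρ'), mul_nonneg a2 (norm_nonneg r),
      mul_nonneg a2 (norm_nonneg ρ'), mul_nonneg a3 (norm_nonneg r), mul_nonneg a3 (norm_nonneg rγ),
      mul_nonneg this (norm_nonneg r), mul_nonneg this (norm_nonneg rγ),
      mul_nonneg this (norm_nonneg ρ')]
  have c2 : √‖O.K‖ * ‖ρ‖ * √⟪O.K ζ, ζ⟫_ℝ ≤ O.const * ‖ρ‖ * √⟪O.K ζ, ζ⟫_ℝ := by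
    gcongr
    have : 0 ≤ √‖O.A‖ + (√O.a)⁻¹ + √‖O.S‖ + ‖O.K‖ + 1 := by positivity
    unfold const; linarith
  set b := √‖O.A‖ * ‖r‖ + (√O.a)⁻¹ * ‖rγ‖
  set d := √‖O.S‖ * ‖ρ'‖
  have hb : 0 ≤ b := by positivity
  have hd : 0 ≤ d := by positivity
  have c3 : (b + d) ^ 2 ≤ O.const ^ 2 * (‖r‖ + ‖rγ‖ + ‖ρ'‖) ^ 2 := by
    rw [← mul_pow]; gcongr
  -- Young's inequality: the terms `−2x²` and `−2y²` coming from the energy of the time derivatives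
  -- absorb `2bx` and `2dy`. This is the reason why the residuals appear squared.
  nlinarith [sq_nonneg (x - b), sq_nonneg (y - d), mul_nonneg hb hd, sq_nonneg x, sq_nonneg y]

end Operators

end Algebra

/-! ### Stable discretizations of an abstract poroelastic system -/

/-- The spaces of the abstract problem, with the embeddings into the `L²` spaces and the
divergences. -/
structure Embeddings (E V F Q Sg Wd : Type*) [NormedAddCommGroup E] [InnerProductSpace ℝ E]
    [NormedAddCommGroup V] [InnerProductSpace ℝ V] [NormedAddCommGroup F] [InnerProductSpace ℝ F]
    [NormedAddCommGroup Q] [InnerProductSpace ℝ Q] [NormedAddCommGroup Sg] [NormedSpace ℝ Sg]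
    [NormedAddCommGroup Wd] [NormedSpace ℝ Wd] where
  ι : Sg →L[ℝ] E
  δ : Sg →L[ℝ] V
  j : Wd →L[ℝ] F
  d : Wd →L[ℝ] Q
  ι_le : ∀ τ, ‖ι τ‖ ≤ ‖τ‖
  j_le : ∀ w, ‖j w‖ ≤ ‖w‖

variable {E V F Q Sg Wd : Type*} [NormedAddCommGroup E] [InnerProductSpace ℝ E]
    [NormedAddCommGroup V] [InnerProductSpace ℝ V] [NormedAddCommGroup F] [InnerProductSpace ℝ F]
    [NormedAddCommGroup Q] [InnerProductSpace ℝ Q] [NormedAddCommGroup Sg] [NormedSpace ℝ Sg]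
    [NormedAddCommGroup Wd] [NormedSpace ℝ Wd]

/-- Finite-dimensional spaces with the inf-sup conditions. -/
structure Discretization (O : Operators E F Q) (M : Embeddings E V F Q Sg Wd) (c : ℝ) where
  S : Submodule ℝ Sg
  V : Submodule ℝ V
  G : Submodule ℝ E
  W : Submodule ℝ Wd
  Q : Submodule ℝ Q
  finite_S : FiniteDimensional ℝ S
  finite_V : FiniteDimensional ℝ V
  finite_G : FiniteDimensional ℝ G
  finite_W : FiniteDimensional ℝ W
  finite_Q : FiniteDimensional ℝ Q
  G_skew : G ≤ O.skew
  div_S : ∀ τ ∈ S, M.δ τ ∈ V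
  div_W : ∀ w ∈ W, M.d w ∈ Q
  c_nonneg : 0 ≤ c
  infsup_W : ∀ q ∈ Q, ∃ w ∈ W, M.d w = q ∧ ‖w‖ ≤ c * ‖q‖
  infsup_S : ∀ v ∈ V, ∀ η ∈ G, ∃ τ ∈ S, M.δ τ = v ∧
    (∀ η' ∈ G, ⟪M.ι τ, η'⟫_ℝ = ⟪η, η'⟫_ℝ) ∧ ‖τ‖ ≤ c * (‖v‖ + ‖η‖)

attribute [instance] Discretization.finite_S Discretization.finite_V Discretization.finite_G
  Discretization.finite_W Discretization.finite_Q

namespace Discretization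

variable {O : Operators E F Q} {M : Embeddings E V F Q Sg Wd} {c : ℝ} (D : Discretization O M c)

/-- `τ` has the same discrete divergence as `σ`. -/
def DivMatch (τ σ : Sg) : Prop := ∀ v ∈ D.V, ⟪M.δ τ, v⟫_ℝ = ⟪M.δ σ, v⟫_ℝ

/-- The discretely divergence-free, weakly symmetric stresses. -/
def kernel : Submodule ℝ Sg where
  carrier := {τ | τ ∈ D.S ∧ M.δ τ = 0 ∧ ∀ η ∈ D.G, ⟪M.ι τ, η⟫_ℝ = 0}
  zero_mem' := ⟨D.S.zero_mem, by simp, by simp⟩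
  add_mem' := fun {a b} ha hb => ⟨D.S.add_mem ha.1 hb.1, by rw [map_add, ha.2.1, hb.2.1, add_zero],
    fun η h => by rw [map_add, inner_add_left, ha.2.2 η h, hb.2.2 η h, add_zero]⟩
  smul_mem' := fun r a ha => ⟨D.S.smul_mem r ha.1, by rw [map_smul, ha.2.1, smul_zero],
    fun η h => by rw [map_smul, real_inner_smul_left, ha.2.2 η h, mul_zero]⟩

theorem kernel_le : D.kernel ≤ D.S := fun _ h => h.1

instance : FiniteDimensional ℝ D.kernel := Submodule.finiteDimensional_of_le D.kernel_le

/-- A linear selection of stresses with prescribed divergence and prescribed weak skew part. -/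
theorem exists_lift : ∃ L : Sg →L[ℝ] Sg, ∀ σ, L σ ∈ D.S ∧ D.DivMatch (L σ) σ ∧
    ∀ η ∈ D.G, ⟪M.ι (L σ), η⟫_ℝ = ⟪M.ι σ, η⟫_ℝ := by
  -- Divergence together with the projection of the stress onto the discrete rotations. The inf-sup
  -- condition says that this map is onto.
  let B : D.S →ₗ[ℝ] D.V × D.G :=
    ((M.δ.toLinearMap ∘ₗ D.S.subtype).codRestrict D.V fun x => D.div_S _ x.2).prod
      (D.G.orthogonalProjectionOnto.toLinearMap ∘ₗ M.ι.toLinearMap ∘ₗ D.S.subtype)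
  have hB : Function.Surjective B := by
    rintro ⟨v, η⟩
    obtain ⟨τ, h1, h2, h3, -⟩ := D.infsup_S v v.2 η η.2
    refine ⟨⟨τ, h1⟩, Prod.ext (Subtype.ext h2) (Subtype.ext ?_)⟩
    refine D.G.eq_starProjection_of_mem_of_inner_eq_zero η.2 fun w hw => ?_
    rw [inner_sub_left, sub_eq_zero]
    exact h3 w hw
  -- A linear right inverse is automatically continuous in finite dimensions, so the selection
  -- commutes with time derivatives. No bound on its norm is required, since quasi-optimality is
  -- gained afterwards by projecting.
  obtain ⟨R, hR⟩ := B.exists_rightInverse_of_surjective (LinearMap.range_eq_top.2 hB)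
  let R' : D.V × D.G →L[ℝ] D.S := R.toContinuousLinearMap
  let C : Sg →L[ℝ] D.V × D.G :=
    (D.V.orthogonalProjectionOnto ∘L M.δ).prod (D.G.orthogonalProjectionOnto ∘L M.ι)
  refine ⟨D.S.subtypeL ∘L R' ∘L C, fun σ => ?_⟩
  have h : B (R (C σ)) = C σ := LinearMap.congr_fun hR (C σ)
  refine ⟨(R (C σ)).2, fun v hv => ?_, fun η hη => ?_⟩
  · have h1 : M.δ (R (C σ)) = D.V.starProjection (M.δ σ) := congrArg (fun x => (x.1 : V)) h
    change ⟪M.δ (R (C σ)), v⟫_ℝ = _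
    rw [h1]
    have := D.V.starProjection_inner_eq_zero (M.δ σ) v hv
    rw [inner_sub_left] at this
    linarith
  · have h1 : D.G.starProjection (M.ι (R (C σ))) = D.G.starProjection (M.ι σ) :=
      congrArg (fun x => (x.2 : E)) h
    change ⟪M.ι (R (C σ)), η⟫_ℝ = _
    have e1 := D.G.starProjection_inner_eq_zero (M.ι σ) η hη
    have e2 := D.G.starProjection_inner_eq_zero (M.ι (R (C σ))) η hη
    rw [inner_sub_left] at e1 e2
    rw [h1] at e2
    linarith

/-- The weakly symmetric, divergence preserving quasi-optimal projection. -/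
theorem exists_interpolation : ∃ L : Sg →L[ℝ] Sg, ∀ σ, L σ ∈ D.S ∧ D.DivMatch (L σ) σ ∧
    (∀ η ∈ D.G, ⟪M.ι (L σ), η⟫_ℝ = ⟪M.ι σ, η⟫_ℝ) ∧
    ∀ τ ∈ D.S, D.DivMatch τ σ → ‖M.ι σ - M.ι (L σ)‖ ≤ (1 + c) * ‖M.ι σ - M.ι τ‖ := by
  obtain ⟨L, hL⟩ := D.exists_lift
  -- The lift is corrected by an element of the kernel, so the constraints are kept. The correction
  -- comes from the orthogonal projection onto the image `Z` of the kernel, which makes the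
  -- corrected stress the best one among all that satisfy the constraints. As `ι` need not be
  -- injective, a linear section `R` over `Z` is chosen.
  let Z : Submodule ℝ E := D.kernel.map M.ι.toLinearMap
  let B : D.kernel →ₗ[ℝ] Z := M.ι.toLinearMap.submoduleMap D.kernel
  obtain ⟨R, hR⟩ := B.exists_rightInverse_of_surjective
    (LinearMap.range_eq_top.2 (M.ι.toLinearMap.submoduleMap_surjective D.kernel))
  let R' : Z →L[ℝ] D.kernel := R.toContinuousLinearMap
  have hR' (z : Z) : M.ι (R' z) = z := congrArg Subtype.val (LinearMap.congr_fun hR z)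
  let N : Sg →L[ℝ] Sg :=
    D.kernel.subtypeL ∘L R' ∘L Z.orthogonalProjectionOnto ∘L (M.ι - M.ι ∘L L)
  have hN (σ : Sg) : N σ ∈ D.kernel := (R' _).2
  have hN' (σ : Sg) : M.ι (N σ) = Z.starProjection (M.ι σ - M.ι (L σ)) := hR' _
  refine ⟨L + N, fun σ => ⟨D.S.add_mem (hL σ).1 (D.kernel_le (hN σ)), fun v hv => ?_,
    fun η hη => ?_, fun τ hτ hm => ?_⟩⟩
  · rw [add_apply, map_add, (hN σ).2.1, add_zero]
    exact (hL σ).2.1 v hv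
  · rw [add_apply, map_add, inner_add_left, (hN σ).2.2 η hη, add_zero]
    exact (hL σ).2.2 η hη
  -- The competitor `τ` has the right divergence but not the right weak skew part. Adding a
  -- divergence-free `τ'` that carries the missing skew part makes it admissible, at a cost of at
  -- most `c ‖ι σ − ι τ‖`; hence the factor `1 + c`.
  · obtain ⟨τ', h1, h2, h3, h4⟩ := D.infsup_S 0 D.V.zero_mem
      (D.G.starProjection (M.ι σ - M.ι τ)) (D.G.starProjection_apply_mem _)
    have hk : τ + τ' - L σ ∈ D.kernel := by
      refine ⟨D.S.sub_mem (D.S.add_mem hτ h1) (hL σ).1, ?_, fun η hη => ?_⟩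
      · have hmem : M.δ (τ + τ' - L σ) ∈ D.V :=
          D.div_S _ (D.S.sub_mem (D.S.add_mem hτ h1) (hL σ).1)
        rw [← inner_self_eq_zero (𝕜 := ℝ)]
        nth_rewrite 1 [map_sub, map_add, h2, add_zero]
        rw [inner_sub_left, hm _ hmem, (hL σ).2.1 _ hmem, sub_self]
      · have e := D.G.starProjection_inner_eq_zero (M.ι σ - M.ι τ) η hη
        rw [map_sub, map_add, inner_sub_left, inner_add_left, h3 η hη, (hL σ).2.2 η hη]
        rw [inner_sub_left, inner_sub_left] at e
        linarith
    have hmin : ‖M.ι σ - M.ι (L σ) - Z.starProjection (M.ι σ - M.ι (L σ))‖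
        ≤ ‖M.ι σ - M.ι (L σ) - M.ι (τ + τ' - L σ)‖ := by
      rw [Z.starProjection_minimal]
      exact ciInf_le ⟨0, by rintro _ ⟨x, rfl⟩; exact norm_nonneg _⟩
        (⟨M.ι (τ + τ' - L σ), Submodule.mem_map_of_mem hk⟩ : Z)
    have e1 : M.ι σ - M.ι ((L + N) σ)
        = M.ι σ - M.ι (L σ) - Z.starProjection (M.ι σ - M.ι (L σ)) := by
      rw [add_apply, map_add, hN']; abel
    have e2 : M.ι σ - M.ι (L σ) - M.ι (τ + τ' - L σ) = (M.ι σ - M.ι τ) - M.ι τ' := by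
      simp only [map_sub, map_add]; abel
    have h5 : ‖M.ι τ'‖ ≤ c * ‖M.ι σ - M.ι τ‖ := by
      refine (M.ι_le _).trans (h4.trans ?_)
      rw [norm_zero, zero_add]
      exact mul_le_mul_of_nonneg_left (D.G.norm_starProjection_apply_le _) D.c_nonneg
    rw [e1]
    refine hmin.trans ?_
    rw [e2]
    refine (norm_sub_le _ _).trans ?_
    linarith

end Discretization

/-! ### Error equations and energy estimates -/

section Derivatives

variable {H : Type*} [NormedAddCommGroup H] [NormedSpace ℝ H] {T : ℝ}

theorem hasDerivAt_dt {F : ℝ → H} (hF : ContDiffOn ℝ 1 F (Icc 0 T)) {t : ℝ} (ht : t ∈ Ioo 0 T) :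
    HasDerivAt F (dt T F t) t := by
  have hn : Icc 0 T ∈ 𝓝 t := Icc_mem_nhds ht.1 ht.2
  exact ((hF.differentiableOn one_ne_zero t (Ioo_subset_Icc_self ht)).hasDerivWithinAt).hasDerivAt hn

/-- Derivatives are limits of elements of the span of the values, and `Z` is closed. This is applied
to the discrete kernel, to the discrete pressures and to the skew fields. -/
theorem mem_of_hasDerivAt {Z : Submodule ℝ H} (hZ : IsClosed (Z : Set H)) {F : ℝ → H} {F' : H}
    {t : ℝ} (ht : t ∈ Ioo 0 T) (h : HasDerivAt F F' t) (hm : ∀ s ∈ Icc 0 T, F s ∈ Z) : F' ∈ Z := by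
  have h1 := range_derivWithin_subset_closure_span_image F (s := Icc 0 T) (t := Icc 0 T)
    (by rw [inter_self]; exact subset_closure) (mem_range_self t)
  rw [(h.hasDerivWithinAt).derivWithin
    ((uniqueDiffOn_Icc (ht.1.trans ht.2)) t (Ioo_subset_Icc_self ht))] at h1
  have h2 : closure (Submodule.span ℝ (F '' Icc 0 T) : Set H) ⊆ Z :=
    closure_minimal (Submodule.span_le.2 (by rintro _ ⟨s, hs, rfl⟩; exact hm s hs)) hZ
  exact h2 h1

theorem hasDerivAt_quadratic {H : Type*} [NormedAddCommGroup H] [InnerProductSpace ℝ H]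
    (B : H →L[ℝ] H) (hB : ∀ x y, ⟪B x, y⟫_ℝ = ⟪B y, x⟫_ℝ) {x : ℝ → H} {x' : H} {t : ℝ}
    (h : HasDerivAt x x' t) : HasDerivAt (fun s => ⟪B (x s), x s⟫_ℝ) (2 * ⟪B x', x t⟫_ℝ) t := by
  have := (B.hasFDerivAt.comp_hasDerivAt t h).inner ℝ h
  simp only [Function.comp_apply] at this
  rw [hB (x t) x'] at this
  rw [← two_mul] at this
  exact this

end Derivatives

variable {E V F Q Sg Wd : Type*} [NormedAddCommGroup E] [InnerProductSpace ℝ E]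
    [NormedAddCommGroup V] [InnerProductSpace ℝ V] [NormedAddCommGroup F] [InnerProductSpace ℝ F]
    [NormedAddCommGroup Q] [InnerProductSpace ℝ Q] [NormedAddCommGroup Sg] [NormedSpace ℝ Sg]
    [NormedAddCommGroup Wd] [NormedSpace ℝ Wd]

/-- The error equations satisfied by an exact and a semidiscrete solution. -/
structure ErrorEqs {O : Operators E F Q} {M : Embeddings E V F Q Sg Wd} {c : ℝ}
    (D : Discretization O M c) (T : ℝ) (σ σh : ℝ → Sg) (u uh : ℝ → V) (γ γh : ℝ → E)
    (z zh : ℝ → Wd) (p ph : ℝ → Q) : Prop where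
  σ_reg : ContDiffOn ℝ 1 σ (Icc 0 T)
  σh_reg : ContDiffOn ℝ 1 σh (Icc 0 T)
  p_reg : ContDiffOn ℝ 1 p (Icc 0 T)
  ph_reg : ContDiffOn ℝ 1 ph (Icc 0 T)
  σh_mem : ∀ t ∈ Icc 0 T, σh t ∈ D.S
  uh_mem : ∀ t ∈ Icc 0 T, uh t ∈ D.V
  γh_mem : ∀ t ∈ Icc 0 T, γh t ∈ D.G
  zh_mem : ∀ t ∈ Icc 0 T, zh t ∈ D.W
  ph_mem : ∀ t ∈ Icc 0 T, ph t ∈ D.Q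
  γ_skew : ∀ t ∈ Icc 0 T, γ t ∈ O.skew
  eq1 : ∀ t ∈ Icc 0 T, ∀ τ ∈ D.S,
    ⟪O.A (O.eff (M.ι (σ t - σh t)) (p t - ph t)), M.ι τ⟫_ℝ + ⟪u t - uh t, M.δ τ⟫_ℝ
      + ⟪γ t - γh t, M.ι τ⟫_ℝ = 0
  eq2v : ∀ t ∈ Icc 0 T, ∀ v ∈ D.V, ⟪M.δ (σ t - σh t), v⟫_ℝ = 0
  eq2η : ∀ t ∈ Icc 0 T, ∀ η ∈ D.G, ⟪M.ι (σ t - σh t), η⟫_ℝ = 0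
  eq3h : ∀ t ∈ Icc 0 T, ∀ w ∈ D.W, ⟪O.K (M.j (zh t)), M.j w⟫_ℝ + ⟪ph t, M.d w⟫_ℝ = 0
  eq3 : ∀ t ∈ Icc 0 T, ∀ w ∈ D.W, ⟪O.K (M.j (z t - zh t)), M.j w⟫_ℝ + ⟪p t - ph t, M.d w⟫_ℝ = 0
  eq4 : ∀ t ∈ Icc 0 T, ∀ q ∈ D.Q,
    ⟪O.S (dt T p t - dt T ph t), q⟫_ℝ
      + ⟪O.A (O.eff (M.ι (dt T σ t - dt T σh t)) (dt T p t - dt T ph t)), O.P q⟫_ℝ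
      - ⟪M.d (z t - zh t), q⟫_ℝ = 0

namespace ErrorEqs

variable {O : Operators E F Q} {M : Embeddings E V F Q Sg Wd} {c : ℝ}
  {D : Discretization O M c} {T : ℝ} {σ σh : ℝ → Sg} {u uh : ℝ → V} {γ γh : ℝ → E}
  {z zh : ℝ → Wd} {p ph : ℝ → Q}

theorem eff_sub (σ σ' : E) (p p' : Q) : O.eff (σ - σ') (p - p') = O.eff σ p - O.eff σ' p' := by
  simp only [Operators.eff, map_sub]; abel

theorem eff_add (σ σ' : E) (p p' : Q) : O.eff (σ + σ') (p + p') = O.eff σ p + O.eff σ' p' := by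
  simp only [Operators.eff, map_add]; abel

theorem norm_eff_le (σ : E) (p : Q) : ‖O.eff σ p‖ ≤ ‖σ‖ + ‖O.P‖ * ‖p‖ :=
  (norm_add_le _ _).trans (add_le_add_right (O.P.le_opNorm p) _)

theorem hasDerivAt_eff {x : ℝ → E} {y : ℝ → Q} {x' : E} {y' : Q} {t : ℝ} (hx : HasDerivAt x x' t)
    (hy : HasDerivAt y y' t) : HasDerivAt (fun s => O.eff (x s) (y s)) (O.eff x' y') t :=
  hx.add (O.P.hasFDerivAt.comp_hasDerivAt t hy)

theorem inner_starProjection (D : Discretization O M c) (q : Q) {q' : Q} (hq : q' ∈ D.Q) :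
    ⟪D.Q.starProjection q, q'⟫_ℝ = ⟪q, q'⟫_ℝ := by
  have := D.Q.starProjection_inner_eq_zero q q' hq
  rw [inner_sub_left] at this
  linarith

section

variable (h : ErrorEqs D T σ σh u uh γ γh z zh p ph)
include h

/-- The displacement and the discrete rotation drop out on the discrete kernel. -/
theorem eq1_kernel {t : ℝ} (ht : t ∈ Icc 0 T) {τ : Sg} (hτ : τ ∈ D.kernel) :
    ⟪O.A (O.eff (M.ι (σ t - σh t)) (p t - ph t)), M.ι τ⟫_ℝ + ⟪γ t, M.ι τ⟫_ℝ = 0 := by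
  have := h.eq1 t ht τ hτ.1
  rw [hτ.2.1, inner_zero_right, add_zero, inner_sub_left, real_inner_comm _ (γh t),
    hτ.2.2 _ (h.γh_mem t ht), sub_zero] at this
  exact this

/-- The kernel identity is differentiated with `τ` held fixed. The projection of `γ'` can be
subtracted because kernel elements are orthogonal to the discrete rotations. Neither the
displacements nor `γh` have to be differentiable. -/
theorem eq1_deriv {t : ℝ} (ht : t ∈ Ioo 0 T) {γ' : E} (hγ : HasDerivAt γ γ' t) {τ : Sg}
    (hτ : τ ∈ D.kernel) :
    ⟪O.A (O.eff (M.ι (dt T σ t - dt T σh t)) (dt T p t - dt T ph t)), M.ι τ⟫_ℝ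
      + ⟪γ' - D.G.starProjection γ', M.ι τ⟫_ℝ = 0 := by
  have hσ := M.ι.hasFDerivAt.comp_hasDerivAt t
    ((hasDerivAt_dt h.σ_reg ht).sub (hasDerivAt_dt h.σh_reg ht))
  have hp := (hasDerivAt_dt h.p_reg ht).sub (hasDerivAt_dt h.ph_reg ht)
  have h1 := (O.A.hasFDerivAt.comp_hasDerivAt t (hasDerivAt_eff (O := O) hσ hp)).inner ℝ
    (hasDerivAt_const t (M.ι τ))
  have h2 := hγ.inner ℝ (hasDerivAt_const t (M.ι τ))
  have h3 := h1.add h2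
  have h4 := h3.congr_of_eventuallyEq (f₁ := fun _ => (0 : ℝ)) (by
    filter_upwards [Icc_mem_nhds ht.1 ht.2] with s hs
    exact (h.eq1_kernel hs hτ).symm)
  have h5 := h4.unique (hasDerivAt_const t 0)
  simp only [inner_zero_right, zero_add] at h5
  rw [inner_sub_left, real_inner_comm _ (D.G.starProjection γ'),
    hτ.2.2 _ (D.G.starProjection_apply_mem _), sub_zero]
  exact h5

/-- Being skew, the residual is orthogonal to every `O.P q`, so testing it with a stress is the same
as testing it with the stress augmented by the pressure. -/
theorem rotation_residual_skew {t : ℝ} (ht : t ∈ Ioo 0 T) {γ' : E} (hγ : HasDerivAt γ γ' t) :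
    γ' - D.G.starProjection γ' ∈ O.skew :=
  O.skew.sub_mem (mem_of_hasDerivAt O.skew_closed ht hγ h.γ_skew)
    (D.G_skew (D.G.starProjection_apply_mem _))

variable {L : Sg →L[ℝ] Sg} (hL : ∀ σ, L σ ∈ D.S ∧ D.DivMatch (L σ) σ ∧
    ∀ η ∈ D.G, ⟪M.ι (L σ), η⟫_ℝ = ⟪M.ι σ, η⟫_ℝ)
include hL

/-- The divergence of the difference belongs to the discrete displacements and is orthogonal to all
of them, so it vanishes. -/
theorem interp_sub_mem_kernel {t : ℝ} (ht : t ∈ Icc 0 T) : L (σ t) - σh t ∈ D.kernel := by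
  refine ⟨D.S.sub_mem (hL _).1 (h.σh_mem t ht), ?_, fun η hη => ?_⟩
  · have hm : M.δ (L (σ t) - σh t) ∈ D.V :=
      D.div_S _ (D.S.sub_mem (hL _).1 (h.σh_mem t ht))
    rw [← inner_self_eq_zero (𝕜 := ℝ)]
    nth_rewrite 1 [map_sub]
    rw [inner_sub_left, (hL _).2.1 _ hm, ← inner_sub_left, ← map_sub]
    exact h.eq2v t ht _ hm
  · rw [map_sub, inner_sub_left, (hL _).2.2 η hη, ← inner_sub_left, ← map_sub]
    exact h.eq2η t ht η hη

omit hL in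
theorem hasDerivAt_interp_sub {t : ℝ} (ht : t ∈ Ioo 0 T) :
    HasDerivAt (fun s => L (σ s) - σh s) (L (dt T σ t) - dt T σh t) t :=
  (L.hasFDerivAt.comp_hasDerivAt t (hasDerivAt_dt h.σ_reg ht)).sub (hasDerivAt_dt h.σh_reg ht)

theorem interp_sub_deriv_mem_kernel {t : ℝ} (ht : t ∈ Ioo 0 T) :
    L (dt T σ t) - dt T σh t ∈ D.kernel :=
  mem_of_hasDerivAt (Submodule.closed_of_finiteDimensional _) ht (h.hasDerivAt_interp_sub ht)
    fun _ hs => h.interp_sub_mem_kernel hL hs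

omit hL in
theorem hasDerivAt_proj_sub {t : ℝ} (ht : t ∈ Ioo 0 T) :
    HasDerivAt (fun s => D.Q.starProjection (p s) - ph s)
      (D.Q.starProjection (dt T p t) - dt T ph t) t :=
  (D.Q.starProjection.hasFDerivAt.comp_hasDerivAt t (hasDerivAt_dt h.p_reg ht)).sub
    (hasDerivAt_dt h.ph_reg ht)

omit hL in
theorem proj_sub_deriv_mem {t : ℝ} (ht : t ∈ Ioo 0 T) :
    D.Q.starProjection (dt T p t) - dt T ph t ∈ D.Q :=
  mem_of_hasDerivAt (Submodule.closed_of_finiteDimensional _) ht (h.hasDerivAt_proj_sub ht)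
    fun s hs => D.Q.sub_mem (D.Q.starProjection_apply_mem _) (h.ph_mem s hs)

/-- The energy estimate for the stress and the pressure. -/
theorem energy_estimate (hT : 0 < T) {γ' : ℝ → E} (hγ : ∀ᵐ t ∂(timeMeasure T), HasDerivAt γ (γ' t) t)
    {g k : ℝ → ℝ} (hg : Integrable g (timeMeasure T)) (hk : Integrable k (timeMeasure T))
    (hg0 : ∀ t, 0 ≤ g t) (hk0 : ∀ t, 0 ≤ k t)
    (hgb : ∀ᵐ t ∂(timeMeasure T), ‖O.eff (M.ι (dt T σ t - L (dt T σ t)))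
        (dt T p t - D.Q.starProjection (dt T p t))‖ + ‖γ' t - D.G.starProjection (γ' t)‖
        + ‖dt T p t - D.Q.starProjection (dt T p t)‖ ≤ g t)
    (hkb : ∀ᵐ t ∂(timeMeasure T), ∃ zt ∈ D.W, (∀ q ∈ D.Q, ⟪M.d zt, q⟫_ℝ = ⟪M.d (z t), q⟫_ℝ) ∧
      ‖M.j (z t - zt)‖ ^ 2 ≤ k t) {t : ℝ} (ht : t ∈ Icc 0 T) :
    √(O.energy (O.eff (M.ι (L (σ t) - σh t)) (D.Q.starProjection (p t) - ph t))
      (D.Q.starProjection (p t) - ph t)) ≤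
    √(O.energy (O.eff (M.ι (L (σ 0) - σh 0)) (D.Q.starProjection (p 0) - ph 0))
      (D.Q.starProjection (p 0) - ph 0))
      + 2 * ∫ s, O.const * g s ∂(timeMeasure T) + √(∫ s, O.const * k s ∂(timeMeasure T)) := by
  have hθp : ContDiffOn ℝ 1 (fun s => D.Q.starProjection (p s) - ph s) (Icc 0 T) :=
    (D.Q.starProjection.contDiff.comp_contDiffOn h.p_reg).sub h.ph_reg
  have hθσ : ContDiffOn ℝ 1 (fun s => M.ι (L (σ s) - σh s)) (Icc 0 T) :=
    M.ι.contDiff.comp_contDiffOn ((L.contDiff.comp_contDiffOn h.σ_reg).sub h.σh_reg)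
  have hψ : ContDiffOn ℝ 1 (fun s => O.eff (M.ι (L (σ s) - σh s)) (D.Q.starProjection (p s) - ph s))
      (Icc 0 T) := hθσ.add (O.P.contDiff.comp_contDiffOn hθp)
  rw [← uIcc_of_le hT.le] at hψ hθp
  refine sqrt_le_of_deriv_le hT.le
    (Y := fun s => O.energy (O.eff (M.ι (L (σ s) - σh s)) (D.Q.starProjection (p s) - ph s))
      (D.Q.starProjection (p s) - ph s))
    ((absolutelyContinuous_quadratic O.A hψ.absolutelyContinuousOnInterval).add
      (absolutelyContinuous_quadratic O.S hθp.absolutelyContinuousOnInterval))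
    (fun _ _ => O.energy_nonneg _ _) (hg.const_mul _) (hk.const_mul _)
    (fun t => mul_nonneg O.const_pos.le (hg0 t)) (fun t => mul_nonneg O.const_pos.le (hk0 t)) ?_ ht
  filter_upwards [hγ, hgb, hkb, ae_timeMeasure_mem_Ioo] with s hγs hgs hks hs
  obtain ⟨zt, hzt, hzd, hzb⟩ := hks
  have hs' := Ioo_subset_Icc_self hs
  have hdσ := M.ι.hasFDerivAt.comp_hasDerivAt s (h.hasDerivAt_interp_sub (L := L) hs)
  have hdp := h.hasDerivAt_proj_sub hs
  have hd := (hasDerivAt_quadratic O.A O.A_symm (hasDerivAt_eff (O := O) hdσ hdp)).add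
    (hasDerivAt_quadratic O.S O.S_symm hdp)
  have hd' : deriv (fun s => O.energy (O.eff (M.ι (L (σ s) - σh s))
    (D.Q.starProjection (p s) - ph s)) (D.Q.starProjection (p s) - ph s)) s = _ := hd.deriv
  rw [hd']
  have hk1 := h.interp_sub_mem_kernel hL hs'
  set θ := D.Q.starProjection (p s) - ph s with hθ
  have hθm : θ ∈ D.Q := D.Q.sub_mem (D.Q.starProjection_apply_mem _) (h.ph_mem s hs')
  have hw : zt - zh s ∈ D.W := D.W.sub_mem hzt (h.zh_mem s hs')
  have e1 := h.eq1_deriv hs hγs hk1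
  have e3 := h.eq3 s hs' _ hw
  have e4 := h.eq4 s hs' θ hθm
  have esk := O.skew_orth _ (h.rotation_residual_skew hs hγs) θ
  -- The sum of three equations: the differentiated stress equation tested with the stress
  -- difference, the mass equation tested with `θ`, and Darcy's law tested with `zt − zh s`. All
  -- errors are split into a discrete part and a residual.
  have key : ⟪O.A (O.eff (M.ι (L (dt T σ s) - dt T σh s)) (D.Q.starProjection (dt T p s) - dt T ph s)
        + O.eff (M.ι (dt T σ s - L (dt T σ s))) (dt T p s - D.Q.starProjection (dt T p s))),
        O.eff (M.ι (L (σ s) - σh s)) θ⟫_ℝ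
      + ⟪γ' s - D.G.starProjection (γ' s), O.eff (M.ι (L (σ s) - σh s)) θ⟫_ℝ
      + ⟪O.S ((D.Q.starProjection (dt T p s) - dt T ph s)
        + (dt T p s - D.Q.starProjection (dt T p s))), θ⟫_ℝ
      + ⟪O.K (M.j (zt - zh s) + M.j (z s - zt)), M.j (zt - zh s)⟫_ℝ = 0 := by
    have a1 : O.eff (M.ι (L (dt T σ s) - dt T σh s)) (D.Q.starProjection (dt T p s) - dt T ph s)
        + O.eff (M.ι (dt T σ s - L (dt T σ s))) (dt T p s - D.Q.starProjection (dt T p s))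
        = O.eff (M.ι (dt T σ s - dt T σh s)) (dt T p s - dt T ph s) := by
      rw [← eff_add, ← map_add]; congr 2 <;> abel
    have a2 : (D.Q.starProjection (dt T p s) - dt T ph s)
        + (dt T p s - D.Q.starProjection (dt T p s)) = dt T p s - dt T ph s := by abel
    have a3 : M.j (zt - zh s) + M.j (z s - zt) = M.j (z s - zh s) := by
      rw [← map_add]; congr 1; abel
    -- The coupling terms of the mass equation and of Darcy's law agree: `zt` has the divergence of
    -- `z s` as seen by `D.Q`, and discrete divergences lie in `D.Q`, so they do not notice the
    -- projection of the pressure.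
    have a4 : ⟪M.d (z s - zh s), θ⟫_ℝ = ⟪p s - ph s, M.d (zt - zh s)⟫_ℝ := by
      have b1 : ⟪p s - ph s, M.d (zt - zh s)⟫_ℝ = ⟪θ, M.d (zt - zh s)⟫_ℝ := by
        rw [hθ, inner_sub_left, inner_sub_left, inner_starProjection D _ (D.div_W _ hw)]
      rw [b1, real_inner_comm, map_sub, map_sub, inner_sub_right, inner_sub_right,
        real_inner_comm _ θ, real_inner_comm (M.d zt) θ, hzd θ hθm]
    rw [a1, a2, a3]
    -- The `A`-terms of the stress and mass equations merge into one with the test function `ι(…) +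
    -- P θ`; the rotation residual joins for free since `esk` makes its product with `P θ` zero.
    change ⟪_, M.ι (L (σ s) - σh s) + O.P θ⟫_ℝ + ⟪_, M.ι (L (σ s) - σh s) + O.P θ⟫_ℝ + _ + _ = 0
    rw [inner_add_right, inner_add_right, esk]
    linarith
  have hfin := O.energy_dissipation key
  have c1 : 2 * (O.const * (‖O.eff (M.ι (dt T σ s - L (dt T σ s)))
        (dt T p s - D.Q.starProjection (dt T p s))‖ + ‖γ' s - D.G.starProjection (γ' s)‖
        + ‖dt T p s - D.Q.starProjection (dt T p s)‖))
        * √(O.energy (O.eff (M.ι (L (σ s) - σh s)) θ) θ)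
      ≤ 2 * (O.const * g s) * √(O.energy (O.eff (M.ι (L (σ s) - σh s)) θ) θ) := by
    have := O.const_pos.le
    gcongr
  have c2 : O.const * ‖M.j (z s - zt)‖ ^ 2 ≤ O.const * k s := by
    have := O.const_pos.le
    gcongr
  calc _ = 2 * (⟪O.A (O.eff (M.ι (L (dt T σ s) - dt T σh s))
        (D.Q.starProjection (dt T p s) - dt T ph s)), O.eff (M.ι (L (σ s) - σh s)) θ⟫_ℝ
        + ⟪O.S (D.Q.starProjection (dt T p s) - dt T ph s), θ⟫_ℝ) := by rw [mul_add]; rfl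
    _ ≤ _ := hfin.trans (add_le_add c1 c2)

end

end ErrorEqs

/-! ### Time regularity of the discrete flux, the flux energy and the stationary estimates -/

variable {E V F Q Sg Wd : Type*} [NormedAddCommGroup E] [InnerProductSpace ℝ E]
    [NormedAddCommGroup V] [InnerProductSpace ℝ V] [NormedAddCommGroup F] [InnerProductSpace ℝ F]
    [NormedAddCommGroup Q] [InnerProductSpace ℝ Q] [NormedAddCommGroup Sg] [NormedSpace ℝ Sg]
    [NormedAddCommGroup Wd] [NormedSpace ℝ Wd]

/-- A function with values in a finite-dimensional space is smooth if it is so after application of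
the symmetric coercive operator `B` in the weak sense. -/
theorem contDiffOn_of_weak {H : Type*} [NormedAddCommGroup H] [InnerProductSpace ℝ H]
    {B : H →L[ℝ] H} {k : ℝ} (hk : 0 < k) (hB : ∀ x, k * ‖x‖ ^ 2 ≤ ⟪B x, x⟫_ℝ)
    (Z : Submodule ℝ H) [FiniteDimensional ℝ Z] {x : ℝ → H} {s : Set ℝ} (hx : ∀ t ∈ s, x t ∈ Z)
    (hd : ∀ y ∈ Z, ContDiffOn ℝ 1 (fun t => ⟪B (x t), y⟫_ℝ) s) : ContDiffOn ℝ 1 x s := by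
  -- The compression of `B` to `Z` is injective by coercivity, hence invertible in finite
  -- dimensions. Thus `x t` is a fixed linear image of the coordinates `⟪B (x t), b i⟫`, which are
  -- smooth by assumption.
  let N : Z →ₗ[ℝ] Z := (Z.orthogonalProjectionOnto ∘L B ∘L Z.subtypeL).toLinearMap
  have hN (y w : Z) : ⟪((N y : Z) : H), w⟫_ℝ = ⟪B y, w⟫_ℝ := by
    have := Z.starProjection_inner_eq_zero (B y) w w.2
    rw [inner_sub_left] at this
    change ⟪Z.starProjection (B y), (w : H)⟫_ℝ = _
    linarith
  have hinj : Function.Injective N := by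
    rw [← LinearMap.ker_eq_bot, LinearMap.ker_eq_bot']
    intro y hy
    have h1 := hN y y
    rw [hy] at h1
    have h2 := hB y
    rw [← h1] at h2
    simp only [Submodule.coe_zero, inner_zero_left] at h2
    have h3 : ‖(y : H)‖ ^ 2 = 0 := le_antisymm (by nlinarith) (sq_nonneg _)
    exact Subtype.ext (by simpa using h3)
  let e : Z ≃ₗ[ℝ] Z := LinearEquiv.ofInjectiveEndo N hinj
  let e' : Z →L[ℝ] Z := (e.symm : Z →ₗ[ℝ] Z).toContinuousLinearMap
  let b := stdOrthonormalBasis ℝ Z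
  have hrep : ∀ t ∈ s, x t = e' (∑ i, ⟪B (x t), (b i : H)⟫_ℝ • b i) := by
    intro t ht
    have h1 : N ⟨x t, hx t ht⟩ = ∑ i, ⟪B (x t), (b i : H)⟫_ℝ • b i := by
      rw [← b.sum_repr' (N ⟨x t, hx t ht⟩)]
      refine Finset.sum_congr rfl fun i _ => ?_
      rw [real_inner_comm]
      congr 1
      exact hN ⟨x t, hx t ht⟩ (b i)
    rw [← h1]
    exact (congrArg Subtype.val (e.symm_apply_apply ⟨x t, hx t ht⟩)).symm
  refine ContDiffOn.congr ?_ hrep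
  refine Z.subtypeL.contDiff.comp_contDiffOn (e'.contDiff.comp_contDiffOn ?_)
  exact ContDiffOn.sum fun i _ => (hd _ (b i).2).smul contDiffOn_const

namespace ErrorEqs

variable {O : Operators E F Q} {M : Embeddings E V F Q Sg Wd} {c : ℝ}
  {D : Discretization O M c} {T : ℝ} {σ σh : ℝ → Sg} {u uh : ℝ → V} {γ γh : ℝ → E}
  {z zh : ℝ → Wd} {p ph : ℝ → Q}
  (h : ErrorEqs D T σ σh u uh γ γh z zh p ph)
include h

/-- A solution has a flux that is merely continuous in time. The discrete Darcy law expresses the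
discrete flux through `ph`, from which it inherits a continuous derivative. -/
theorem zh_reg : ContDiffOn ℝ 1 (fun t => M.j (zh t)) (Icc 0 T) := by
  refine contDiffOn_of_weak O.k_pos O.K_coercive (D.W.map M.j.toLinearMap)
    (fun t ht => Submodule.mem_map_of_mem (h.zh_mem t ht)) ?_
  rintro _ ⟨w, hw, rfl⟩
  refine ContDiffOn.congr ((h.ph_reg.inner ℝ (contDiffOn_const (c := M.d w))).neg) fun t ht => ?_
  exact eq_neg_of_add_eq_zero_left (h.eq3h t ht w hw)

theorem eq3_deriv {t : ℝ} (ht : t ∈ Ioo 0 T) {z' : F} (hz : HasDerivAt (fun s => M.j (z s)) z' t)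
    {w : Wd} (hw : w ∈ D.W) :
    ⟪O.K (z' - dt T (fun s => M.j (zh s)) t), M.j w⟫_ℝ + ⟪dt T p t - dt T ph t, M.d w⟫_ℝ = 0 := by
  have hp := (hasDerivAt_dt h.p_reg ht).sub (hasDerivAt_dt h.ph_reg ht)
  have h1 := (O.K.hasFDerivAt.comp_hasDerivAt t (hz.sub (hasDerivAt_dt h.zh_reg ht))).inner ℝ
    (hasDerivAt_const t (M.j w))
  have h2 := hp.inner ℝ (hasDerivAt_const t (M.d w))
  have h4 := (h1.add h2).congr_of_eventuallyEq (f₁ := fun _ => (0 : ℝ)) (by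
    filter_upwards [Icc_mem_nhds ht.1 ht.2] with s hs
    have := h.eq3 s hs w hw
    rw [map_sub] at this
    exact this.symm)
  have h5 := h4.unique (hasDerivAt_const t 0)
  simp only [inner_zero_right, zero_add] at h5
  exact h5

/-- The energy estimate for the flux. -/
theorem flux_estimate {L : Sg →L[ℝ] Sg} (hL : ∀ σ, L σ ∈ D.S ∧ D.DivMatch (L σ) σ ∧
    ∀ η ∈ D.G, ⟪M.ι (L σ), η⟫_ℝ = ⟪M.ι σ, η⟫_ℝ) (hT : 0 < T)
    {γ' : ℝ → E} (hγ : ∀ᵐ t ∂(timeMeasure T), HasDerivAt γ (γ' t) t)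
    {z' zt' : ℝ → F} {zt : ℝ → Wd}
    (hz : ∀ᵐ t ∂(timeMeasure T), HasDerivAt (fun s => M.j (z s)) (z' t) t)
    (hzt : ∀ᵐ t ∂(timeMeasure T), HasDerivAt (fun s => M.j (zt s)) (zt' t) t)
    (hac : AbsolutelyContinuousOnInterval (fun s => M.j (zt s)) 0 T)
    (hzm : ∀ t ∈ Icc 0 T, zt t ∈ D.W ∧ ∀ q ∈ D.Q, ⟪M.d (zt t), q⟫_ℝ = ⟪M.d (z t), q⟫_ℝ)
    {g k : ℝ → ℝ} (hg : Integrable (fun t => g t ^ 2) (timeMeasure T))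
    (hk : Integrable k (timeMeasure T)) (hk0 : ∀ t, 0 ≤ k t)
    (hgb : ∀ᵐ t ∂(timeMeasure T), ‖O.eff (M.ι (dt T σ t - L (dt T σ t)))
        (dt T p t - D.Q.starProjection (dt T p t))‖ + ‖γ' t - D.G.starProjection (γ' t)‖
        + ‖dt T p t - D.Q.starProjection (dt T p t)‖ ≤ g t)
    (hkb : ∀ᵐ t ∂(timeMeasure T), ‖z' t - zt' t‖ ≤ k t) {t : ℝ} (ht : t ∈ Icc 0 T) :
    √⟪O.K (M.j (zt t - zh t)), M.j (zt t - zh t)⟫_ℝ ≤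
    √⟪O.K (M.j (zt 0 - zh 0)), M.j (zt 0 - zh 0)⟫_ℝ
      + 2 * ∫ s, O.const * k s ∂(timeMeasure T)
      + √(∫ s, O.const ^ 2 * g s ^ 2 ∂(timeMeasure T)) := by
  have hzh := h.zh_reg
  have hac2 : AbsolutelyContinuousOnInterval (fun s => M.j (zt s - zh s)) 0 T := by
    have h1 : ContDiffOn ℝ 1 (fun t => M.j (zh t)) (uIcc 0 T) := by rwa [uIcc_of_le hT.le]
    have h2 := hac.sub h1.absolutelyContinuousOnInterval
    refine absolutelyContinuous_of_dist_le (C := 1) h2 fun s _ t _ => ?_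
    simp [map_sub]
  refine sqrt_le_of_deriv_le hT.le
    (Y := fun s => ⟪O.K (M.j (zt s - zh s)), M.j (zt s - zh s)⟫_ℝ)
    (absolutelyContinuous_quadratic O.K hac2)
    (fun _ _ => O.K_nonneg _) (hk.const_mul _) (hg.const_mul _)
    (fun t => mul_nonneg O.const_pos.le (hk0 t)) (fun t => by positivity) ?_ ht
  filter_upwards [hγ, hz, hzt, hgb, hkb, ae_timeMeasure_mem_Ioo] with s hγs hzs hzts hgs hks hs
  have hs' := Ioo_subset_Icc_self hs
  have hd := (hasDerivAt_quadratic O.K O.K_symm (hzts.sub (hasDerivAt_dt hzh hs)))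
  have hd' : deriv (fun s => ⟪O.K (M.j (zt s - zh s)), M.j (zt s - zh s)⟫_ℝ) s
      = 2 * ⟪O.K (zt' s - dt T (fun r => M.j (zh r)) s), M.j (zt s - zh s)⟫_ℝ := by
    simp only [map_sub, Pi.sub_apply] at hd ⊢
    exact hd.deriv
  rw [hd']
  have hk1 := h.interp_sub_deriv_mem_kernel hL hs
  set θ := D.Q.starProjection (dt T p s) - dt T ph s with hθ
  have hθm : θ ∈ D.Q := h.proj_sub_deriv_mem hs
  have hw : zt s - zh s ∈ D.W := D.W.sub_mem (hzm s hs').1 (h.zh_mem s hs')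
  have e1 := h.eq1_deriv hs hγs hk1
  have e3 := h.eq3_deriv hs hzs hw
  have e4 := h.eq4 s hs' θ hθm
  have esk := O.skew_orth _ (h.rotation_residual_skew hs hγs) θ
  -- The same combination as for the first energy, with the test functions `L σ' − σh'` and `θ = P_Q
  -- p' − ph'` in the stress and mass equations, and with the time derivative of Darcy's law tested
  -- with `zt − zh`.
  have key : ⟪O.A (O.eff (M.ι (L (dt T σ s) - dt T σh s)) θ
        + O.eff (M.ι (dt T σ s - L (dt T σ s))) (dt T p s - D.Q.starProjection (dt T p s))),
        O.eff (M.ι (L (dt T σ s) - dt T σh s)) θ⟫_ℝ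
      + ⟪γ' s - D.G.starProjection (γ' s), O.eff (M.ι (L (dt T σ s) - dt T σh s)) θ⟫_ℝ
      + ⟪O.S (θ + (dt T p s - D.Q.starProjection (dt T p s))), θ⟫_ℝ
      + ⟪O.K ((zt' s - dt T (fun r => M.j (zh r)) s) + (z' s - zt' s)), M.j (zt s - zh s)⟫_ℝ
      = 0 := by
    have a1 : O.eff (M.ι (L (dt T σ s) - dt T σh s)) θ
        + O.eff (M.ι (dt T σ s - L (dt T σ s))) (dt T p s - D.Q.starProjection (dt T p s))
        = O.eff (M.ι (dt T σ s - dt T σh s)) (dt T p s - dt T ph s) := by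
      rw [← eff_add, ← map_add, hθ]; congr 2 <;> abel
    have a2 : θ + (dt T p s - D.Q.starProjection (dt T p s)) = dt T p s - dt T ph s := by
      rw [hθ]; abel
    have a3 : (zt' s - dt T (fun r => M.j (zh r)) s) + (z' s - zt' s)
        = z' s - dt T (fun r => M.j (zh r)) s := by abel
    have a4 : ⟪M.d (z s - zh s), θ⟫_ℝ = ⟪dt T p s - dt T ph s, M.d (zt s - zh s)⟫_ℝ := by
      have b1 : ⟪dt T p s - dt T ph s, M.d (zt s - zh s)⟫_ℝ = ⟪θ, M.d (zt s - zh s)⟫_ℝ := by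
        rw [hθ, inner_sub_left, inner_sub_left, inner_starProjection D _ (D.div_W _ hw)]
      rw [b1, real_inner_comm, map_sub, map_sub, inner_sub_right, inner_sub_right,
        real_inner_comm _ θ, real_inner_comm (M.d (zt s)) θ, (hzm s hs').2 θ hθm]
    rw [a1, a2, a3]
    change ⟪_, M.ι (L (dt T σ s) - dt T σh s) + O.P θ⟫_ℝ
      + ⟪_, M.ι (L (dt T σ s) - dt T σh s) + O.P θ⟫_ℝ + _ + _ = 0
    rw [inner_add_right, inner_add_right, esk]
    linarith
  refine (O.flux_dissipation key).trans (add_le_add ?_ ?_)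
  · have := O.const_pos.le
    gcongr
  · gcongr

/-! ### Stationary estimates -/

/-- The inf-sup condition supplies a divergence-free `τ` with weak skew part `θ`: the displacement
disappears from the stress equation and the rotation term produces `‖θ‖²`. -/
theorem rotation_estimate {t : ℝ} (ht : t ∈ Icc 0 T) :
    ‖D.G.starProjection (γ t) - γh t‖ ≤
      c * (‖O.A‖ * ‖O.eff (M.ι (σ t - σh t)) (p t - ph t)‖ + ‖γ t - D.G.starProjection (γ t)‖) := by
  set θ := D.G.starProjection (γ t) - γh t with hθ
  have hθm : θ ∈ D.G := D.G.sub_mem (D.G.starProjection_apply_mem _) (h.γh_mem t ht)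
  obtain ⟨τ, h1, h2, h3, h4⟩ := D.infsup_S 0 D.V.zero_mem θ hθm
  rw [norm_zero, zero_add] at h4
  have e := h.eq1 t ht τ h1
  rw [h2, inner_zero_right, add_zero] at e
  have hs : γ t - γh t = (γ t - D.G.starProjection (γ t)) + θ := by rw [hθ]; abel
  rw [hs, inner_add_left, real_inner_comm _ θ, h3 θ hθm, real_inner_self_eq_norm_sq] at e
  have n1 := abs_le.1 (abs_real_inner_le_norm (O.A (O.eff (M.ι (σ t - σh t)) (p t - ph t))) (M.ι τ))
  have n2 := abs_le.1 (abs_real_inner_le_norm (γ t - D.G.starProjection (γ t)) (M.ι τ))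
  have n3 := O.A.le_opNorm (O.eff (M.ι (σ t - σh t)) (p t - ph t))
  have n4 := (M.ι_le τ).trans h4
  set X := ‖O.A‖ * ‖O.eff (M.ι (σ t - σh t)) (p t - ph t)‖
  set R := ‖γ t - D.G.starProjection (γ t)‖
  have hX : 0 ≤ X := by positivity
  have hR : 0 ≤ R := by positivity
  have h5 : ‖θ‖ ^ 2 ≤ (X + R) * (c * ‖θ‖) := by
    calc ‖θ‖ ^ 2 ≤ ‖O.A (O.eff (M.ι (σ t - σh t)) (p t - ph t))‖ * ‖M.ι τ‖ + R * ‖M.ι τ‖ := by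
          linarith
      _ ≤ X * (c * ‖θ‖) + R * (c * ‖θ‖) := by gcongr
      _ = _ := by ring
  have hc := D.c_nonneg
  rcases (norm_nonneg θ).eq_or_lt with h0 | h0
  · rw [← h0]; positivity
  · nlinarith

/-- With `δ τ = θ` the displacement term equals `‖θ‖²`, as the projection error of `u` is orthogonal
to the discrete displacements. Consequently no approximation error of `u` appears on the right. -/
theorem displacement_estimate {t : ℝ} (ht : t ∈ Icc 0 T) :
    ‖D.V.starProjection (u t) - uh t‖ ≤
      c * (‖O.A‖ * ‖O.eff (M.ι (σ t - σh t)) (p t - ph t)‖ + ‖γ t - γh t‖) := by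
  set θ := D.V.starProjection (u t) - uh t with hθ
  have hθm : θ ∈ D.V := D.V.sub_mem (D.V.starProjection_apply_mem _) (h.uh_mem t ht)
  obtain ⟨τ, h1, h2, h3, h4⟩ := D.infsup_S θ hθm 0 D.G.zero_mem
  rw [norm_zero, add_zero] at h4
  have e := h.eq1 t ht τ h1
  have hu : ⟪u t - uh t, M.δ τ⟫_ℝ = ‖θ‖ ^ 2 := by
    have := D.V.starProjection_inner_eq_zero (u t) θ hθm
    have hs : u t - uh t = (u t - D.V.starProjection (u t)) + θ := by rw [hθ]; abel
    rw [h2, hs, inner_add_left, this, zero_add, real_inner_self_eq_norm_sq]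
  rw [hu] at e
  have n1 := abs_le.1 (abs_real_inner_le_norm (O.A (O.eff (M.ι (σ t - σh t)) (p t - ph t))) (M.ι τ))
  have n2 := abs_le.1 (abs_real_inner_le_norm (γ t - γh t) (M.ι τ))
  have n3 := O.A.le_opNorm (O.eff (M.ι (σ t - σh t)) (p t - ph t))
  have n4 := (M.ι_le τ).trans h4
  set X := ‖O.A‖ * ‖O.eff (M.ι (σ t - σh t)) (p t - ph t)‖
  set R := ‖γ t - γh t‖
  have hX : 0 ≤ X := by positivity
  have hR : 0 ≤ R := by positivity
  have h5 : ‖θ‖ ^ 2 ≤ (X + R) * (c * ‖θ‖) := by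
    calc ‖θ‖ ^ 2 ≤ ‖O.A (O.eff (M.ι (σ t - σh t)) (p t - ph t))‖ * ‖M.ι τ‖ + R * ‖M.ι τ‖ := by
          linarith
      _ ≤ X * (c * ‖θ‖) + R * (c * ‖θ‖) := by gcongr
      _ = _ := by ring
  have hc := D.c_nonneg
  rcases (norm_nonneg θ).eq_or_lt with h0 | h0
  · rw [← h0]; positivity
  · nlinarith

/-- Darcy's law is tested with a flux of divergence `θ`. The pressure is thus controlled through the
flux, also when the storage term vanishes. -/
theorem pressure_estimate {t : ℝ} (ht : t ∈ Icc 0 T) :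
    ‖D.Q.starProjection (p t) - ph t‖ ≤ c * (‖O.K‖ * ‖M.j (z t - zh t)‖) := by
  set θ := D.Q.starProjection (p t) - ph t with hθ
  have hθm : θ ∈ D.Q := D.Q.sub_mem (D.Q.starProjection_apply_mem _) (h.ph_mem t ht)
  obtain ⟨w, h1, h2, h4⟩ := D.infsup_W θ hθm
  have e := h.eq3 t ht w h1
  have hu : ⟪p t - ph t, M.d w⟫_ℝ = ‖θ‖ ^ 2 := by
    have := D.Q.starProjection_inner_eq_zero (p t) θ hθm
    have hs : p t - ph t = (p t - D.Q.starProjection (p t)) + θ := by rw [hθ]; abel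
    rw [h2, hs, inner_add_left, this, zero_add, real_inner_self_eq_norm_sq]
  rw [hu] at e
  have n1 := abs_le.1 (abs_real_inner_le_norm (O.K (M.j (z t - zh t))) (M.j w))
  have n3 := O.K.le_opNorm (M.j (z t - zh t))
  have n4 := (M.j_le w).trans h4
  set X := ‖O.K‖ * ‖M.j (z t - zh t)‖
  have hX : 0 ≤ X := by positivity
  have h5 : ‖θ‖ ^ 2 ≤ X * (c * ‖θ‖) := by
    calc ‖θ‖ ^ 2 ≤ ‖O.K (M.j (z t - zh t))‖ * ‖M.j w‖ := by linarith
      _ ≤ X * (c * ‖θ‖) := by gcongr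
  have hc := D.c_nonneg
  rcases (norm_nonneg θ).eq_or_lt with h0 | h0
  · rw [← h0]; positivity
  · nlinarith

end ErrorEqs

/-! ### Pointwise properties of the coefficients -/

section LinearAlgebra

/-- The inverse of a symmetric positive definite operator. -/
theorem inverse_bounds {H : Type*} [NormedAddCommGroup H] [InnerProductSpace ℝ H]
    {C A : H →L[ℝ] H} {c₀ c₁ : ℝ} (h0 : 0 < c₀) (hs : ∀ x y, ⟪C x, y⟫_ℝ = ⟪C y, x⟫_ℝ)
    (hb : ∀ x, c₀ * ‖x‖ ^ 2 ≤ ⟪C x, x⟫_ℝ ∧ ⟪C x, x⟫_ℝ ≤ c₁ * ‖x‖ ^ 2) (hA : ∀ x, C (A x) = x) :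
    (∀ x y, ⟪A x, y⟫_ℝ = ⟪A y, x⟫_ℝ) ∧ (∀ x, ‖A x‖ ≤ c₀⁻¹ * ‖x‖) ∧
      ∀ x, c₀ / (|c₁| + 1) ^ 2 * ‖x‖ ^ 2 ≤ ⟪A x, x⟫_ℝ := by
  have hpos : ∀ x, 0 ≤ ⟪C x, x⟫_ℝ := fun x => le_trans (by positivity) (hb x).1
  have hb1 : ∀ x, ⟪C x, x⟫_ℝ ≤ |c₁| * ‖x‖ ^ 2 := fun x =>
    (hb x).2.trans (mul_le_mul_of_nonneg_right (le_abs_self _) (sq_nonneg _))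
  -- The Cauchy–Schwarz inequality of the form of `C`, applied to `x` and `C x`, turns the bound of
  -- the quadratic form into a bound of the operator norm.
  have hC (x : H) : ‖C x‖ ≤ |c₁| * ‖x‖ := by
    have h1 := (le_abs_self _).trans (inner_map_le_sqrt_mul_sqrt C hs hpos x (C x))
    rw [real_inner_self_eq_norm_sq] at h1
    have h2 : √⟪C x, x⟫_ℝ ≤ √|c₁| * ‖x‖ := by
      refine (Real.sqrt_le_sqrt (hb1 x)).trans ?_
      rw [Real.sqrt_mul (abs_nonneg _), Real.sqrt_sq (norm_nonneg _)]
    have h3 : √⟪C (C x), C x⟫_ℝ ≤ √|c₁| * ‖C x‖ := by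
      refine (Real.sqrt_le_sqrt (hb1 _)).trans ?_
      rw [Real.sqrt_mul (abs_nonneg _), Real.sqrt_sq (norm_nonneg _)]
    have h4 : ‖C x‖ ^ 2 ≤ |c₁| * ‖x‖ * ‖C x‖ := by
      calc ‖C x‖ ^ 2 ≤ (√|c₁| * ‖x‖) * (√|c₁| * ‖C x‖) :=
            h1.trans (mul_le_mul h2 h3 (Real.sqrt_nonneg _) (by positivity))
        _ = (√|c₁| * √|c₁|) * ‖x‖ * ‖C x‖ := by ring
        _ = _ := by rw [Real.mul_self_sqrt (abs_nonneg _)]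
    rcases (norm_nonneg (C x)).eq_or_lt with h5 | h5
    · rw [← h5]; positivity
    · nlinarith
  refine ⟨fun x y => ?_, fun x => ?_, fun x => ?_⟩
  · nth_rewrite 1 [← hA y]
    rw [real_inner_comm, hs, hA, real_inner_comm]
  · have h1 := (hb (A x)).1
    rw [hA] at h1
    have h2 := h1.trans (real_inner_le_norm _ _)
    rw [inv_mul_eq_div, le_div_iff₀ h0]
    rcases (norm_nonneg (A x)).eq_or_lt with h5 | h5
    · rw [← h5]; simp
    · nlinarith
  · have h1 := (hb (A x)).1
    rw [hA, real_inner_comm] at h1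
    refine le_trans ?_ h1
    -- The norm bound of `C` at `A x`, enlarged by 1 to keep the denominator positive.
    have h2 : ‖x‖ ≤ (|c₁| + 1) * ‖A x‖ := by
      have := hC (A x)
      rw [hA] at this
      linarith [norm_nonneg (A x)]
    rw [div_mul_eq_mul_div, div_le_iff₀ (by positivity), mul_assoc]
    refine mul_le_mul_of_nonneg_left ?_ h0.le
    rw [← mul_pow, mul_comm ‖A x‖]
    gcongr

variable {n : ℕ}

/-- The transpose of a matrix. -/
def transp (n : ℕ) : Mat n →L[ℝ] Mat n :=
  (LinearIsometryEquiv.piLpCongrLeft 2 ℝ ℝ (Equiv.prodComm (Fin n) (Fin n))).toContinuousLinearEquiv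

@[simp] theorem transp_apply (τ : Mat n) (i j : Fin n) : transp n τ (i, j) = τ (j, i) := by
  simp [transp, LinearIsometryEquiv.piLpCongrLeft]

theorem isSkew_iff {τ : Mat n} : IsSkew τ ↔ τ + transp n τ = 0 := by
  constructor
  · intro h; ext ⟨i, j⟩
    simp [h i j]
  · intro h i j
    have := congrArg (fun ξ : Mat n => ξ (i, j)) h
    simp at this
    linarith

/-- The symmetric matrices. -/
def symMat (n : ℕ) : Submodule ℝ (Mat n) where
  carrier := {τ | IsSym τ}
  zero_mem' := fun i j => by simp
  add_mem' := fun {a b} ha hb i j => by simp [ha i j, hb i j]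
  smul_mem' := fun c a ha i j => by simp [ha i j]

/-- Exchanging the two indices in the sum changes the sign. -/
theorem inner_sym_skew {τ η : Mat n} (hτ : IsSym τ) (hη : IsSkew η) : ⟪τ, η⟫_ℝ = 0 := by
  have h1 : ⟪τ, η⟫_ℝ = -⟪τ, η⟫_ℝ := by
    rw [PiLp.inner_apply, ← Finset.sum_neg_distrib,
      ← Equiv.sum_comp (Equiv.prodComm (Fin n) (Fin n))]
    refine Finset.sum_congr rfl fun x _ => ?_
    obtain ⟨i, j⟩ := x
    simp only [Equiv.prodComm_apply, Prod.swap_prod_mk, hτ j i, hη j i, inner_neg_right]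
  linarith

theorem exists_sym_skew (τ : Mat n) : ∃ s k : Mat n, IsSym s ∧ IsSkew k ∧ τ = s + k := by
  refine ⟨(1 / 2 : ℝ) • (τ + transp n τ), (1 / 2 : ℝ) • (τ - transp n τ), fun i j => ?_,
    fun i j => ?_, ?_⟩
  · simp; ring
  · simp; ring
  · rw [← smul_add]
    have : τ + transp n τ + (τ - transp n τ) = (2 : ℝ) • τ := by rw [two_smul]; abel
    rw [this, smul_smul]; norm_num

theorem isSym_idMat (n : ℕ) : IsSym (idMat n) := fun i j => by
  simp [idMat, eq_comm]

variable {D : Coeffs n} {Ω : Set (Vec n)}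

/-- The splitting into symmetric and skew matrices is orthogonal and invariant under `A`, which is
the inverse of `C` on the first part and a positive scalar on the second. The bounds are obtained
separately on the two parts. -/
theorem Coeffs.Admissible.A_bounds (hD : D.Admissible Ω) : ∃ a > 0, ∃ b, ∀ x ∈ Ω,
    (∀ τ ξ, ⟪D.A x τ, ξ⟫_ℝ = ⟪D.A x ξ, τ⟫_ℝ) ∧ (∀ τ, a * ‖τ‖ ^ 2 ≤ ⟪D.A x τ, τ⟫_ℝ) ∧
      ‖D.A x‖ ≤ b := by
  obtain ⟨c₀, h0, c₁, hb⟩ := hD.C_bounds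
  obtain ⟨a, ha, hk⟩ := hD.A_skew
  refine ⟨min (c₀ / (|c₁| + 1) ^ 2) a, lt_min (by positivity) ha, c₀⁻¹ + a, fun x hx => ?_⟩
  let Cs : symMat n →L[ℝ] symMat n := ((D.C x) ∘L (symMat n).subtypeL).codRestrict (symMat n)
    fun τ => hD.C_sym x hx τ τ.2
  let As : symMat n →L[ℝ] symMat n := ((D.A x) ∘L (symMat n).subtypeL).codRestrict (symMat n)
    fun τ => (hD.A_sym x hx τ τ.2).1
  obtain ⟨h1, h2, h3⟩ := inverse_bounds (C := Cs) (A := As) (c₁ := c₁) h0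
    (fun τ ξ => by
      have := hD.C_selfadjoint x hx τ ξ τ.2 ξ.2
      rw [real_inner_comm] at this
      rw [real_inner_comm]
      exact this.trans (real_inner_comm _ _))
    (fun τ => hb x hx τ τ.2) (fun τ => Subtype.ext (hD.A_sym x hx τ τ.2).2)
  have sy : ∀ τ, IsSym τ → IsSym (D.A x τ) := fun τ hτ => (hD.A_sym x hx τ hτ).1
  have s1 : ∀ τ ξ : Mat n, IsSym τ → IsSym ξ → ⟪D.A x τ, ξ⟫_ℝ = ⟪D.A x ξ, τ⟫_ℝ :=
    fun τ ξ hτ hξ => h1 ⟨τ, hτ⟩ ⟨ξ, hξ⟩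
  have s2 : ∀ τ : Mat n, IsSym τ → ‖D.A x τ‖ ≤ c₀⁻¹ * ‖τ‖ := fun τ hτ => h2 ⟨τ, hτ⟩
  have s3 : ∀ τ : Mat n, IsSym τ → c₀ / (|c₁| + 1) ^ 2 * ‖τ‖ ^ 2 ≤ ⟪D.A x τ, τ⟫_ℝ :=
    fun τ hτ => h3 ⟨τ, hτ⟩
  refine ⟨fun τ ξ => ?_, fun τ => ?_, ?_⟩
  · obtain ⟨s, k, hs, hk', rfl⟩ := exists_sym_skew τ
    obtain ⟨s', k', hs', hk'', rfl⟩ := exists_sym_skew ξ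
    simp only [map_add, inner_add_left, inner_add_right, hk x hx _ hk', hk x hx _ hk'',
      real_inner_smul_left, inner_sym_skew (sy _ hs) hk'', inner_sym_skew (sy _ hs') hk',
      real_inner_comm s' k, real_inner_comm s k', inner_sym_skew hs' hk', inner_sym_skew hs hk'',
      s1 s s' hs hs', real_inner_comm k k']
  · obtain ⟨s, k, hs, hk', rfl⟩ := exists_sym_skew τ
    have e : ‖s + k‖ ^ 2 = ‖s‖ ^ 2 + ‖k‖ ^ 2 := by
      rw [norm_add_sq_real, inner_sym_skew hs hk']; ring
    have e2 : ⟪D.A x (s + k), s + k⟫_ℝ = ⟪D.A x s, s⟫_ℝ + a * ‖k‖ ^ 2 := by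
      simp only [map_add, inner_add_left, inner_add_right, hk x hx _ hk',
        real_inner_smul_left, inner_sym_skew (sy _ hs) hk', real_inner_comm s k,
        inner_sym_skew hs hk', real_inner_self_eq_norm_sq]
      ring
    rw [e, e2, mul_add]
    refine add_le_add (le_trans ?_ (s3 s hs)) ?_
    · gcongr; exact min_le_left _ _
    · gcongr; exact min_le_right _ _
  · refine ContinuousLinearMap.opNorm_le_bound _ (by positivity) fun τ => ?_
    obtain ⟨s, k, hs, hk', rfl⟩ := exists_sym_skew τ
    have e : ‖s + k‖ ^ 2 = ‖s‖ ^ 2 + ‖k‖ ^ 2 := by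
      rw [norm_add_sq_real, inner_sym_skew hs hk']; ring
    have n1 : ‖s‖ ≤ ‖s + k‖ := by
      refine abs_le_of_sq_le_sq' ?_ (norm_nonneg _) |>.2
      nlinarith [sq_nonneg ‖k‖]
    have n2 : ‖k‖ ≤ ‖s + k‖ := by
      refine abs_le_of_sq_le_sq' ?_ (norm_nonneg _) |>.2
      nlinarith [sq_nonneg ‖s‖]
    rw [map_add, hk x hx _ hk', add_mul]
    refine (norm_add_le _ _).trans (add_le_add ((s2 s hs).trans ?_) ?_)
    · gcongr
    · rw [norm_smul, Real.norm_of_nonneg ha.le]; gcongr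

/-- The inverse of the conductivity as an operator. -/
def Coeffs.κinv (D : Coeffs n) (x : Vec n) : Vec n →L[ℝ] Vec n :=
  (Matrix.toEuclideanCLM (𝕜 := ℝ) (n := Fin n)) (D.κ x)⁻¹

theorem dotProduct_eq_inner (v w : Vec n) : v.ofLp ⬝ᵥ w.ofLp = ⟪v, w⟫_ℝ := by
  rw [PiLp.inner_apply, dotProduct]
  exact Finset.sum_congr rfl fun i _ => by simp [mul_comm]

theorem Coeffs.Admissible.κinv_bounds (hD : D.Admissible Ω) : ∃ k > 0, ∃ b, ∀ x ∈ Ω,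
    (∀ v w, ⟪D.κinv x v, w⟫_ℝ = ⟪D.κinv x w, v⟫_ℝ) ∧ (∀ v, k * ‖v‖ ^ 2 ≤ ⟪D.κinv x v, v⟫_ℝ) ∧
      ‖D.κinv x‖ ≤ b := by
  obtain ⟨k₀, h0, k₁, hb⟩ := hD.κ_bounds
  refine ⟨k₀ / (|k₁| + 1) ^ 2, by positivity, k₀⁻¹, fun x hx => ?_⟩
  let C : Vec n →L[ℝ] Vec n := Matrix.toEuclideanCLM (𝕜 := ℝ) (n := Fin n) (D.κ x)
  have hC (v : Vec n) : (C v).ofLp = D.κ x *ᵥ v.ofLp := by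
    simp [C]
  have hq (v : Vec n) : ⟪C v, v⟫_ℝ = v.ofLp ⬝ᵥ (D.κ x *ᵥ v.ofLp) := by
    rw [real_inner_comm, ← dotProduct_eq_inner, hC]
  have hn (v : Vec n) : ‖v‖ ^ 2 = v.ofLp ⬝ᵥ v.ofLp := by
    rw [dotProduct_eq_inner, real_inner_self_eq_norm_sq]
  -- The inverse of a singular matrix is zero by convention, so invertibility has to be proved. It
  -- follows from the lower bound of the quadratic form on the kernel.
  have hdet : IsUnit (D.κ x).det := by
    rw [← Matrix.isUnit_iff_isUnit_det, ← Matrix.mulVec_injective_iff_isUnit]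
    intro v w hvw
    have h1 : D.κ x *ᵥ (v - w) = 0 := by rw [Matrix.mulVec_sub, sub_eq_zero]; exact hvw
    have h2 := (hb x hx (v - w)).1
    rw [h1, dotProduct_zero] at h2
    have h3 : (v - w) ⬝ᵥ (v - w) ≤ 0 := by nlinarith
    have h4 := hn (WithLp.toLp 2 (v - w))
    have h5 : ‖WithLp.toLp 2 (v - w)‖ ^ 2 = 0 := le_antisymm (h4.trans_le h3) (sq_nonneg _)
    have h6 : WithLp.toLp 2 (v - w) = 0 := by simpa using h5
    have h7 : v - w = 0 := congrArg WithLp.ofLp h6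
    exact sub_eq_zero.1 h7
  obtain ⟨h1, h2, h3⟩ := inverse_bounds (C := C) (A := D.κinv x) (c₁ := k₁) h0
    (fun v w => by
      rw [real_inner_comm, ← dotProduct_eq_inner, ← dotProduct_eq_inner, hC, hC,
        Matrix.dotProduct_mulVec, ← Matrix.mulVec_transpose, (hD.κ_symm x hx).eq])
    (fun v => by rw [hq, hn]; exact hb x hx _)
    (fun v => by
      change (C * D.κinv x) v = v
      rw [Coeffs.κinv, ← map_mul, Matrix.mul_nonsing_inv _ hdet, map_one]; rfl)
  exact ⟨h1, h3, ContinuousLinearMap.opNorm_le_bound _ (by positivity) h2⟩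

/-- By Cramer's rule the inverse is the adjugate divided by the determinant, both polynomial in the
entries. -/
theorem Coeffs.Admissible.measurable_κinv (hD : D.Admissible Ω) (v : Vec n) :
    Measurable fun x => D.κinv x v := by
  have h1 : Measurable fun x => (fun i j => D.κ x i j : Fin n → Fin n → ℝ) :=
    measurable_pi_iff.2 fun i => measurable_pi_iff.2 fun j => hD.meas_κ i j
  have hdet : Continuous fun M : Fin n → Fin n → ℝ => Matrix.det (Matrix.of M) :=
    Continuous.matrix_det continuous_id
  have hadj : Continuous fun M : Fin n → Fin n → ℝ => Matrix.adjugate (Matrix.of M) :=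
    Continuous.matrix_adjugate continuous_id
  have hinv (i j : Fin n) : Measurable fun x => (D.κ x)⁻¹ i j := by
    have e : (fun x => (D.κ x)⁻¹ i j) = fun x => (D.κ x).det⁻¹ * (D.κ x).adjugate i j := by
      ext x
      rw [Matrix.inv_def, Matrix.smul_apply, Ring.inverse_eq_inv', smul_eq_mul]
    rw [e]
    refine ((hdet.measurable.comp h1).inv).mul ?_
    exact (hadj.matrix_elem i j).measurable.comp h1
  have e : (fun x => D.κinv x v) = fun x => WithLp.toLp 2 ((D.κ x)⁻¹ *ᵥ v.ofLp) := by
    ext x i; simp [Coeffs.κinv]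
  rw [e]
  refine (PiLp.continuous_toLp 2 _).measurable.comp (measurable_pi_iff.2 fun i => ?_)
  simp only [Matrix.mulVec, dotProduct]
  exact Finset.measurable_sum _ fun j _ => (hinv i j).mul_const _

end LinearAlgebra

/-! ### Multiplication operators on `L²` and the representation of the forms -/

section Multiplication

variable {n : ℕ} {Ω : Set (Vec n)} {X Y : Type*} [NormedAddCommGroup X] [NormedSpace ℝ X]
  [FiniteDimensional ℝ X] [NormedAddCommGroup Y] [NormedSpace ℝ Y]

/-- Expanding `f x` in a basis of `X` reduces the claim to the measurability of `B` on fixed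
vectors. -/
theorem aestronglyMeasurable_field {μ : Measure (Vec n)} {B : Vec n → X →L[ℝ] Y}
    (hB : ∀ v, AEStronglyMeasurable (fun x => B x v) μ) {f : Vec n → X}
    (hf : AEStronglyMeasurable f μ) : AEStronglyMeasurable (fun x => B x (f x)) μ := by
  let b := Module.finBasis ℝ X
  have e : (fun x => B x (f x)) = fun x => ∑ i, (b.equivFunL (f x) i) • B x (b i) := by
    ext x
    conv_lhs => rw [← b.sum_equivFun (f x), map_sum]
    simp
  rw [e]
  refine Finset.aestronglyMeasurable_fun_sum _ fun i _ => ?_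
  refine AEStronglyMeasurable.smul ?_ (hB _)
  exact ((continuous_apply i).comp b.equivFunL.continuous).comp_aestronglyMeasurable hf

/-- Multiplication by a bounded measurable field of linear maps. -/
theorem exists_mulOp {B : Vec n → X →L[ℝ] Y}
    (hB : ∀ v, AEStronglyMeasurable (fun x => B x v) (volume.restrict Ω)) {C : ℝ}
    (hC : ∀ᵐ x ∂(volume.restrict Ω), ‖B x‖ ≤ C) :
    ∃ L : L2 Ω X →L[ℝ] L2 Ω Y, ∀ f, L f =ᵐ[volume.restrict Ω] fun x => B x (f x) := by
  have hle (f : L2 Ω X) : ∀ᵐ x ∂(volume.restrict Ω), ‖B x (f x)‖ ≤ C * ‖f x‖ := by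
    filter_upwards [hC] with x hx
    exact (B x).le_of_opNorm_le hx _
  have hm (f : L2 Ω X) : MemLp (fun x => B x (f x)) 2 (volume.restrict Ω) :=
    (Lp.memLp f).of_le_mul (aestronglyMeasurable_field hB (Lp.aestronglyMeasurable f)) (hle f)
  let L : L2 Ω X →ₗ[ℝ] L2 Ω Y :=
    { toFun := fun f => (hm f).toLp
      map_add' := fun f g => by
        rw [← MemLp.toLp_add]
        refine MemLp.toLp_congr _ _ ?_
        filter_upwards [Lp.coeFn_add f g] with x hx
        rw [hx, Pi.add_apply, map_add, Pi.add_apply]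
      map_smul' := fun c f => by
        rw [RingHom.id_apply, ← MemLp.toLp_const_smul]
        refine MemLp.toLp_congr _ _ ?_
        filter_upwards [Lp.coeFn_smul c f] with x hx
        rw [hx, Pi.smul_apply, map_smul, Pi.smul_apply] }
  refine ⟨L.mkContinuous C fun f => ?_, fun f => (hm f).coeFn_toLp⟩
  refine Lp.norm_le_mul_norm_of_ae_le_mul ?_
  filter_upwards [hle f, (hm f).coeFn_toLp] with x h1 h2
  exact (congrArg norm h2).trans_le h1

end Multiplication

section MultiplicationInner

variable {n : ℕ} {Ω : Set (Vec n)} {X : Type*} [NormedAddCommGroup X] [InnerProductSpace ℝ X]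
  {L : L2 Ω X →L[ℝ] L2 Ω X} {B : Vec n → X →L[ℝ] X}

theorem mulOp_inner (hL : ∀ f, L f =ᵐ[volume.restrict Ω] fun x => B x (f x)) (f g : L2 Ω X) :
    ⟪L f, g⟫_ℝ = ∫ x in Ω, ⟪B x (f x), g x⟫_ℝ := by
  rw [L2.inner_def]
  refine integral_congr_ae ?_
  filter_upwards [hL f] with x hx
  rw [hx]

theorem mulOp_symm (hL : ∀ f, L f =ᵐ[volume.restrict Ω] fun x => B x (f x))
    (hB : ∀ᵐ x ∂(volume.restrict Ω), ∀ v w, ⟪B x v, w⟫_ℝ = ⟪B x w, v⟫_ℝ) (f g : L2 Ω X) :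
    ⟪L f, g⟫_ℝ = ⟪L g, f⟫_ℝ := by
  rw [mulOp_inner hL, mulOp_inner hL]
  exact integral_congr_ae (hB.mono fun x hx => hx _ _)

theorem mulOp_coercive (hL : ∀ f, L f =ᵐ[volume.restrict Ω] fun x => B x (f x)) {a : ℝ}
    (hB : ∀ᵐ x ∂(volume.restrict Ω), ∀ v, a * ‖v‖ ^ 2 ≤ ⟪B x v, v⟫_ℝ) (f : L2 Ω X) :
    a * ‖f‖ ^ 2 ≤ ⟪L f, f⟫_ℝ := by
  rw [← real_inner_self_eq_norm_sq, L2.inner_def, L2.inner_def, ← integral_const_mul]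
  refine integral_mono_ae ((L2.integrable_inner (𝕜 := ℝ) f f).const_mul a)
    (L2.integrable_inner (𝕜 := ℝ) _ _) ?_
  filter_upwards [hB, hL f] with x h1 h2
  rw [h2, real_inner_self_eq_norm_sq]
  exact h1 _

end MultiplicationInner

variable {n : ℕ} {Ω : Set (Vec n)} {D : Coeffs n}

theorem mem_skewFields_iff {tr : L2 Ω (Mat n) →L[ℝ] L2 Ω (Mat n)}
    (htr : ∀ f, tr f =ᵐ[volume.restrict Ω] fun x => f x + transp n (f x)) (η : L2 Ω (Mat n)) :
    η ∈ skewFields Ω ↔ tr η = 0 := by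
  rw [Lp.eq_zero_iff_ae_eq_zero]
  constructor
  · intro h
    filter_upwards [htr η, h] with x h1 h2
    rw [h1]; exact isSkew_iff.1 h2
  · intro h
    change ∀ᵐ x ∂(volume.restrict Ω), IsSkew (η x)
    filter_upwards [htr η, h] with x h1 h2
    rw [h1] at h2
    exact isSkew_iff.2 h2

/-- The skew fields are the kernel of the bounded operator that adds the transpose. -/
theorem isClosed_skewFields : IsClosed (skewFields Ω : Set (L2 Ω (Mat n))) := by
  obtain ⟨tr, htr⟩ := exists_mulOp (Ω := Ω) (B := fun _ => ContinuousLinearMap.id ℝ (Mat n) + transp n)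
    (fun v => aestronglyMeasurable_const) (ae_of_all _ fun _ => le_rfl)
  have : (skewFields Ω : Set (L2 Ω (Mat n))) = tr ⁻¹' {0} := by
    ext η
    exact mem_skewFields_iff (tr := tr) (fun f => htr f) η
  rw [this]
  exact isClosed_singleton.preimage tr.continuous

theorem ae_mem_of_isOpen (hΩ : IsOpen Ω) : ∀ᵐ x ∂(volume.restrict Ω), x ∈ Ω :=
  ae_restrict_mem hΩ.measurableSet

/-- The operators representing the forms of the variational formulation. -/
theorem exists_operators (hΩ : IsOpen Ω) (hD : D.Admissible Ω) :
    ∃ O : Operators (L2 Ω (Mat n)) (L2 Ω (Vec n)) (L2 Ω ℝ), O.skew = skewFields Ω ∧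
      (∀ σ p τ q, formA D σ p τ q = ⟪O.A (O.eff σ p), O.eff τ q⟫_ℝ) ∧
      (∀ z w, formκ D z w = ⟪O.K z, w⟫_ℝ) ∧ (∀ p q, formS D p q = ⟪O.S p, q⟫_ℝ) ∧
      (∀ σ, O.A σ =ᵐ[volume.restrict Ω] fun x => D.A x (σ x)) ∧
      ∀ q, O.P q =ᵐ[volume.restrict Ω] fun x => (D.α x * q x) • idMat n := by
  have hmem := ae_mem_of_isOpen hΩ
  obtain ⟨a, ha, b, hA⟩ := hD.A_bounds
  obtain ⟨k, hk, b', hK⟩ := hD.κinv_bounds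
  obtain ⟨s₁, hS⟩ := hD.s₀_bounds
  obtain ⟨α₁, hα⟩ := hD.α_bounds
  obtain ⟨A, hA'⟩ := exists_mulOp (Ω := Ω) (B := D.A)
    (fun v => (hD.meas_A v).aestronglyMeasurable) (hmem.mono fun x hx => (hA x hx).2.2)
  obtain ⟨K, hK'⟩ := exists_mulOp (Ω := Ω) (B := D.κinv)
    (fun v => (hD.measurable_κinv v).aestronglyMeasurable) (hmem.mono fun x hx => (hK x hx).2.2)
  obtain ⟨S, hS'⟩ := exists_mulOp (Ω := Ω) (B := fun x => D.s₀ x • ContinuousLinearMap.id ℝ ℝ)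
    (C := s₁) (fun v => (hD.meas_s₀.smul_const v).aestronglyMeasurable)
    (hmem.mono fun x hx => by
      rw [norm_smul, ContinuousLinearMap.norm_id, mul_one, Real.norm_of_nonneg (hS x hx).1]
      exact (hS x hx).2)
  obtain ⟨P, hP'⟩ := exists_mulOp (Ω := Ω)
    (B := fun x => (D.α x) • ContinuousLinearMap.toSpanSingleton ℝ (idMat n))
    (C := α₁ * ‖ContinuousLinearMap.toSpanSingleton ℝ (idMat n)‖)
    (fun v => (hD.meas_α.smul_const _).aestronglyMeasurable)
    (hmem.mono fun x hx => by
      rw [norm_smul, Real.norm_of_nonneg (hα x hx).1.le]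
      gcongr
      exact (hα x hx).2)
  have hP (q : L2 Ω ℝ) : P q =ᵐ[volume.restrict Ω] fun x => (D.α x * q x) • idMat n := by
    filter_upwards [hP' q] with x hx
    rw [hx]
    simp [smul_smul]
  let O : Operators (L2 Ω (Mat n)) (L2 Ω (Vec n)) (L2 Ω ℝ) :=
    { A := A, K := K, S := S, P := P, skew := skewFields Ω
      A_symm := mulOp_symm hA' (hmem.mono fun x hx => (hA x hx).1)
      K_symm := mulOp_symm hK' (hmem.mono fun x hx => (hK x hx).1)
      S_symm := mulOp_symm hS' (ae_of_all _ fun x v w => by simp; ring)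
      a := a
      a_pos := ha
      A_coercive := mulOp_coercive hA' (hmem.mono fun x hx => (hA x hx).2.1)
      k := k
      k_pos := hk
      K_coercive := mulOp_coercive hK' (hmem.mono fun x hx => (hK x hx).2.1)
      S_nonneg := fun p => by
        have := mulOp_coercive hS' (a := 0) (hmem.mono fun x hx v => by
          simp only [zero_mul, smul_apply, ContinuousLinearMap.id_apply, real_inner_smul_left,
            real_inner_self_eq_norm_sq]
          exact mul_nonneg (hS x hx).1 (sq_nonneg _)) p
        rwa [zero_mul] at this
      skew_closed := isClosed_skewFields
      skew_orth := fun η hη q => by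
        have hη' : ∀ᵐ x ∂(volume.restrict Ω), IsSkew (η x) := hη
        rw [L2.inner_def]
        refine integral_eq_zero_of_ae ?_
        filter_upwards [hP q, hη'] with x h1 h2
        rw [h1, real_inner_smul_right, real_inner_comm, inner_sym_skew (isSym_idMat n) h2, mul_zero]
        rfl }
  refine ⟨O, rfl, fun σ p τ q => ?_, fun z w => ?_, fun p q => ?_, hA', hP⟩
  · have he (σ : L2 Ω (Mat n)) (p : L2 Ω ℝ) :
        O.eff σ p =ᵐ[volume.restrict Ω] fun x => σ x + (D.α x * p x) • idMat n := by
      filter_upwards [Lp.coeFn_add σ (P p), hP p] with x h1 h2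
      change (σ + P p) x = _
      rw [h1, Pi.add_apply, h2]
    change _ = ⟪A (O.eff σ p), O.eff τ q⟫_ℝ
    rw [mulOp_inner hA']
    refine integral_congr_ae ?_
    filter_upwards [he σ p, he τ q] with x h1 h2
    rw [h1, h2]
  · change _ = ⟪K z, w⟫_ℝ
    rw [mulOp_inner hK']
    refine integral_congr_ae (ae_of_all _ fun x => ?_)
    simp only
    rw [← dotProduct_eq_inner, Coeffs.κinv]
    simp
  · change _ = ⟪S p, q⟫_ℝ
    rw [mulOp_inner hS']
    refine integral_congr_ae (ae_of_all _ fun x => ?_)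
    simp [mul_comm]

variable {E V F Q Sg Wd : Type*} [NormedAddCommGroup E] [InnerProductSpace ℝ E]
    [NormedAddCommGroup V] [InnerProductSpace ℝ V] [NormedAddCommGroup F] [InnerProductSpace ℝ F]
    [NormedAddCommGroup Q] [InnerProductSpace ℝ Q] [NormedAddCommGroup Sg] [NormedSpace ℝ Sg]
    [NormedAddCommGroup Wd] [NormedSpace ℝ Wd]

/-! ### Error bounds of the abstract system -/

namespace Operators

variable (O : Operators E F Q)

theorem one_le_const : 1 ≤ O.const := by
  have : 0 ≤ √‖O.A‖ + (√O.a)⁻¹ + √‖O.S‖ + ‖O.K‖ + √‖O.K‖ := by positivity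
  unfold const; linarith

theorem sqrt_norm_A_le_const : √‖O.A‖ ≤ O.const := by
  have : 0 ≤ (√O.a)⁻¹ + √‖O.S‖ + ‖O.K‖ + √‖O.K‖ + 1 := by positivity
  unfold const; linarith

theorem inv_sqrt_a_le_const : (√O.a)⁻¹ ≤ O.const := by
  have : 0 ≤ √‖O.A‖ + √‖O.S‖ + ‖O.K‖ + √‖O.K‖ + 1 := by positivity
  unfold const; linarith

theorem sqrt_norm_S_le_const : √‖O.S‖ ≤ O.const := by
  have : 0 ≤ √‖O.A‖ + (√O.a)⁻¹ + ‖O.K‖ + √‖O.K‖ + 1 := by positivity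
  unfold const; linarith

theorem sqrt_norm_K_le_const : √‖O.K‖ ≤ O.const := by
  have : 0 ≤ √‖O.A‖ + (√O.a)⁻¹ + √‖O.S‖ + ‖O.K‖ + 1 := by positivity
  unfold const; linarith

theorem sqrt_const_le_const : √O.const ≤ O.const :=
  Real.sqrt_le_iff.2 ⟨O.const_pos.le, by nlinarith [O.one_le_const]⟩

end Operators

/-- The consistency errors of the solution are of size `ε K`. -/
structure Consistent {O : Operators E F Q} {M : Embeddings E V F Q Sg Wd} {c : ℝ}
    (D : Discretization O M c) (T : ℝ) (L : Sg →L[ℝ] Sg) (σ σh : ℝ → Sg) (γ : ℝ → E)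
    (p ph : ℝ → Q) (ε K : ℝ) (γ' : ℝ → E) (g : ℝ → ℝ) : Prop where
  interp : ∀ σ, L σ ∈ D.S ∧ D.DivMatch (L σ) σ ∧ ∀ η ∈ D.G, ⟪M.ι (L σ), η⟫_ℝ = ⟪M.ι σ, η⟫_ℝ
  ε_nonneg : 0 ≤ ε
  K_nonneg : 0 ≤ K
  σ_le : ∀ t ∈ Icc 0 T, ‖M.ι (σ t - L (σ t))‖ ≤ ε * K
  p_le : ∀ t ∈ Icc 0 T, ‖p t - D.Q.starProjection (p t)‖ ≤ ε * K
  γ_le : ∀ t ∈ Icc 0 T, ‖γ t - D.G.starProjection (γ t)‖ ≤ ε * K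
  γ_deriv : ∀ᵐ t ∂(timeMeasure T), HasDerivAt γ (γ' t) t
  g_nonneg : ∀ t, 0 ≤ g t
  g_int : Integrable g (timeMeasure T)
  g_le : ∫ t, g t ∂(timeMeasure T) ≤ K
  σ'_le : ∀ᵐ t ∂(timeMeasure T), ‖M.ι (dt T σ t - L (dt T σ t))‖ ≤ ε * g t
  p'_le : ∀ᵐ t ∂(timeMeasure T), ‖dt T p t - D.Q.starProjection (dt T p t)‖ ≤ ε * g t
  γ'_le : ∀ᵐ t ∂(timeMeasure T), ‖γ' t - D.G.starProjection (γ' t)‖ ≤ ε * g t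
  σ_init : ‖M.ι (σ 0 - σh 0)‖ ≤ ε * K
  p_init : ‖p 0 - ph 0‖ ≤ ε * K

/-- The constant in the bound of `σ + α p I`. -/
def Operators.effConst (O : Operators E F Q) : ℝ :=
  O.const * (5 * O.const * (3 + ‖O.P‖)) + (1 + ‖O.P‖)

theorem Operators.effConst_pos (O : Operators E F Q) : 0 < O.effConst := by
  have := O.const_pos
  unfold Operators.effConst; positivity

namespace ErrorEqs

variable {O : Operators E F Q} {M : Embeddings E V F Q Sg Wd} {c : ℝ}
  {D : Discretization O M c} {T : ℝ} {σ σh : ℝ → Sg} {u uh : ℝ → V} {γ γh : ℝ → E}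
  {z zh : ℝ → Wd} {p ph : ℝ → Q} {L : Sg →L[ℝ] Sg} {ε K : ℝ} {γ' : ℝ → E} {g : ℝ → ℝ}

/-- The factor counts the residuals: the stress once, the pressure with weight `‖O.P‖` inside
`O.eff` and once in the storage term, and the rotation once. -/
theorem residual_le (h2 : Consistent D T L σ σh γ p ph ε K γ' g) :
    ∀ᵐ t ∂(timeMeasure T), ‖O.eff (M.ι (dt T σ t - L (dt T σ t)))
        (dt T p t - D.Q.starProjection (dt T p t))‖ + ‖γ' t - D.G.starProjection (γ' t)‖
        + ‖dt T p t - D.Q.starProjection (dt T p t)‖ ≤ (3 + ‖O.P‖) * (ε * g t) := by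
  filter_upwards [h2.σ'_le, h2.p'_le, h2.γ'_le] with t h3 h4 h5
  have h6 := norm_eff_le (O := O) (M.ι (dt T σ t - L (dt T σ t)))
    (dt T p t - D.Q.starProjection (dt T p t))
  have h7 := mul_le_mul_of_nonneg_left h4 (norm_nonneg O.P)
  linarith

/-- The energy estimate controls the discrete part of the error, and the projection error is added
by the triangle inequality. The same inequality compares the initial discrete differences with the
initial errors. -/
theorem eff_error (h : ErrorEqs D T σ σh u uh γ γh z zh p ph)
    (h2 : Consistent D T L σ σh γ p ph ε K γ' g) (hT : 0 < T)
    {k : ℝ → ℝ} (hk : Integrable k (timeMeasure T)) (hk0 : ∀ t, 0 ≤ k t)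
    (hkK : ∫ t, k t ∂(timeMeasure T) ≤ K ^ 2)
    (hkb : ∀ᵐ t ∂(timeMeasure T), ∃ zt ∈ D.W, (∀ q ∈ D.Q, ⟪M.d zt, q⟫_ℝ = ⟪M.d (z t), q⟫_ℝ) ∧
      ‖M.j (z t - zt)‖ ^ 2 ≤ ε ^ 2 * k t) {t : ℝ} (ht : t ∈ Icc 0 T) :
    ‖O.eff (M.ι (σ t - σh t)) (p t - ph t)‖ ≤ O.effConst * (ε * K) := by
  have hεK : 0 ≤ ε * K := mul_nonneg h2.ε_nonneg h2.K_nonneg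
  have hP : 0 ≤ ‖O.P‖ := norm_nonneg _
  have hc0 := O.const_pos.le
  have hc1 := O.one_le_const
  have h0 : (0 : ℝ) ∈ Icc 0 T := left_mem_Icc.2 hT.le
  have hg : Integrable (fun t => (3 + ‖O.P‖) * (ε * g t)) (timeMeasure T) :=
    (h2.g_int.const_mul ε).const_mul _
  have main := h.energy_estimate h2.interp hT h2.γ_deriv hg (hk.const_mul (ε ^ 2))
    (fun t => by have := h2.g_nonneg t; have := h2.ε_nonneg; positivity)
    (fun t => mul_nonneg (sq_nonneg _) (hk0 t)) (residual_le h2) hkb ht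
  have hinit : √(O.energy (O.eff (M.ι (L (σ 0) - σh 0)) (D.Q.starProjection (p 0) - ph 0))
      (D.Q.starProjection (p 0) - ph 0)) ≤ 2 * O.const * (3 + ‖O.P‖) * (ε * K) := by
    have a1 : ‖M.ι (L (σ 0) - σh 0)‖ ≤ 2 * (ε * K) := by
      have e : M.ι (L (σ 0) - σh 0) = M.ι (σ 0 - σh 0) - M.ι (σ 0 - L (σ 0)) := by
        rw [← map_sub]; congr 1; abel
      rw [e]
      refine (norm_sub_le _ _).trans ?_
      linarith [h2.σ_init, h2.σ_le 0 h0]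
    have a2 : ‖D.Q.starProjection (p 0) - ph 0‖ ≤ 2 * (ε * K) := by
      have e : D.Q.starProjection (p 0) - ph 0
        = (p 0 - ph 0) - (p 0 - D.Q.starProjection (p 0)) := by abel
      rw [e]
      refine (norm_sub_le _ _).trans ?_
      linarith [h2.p_init, h2.p_le 0 h0]
    refine (O.sqrt_energy_le _ _).trans ?_
    have a3 := norm_eff_le (O := O) (M.ι (L (σ 0) - σh 0)) (D.Q.starProjection (p 0) - ph 0)
    have a4 := mul_le_mul_of_nonneg_left a2 hP
    calc _ ≤ O.const * ((1 + ‖O.P‖) * (2 * (ε * K))) + O.const * (2 * (ε * K)) := by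
          refine add_le_add (mul_le_mul O.sqrt_norm_A_le_const ?_ (norm_nonneg _) hc0)
            (mul_le_mul O.sqrt_norm_S_le_const a2 (norm_nonneg _) hc0)
          linarith
      _ ≤ _ := by nlinarith [mul_nonneg hc0 hεK]
  have hint1 : 2 * ∫ s, O.const * ((3 + ‖O.P‖) * (ε * g s)) ∂(timeMeasure T)
      ≤ 2 * O.const * (3 + ‖O.P‖) * (ε * K) := by
    rw [integral_const_mul, integral_const_mul, integral_const_mul]
    have := mul_le_mul_of_nonneg_left h2.g_le h2.ε_nonneg
    have h3 : 0 ≤ 2 * O.const * (3 + ‖O.P‖) := by positivity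
    calc _ = 2 * O.const * (3 + ‖O.P‖) * (ε * ∫ s, g s ∂(timeMeasure T)) := by ring
      _ ≤ _ := mul_le_mul_of_nonneg_left this h3
  have hint2 : √(∫ s, O.const * (ε ^ 2 * k s) ∂(timeMeasure T))
      ≤ O.const * (3 + ‖O.P‖) * (ε * K) := by
    rw [integral_const_mul, integral_const_mul, Real.sqrt_mul hc0]
    have a1 : √(ε ^ 2 * ∫ s, k s ∂(timeMeasure T)) ≤ ε * K := by
      refine Real.sqrt_le_iff.2 ⟨hεK, ?_⟩
      rw [mul_pow]
      gcongr
    calc _ ≤ O.const * (ε * K) :=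
          mul_le_mul O.sqrt_const_le_const a1 (Real.sqrt_nonneg _) hc0
      _ ≤ _ := by nlinarith [mul_nonneg hc0 hεK, mul_nonneg (mul_nonneg hc0 hεK) hP]
  set ψ := O.eff (M.ι (L (σ t) - σh t)) (D.Q.starProjection (p t) - ph t)
  -- The factor 5 = 2 + 2 + 1 adds up `hinit`, `hint1` and `hint2`.
  have hψ : ‖ψ‖ ≤ O.const * (5 * O.const * (3 + ‖O.P‖) * (ε * K)) := by
    refine (O.norm_le_sqrt_A ψ).trans ?_
    refine mul_le_mul O.inv_sqrt_a_le_const ?_ (Real.sqrt_nonneg _) hc0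
    refine (O.sqrt_A_le_energy ψ (D.Q.starProjection (p t) - ph t)).trans (main.trans ?_)
    linarith
  have e : O.eff (M.ι (σ t - σh t)) (p t - ph t)
      = ψ + O.eff (M.ι (σ t - L (σ t))) (p t - D.Q.starProjection (p t)) := by
    rw [← eff_add, ← map_add]; congr 2 <;> abel
  have hρ := norm_eff_le (O := O) (M.ι (σ t - L (σ t))) (p t - D.Q.starProjection (p t))
  have h7 := mul_le_mul_of_nonneg_left (h2.p_le t ht) hP
  have h8 := h2.σ_le t ht
  rw [e]
  refine (norm_add_le _ _).trans ?_
  unfold Operators.effConst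
  nlinarith

theorem rotation_error (h : ErrorEqs D T σ σh u uh γ γh z zh p ph)
    (h2 : Consistent D T L σ σh γ p ph ε K γ' g) {t : ℝ} (ht : t ∈ Icc 0 T) {C : ℝ}
    (hC : ‖O.eff (M.ι (σ t - σh t)) (p t - ph t)‖ ≤ C * (ε * K)) :
    ‖γ t - γh t‖ ≤ (c * (‖O.A‖ * C + 1) + 1) * (ε * K) := by
  have h3 := h.rotation_estimate ht
  have h4 := h2.γ_le t ht
  have e : γ t - γh t = (γ t - D.G.starProjection (γ t)) + (D.G.starProjection (γ t) - γh t) := by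
    abel
  have h5 : c * (‖O.A‖ * ‖O.eff (M.ι (σ t - σh t)) (p t - ph t)‖
      + ‖γ t - D.G.starProjection (γ t)‖) ≤ c * (‖O.A‖ * (C * (ε * K)) + ε * K) := by
    have := D.c_nonneg
    gcongr
  rw [e]
  refine (norm_add_le _ _).trans ?_
  linarith

theorem displacement_error (h : ErrorEqs D T σ σh u uh γ γh z zh p ph) {t : ℝ} (ht : t ∈ Icc 0 T)
    {C C' : ℝ} (hC : ‖O.eff (M.ι (σ t - σh t)) (p t - ph t)‖ ≤ C * (ε * K))
    (hC' : ‖γ t - γh t‖ ≤ C' * (ε * K)) :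
    ‖D.V.starProjection (u t) - uh t‖ ≤ (c * (‖O.A‖ * C + C')) * (ε * K) := by
  refine (h.displacement_estimate ht).trans ?_
  have h5 : c * (‖O.A‖ * ‖O.eff (M.ι (σ t - σh t)) (p t - ph t)‖
      + ‖γ t - γh t‖) ≤ c * (‖O.A‖ * (C * (ε * K)) + C' * (ε * K)) := by
    have := D.c_nonneg
    gcongr
  linarith

/-- The constant in the bound of the flux error. -/
def _root_.Biot.Operators.fluxConst (O : Operators E F Q) : ℝ :=
  (√O.k)⁻¹ * (3 * O.const * (3 + ‖O.P‖)) + 1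

theorem _root_.Biot.Operators.fluxConst_pos (O : Operators E F Q) : 0 < O.fluxConst := by
  have := O.const_pos
  unfold Operators.fluxConst; positivity

theorem flux_error (h : ErrorEqs D T σ σh u uh γ γh z zh p ph)
    (h2 : Consistent D T L σ σh γ p ph ε K γ' g) (hT : 0 < T)
    (hg2 : Integrable (fun t => g t ^ 2) (timeMeasure T))
    (hgK : ∫ t, g t ^ 2 ∂(timeMeasure T) ≤ K ^ 2)
    {z' zt' : ℝ → F} {zt : ℝ → Wd}
    (hz : ∀ᵐ t ∂(timeMeasure T), HasDerivAt (fun s => M.j (z s)) (z' t) t)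
    (hzt : ∀ᵐ t ∂(timeMeasure T), HasDerivAt (fun s => M.j (zt s)) (zt' t) t)
    (hac : AbsolutelyContinuousOnInterval (fun s => M.j (zt s)) 0 T)
    (hzm : ∀ t ∈ Icc 0 T, zt t ∈ D.W ∧ ∀ q ∈ D.Q, ⟪M.d (zt t), q⟫_ℝ = ⟪M.d (z t), q⟫_ℝ)
    {k : ℝ → ℝ} (hk : Integrable k (timeMeasure T)) (hk0 : ∀ t, 0 ≤ k t)
    (hkK : ∫ t, k t ∂(timeMeasure T) ≤ K)
    (hkb : ∀ᵐ t ∂(timeMeasure T), ‖z' t - zt' t‖ ≤ ε * k t)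
    (hzK : ∀ t ∈ Icc 0 T, ‖M.j (z t - zt t)‖ ≤ ε * K)
    (hz0 : ‖M.j (z 0 - zh 0)‖ ≤ ε * K) {t : ℝ} (ht : t ∈ Icc 0 T) :
    ‖M.j (z t - zh t)‖ ≤ O.fluxConst * (ε * K) := by
  have hεK : 0 ≤ ε * K := mul_nonneg h2.ε_nonneg h2.K_nonneg
  have hP : 0 ≤ ‖O.P‖ := norm_nonneg _
  have hc0 := O.const_pos.le
  have h0 : (0 : ℝ) ∈ Icc 0 T := left_mem_Icc.2 hT.le
  have esq (t : ℝ) : ((3 + ‖O.P‖) * (ε * g t)) ^ 2 = ((3 + ‖O.P‖) * ε) ^ 2 * g t ^ 2 := by ring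
  have hg : Integrable (fun t => ((3 + ‖O.P‖) * (ε * g t)) ^ 2) (timeMeasure T) := by
    simp only [esq]
    exact hg2.const_mul _
  have main := h.flux_estimate h2.interp hT h2.γ_deriv hz hzt hac hzm hg (hk.const_mul ε)
    (fun t => mul_nonneg h2.ε_nonneg (hk0 t)) (residual_le h2) hkb ht
  have hinit : √⟪O.K (M.j (zt 0 - zh 0)), M.j (zt 0 - zh 0)⟫_ℝ ≤ O.const * (2 * (ε * K)) := by
    refine (sqrt_inner_map_self_le _ _).trans ?_
    refine mul_le_mul O.sqrt_norm_K_le_const ?_ (norm_nonneg _) hc0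
    have e : M.j (zt 0 - zh 0) = M.j (z 0 - zh 0) - M.j (z 0 - zt 0) := by
      rw [← map_sub]; congr 1; abel
    rw [e]
    refine (norm_sub_le _ _).trans ?_
    linarith [hzK 0 h0]
  have hint1 : 2 * ∫ s, O.const * (ε * k s) ∂(timeMeasure T) ≤ 2 * (O.const * (ε * K)) := by
    rw [integral_const_mul, integral_const_mul]
    have := h2.ε_nonneg
    gcongr
  have hint2 : √(∫ s, O.const ^ 2 * ((3 + ‖O.P‖) * (ε * g s)) ^ 2 ∂(timeMeasure T))
      ≤ O.const * ((3 + ‖O.P‖) * (ε * K)) := by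
    refine Real.sqrt_le_iff.2 ⟨by positivity, ?_⟩
    simp only [esq]
    -- Here the residuals enter through their square integral in time, bounded by `K²`; the square
    -- root restores the order `ε K`.
    rw [integral_const_mul, integral_const_mul]
    calc _ ≤ O.const ^ 2 * (((3 + ‖O.P‖) * ε) ^ 2 * K ^ 2) := by gcongr
      _ = _ := by ring
  have hζ : ‖M.j (zt t - zh t)‖ ≤ (√O.k)⁻¹ * (3 * O.const * (3 + ‖O.P‖) * (ε * K)) := by
    refine (O.norm_le_sqrt_K _).trans ?_
    refine mul_le_mul_of_nonneg_left (main.trans ?_) (by positivity)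
    nlinarith [mul_nonneg hc0 hεK, mul_nonneg (mul_nonneg hc0 hεK) hP]
  have e : M.j (z t - zh t) = M.j (z t - zt t) + M.j (zt t - zh t) := by
    rw [← map_add]; congr 1; abel
  rw [e]
  refine (norm_add_le _ _).trans ?_
  have := hzK t ht
  unfold Operators.fluxConst
  linarith

theorem pressure_error (h : ErrorEqs D T σ σh u uh γ γh z zh p ph)
    (h2 : Consistent D T L σ σh γ p ph ε K γ' g) {t : ℝ} (ht : t ∈ Icc 0 T) {C : ℝ}
    (hC : ‖M.j (z t - zh t)‖ ≤ C * (ε * K)) :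
    ‖p t - ph t‖ ≤ (c * (‖O.K‖ * C) + 1) * (ε * K) := by
  have h3 := h.pressure_estimate ht
  have h4 := h2.p_le t ht
  have e : p t - ph t = (p t - D.Q.starProjection (p t)) + (D.Q.starProjection (p t) - ph t) := by
    abel
  have h5 : c * (‖O.K‖ * ‖M.j (z t - zh t)‖) ≤ c * (‖O.K‖ * (C * (ε * K))) := by
    have := D.c_nonneg
    gcongr
  rw [e]
  refine (norm_add_le _ _).trans ?_
  linarith

/-- The first energy estimate controls only the combination of stress and pressure, so the stress is
recovered once the pressure is known. Its bound therefore inherits the stronger norms of the flux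
estimate. -/
theorem stress_error {σ : E} {p : Q} {B C C' : ℝ} (hC : ‖O.eff σ p‖ ≤ C * B)
    (hC' : ‖p‖ ≤ C' * B) : ‖σ‖ ≤ (C + ‖O.P‖ * C') * B := by
  have e : σ = O.eff σ p - O.P p := by simp [Operators.eff]
  rw [e]
  refine (norm_sub_le _ _).trans ?_
  have h1 := (O.P.le_opNorm p).trans (mul_le_mul_of_nonneg_left hC' (norm_nonneg _))
  linarith

end ErrorEqs

/-! ### Approximation errors of the finite element spaces -/

section HmMaps

variable {n : ℕ} {Ω : Set (Vec n)} {m : ℕ} {X : Type*} [NormedAddCommGroup X] [NormedSpace ℝ X]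
  [CompleteSpace X]

theorem norm_hmFn_le (F : Hm Ω m X) : ‖hmFn F‖ ≤ ‖F‖ := PiLp.norm_apply_le F.1 _

/-- The inclusion of `H^m` into `L²` as a continuous linear map. -/
def hmFnL (Ω : Set (Vec n)) (m : ℕ) (X : Type*) [NormedAddCommGroup X] [NormedSpace ℝ X]
    [CompleteSpace X] : Hm Ω m X →L[ℝ] L2 Ω X :=
  LinearMap.mkContinuous { toFun := hmFn, map_add' := fun _ _ => rfl, map_smul' := fun _ _ => rfl }
    1 fun F => by rw [one_mul]; exact norm_hmFn_le F

/-- Multi-indices of order at most one as multi-indices of order at most `m`. -/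
def MIdx.ofOne {m : ℕ} (hm : 1 ≤ m) (a : MIdx n 1) : MIdx n m :=
  ⟨fun i => Fin.castLE (by omega) (a.1 i), by
    have := a.2
    simp only [Fin.val_castLE]
    omega⟩

/-- The derivatives of order at most one of a function in `H^m`. -/
def hmRestrictAux (hm : 1 ≤ m) : Hm Ω m X →L[ℝ] PiLp 2 fun _ : MIdx n 1 => L2 Ω X :=
  (PiLp.continuousLinearEquiv 2 ℝ (fun _ : MIdx n 1 => L2 Ω X)).symm.toContinuousLinearMap ∘L
    (ContinuousLinearMap.pi fun a : MIdx n 1 =>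
      ContinuousLinearMap.proj (R := ℝ) (φ := fun _ : MIdx n m => L2 Ω X) (MIdx.ofOne hm a)) ∘L
    (PiLp.continuousLinearEquiv 2 ℝ (fun _ : MIdx n m => L2 Ω X)).toContinuousLinearMap ∘L
    (Hm Ω m X).subtypeL

theorem hmRestrictAux_apply (hm : 1 ≤ m) (F : Hm Ω m X) (a : MIdx n 1) :
    hmRestrictAux hm F a = F.1 (MIdx.ofOne hm a) := rfl

/-- The inclusion `H^m ⊆ H^1`. -/
def hmRestrict (hm : 1 ≤ m) : Hm Ω m X →L[ℝ] Hm Ω 1 X :=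
  (hmRestrictAux hm).codRestrict (Hm Ω 1 X) fun F a => by
    rw [hmRestrictAux_apply, hmRestrictAux_apply]
    exact F.2 (MIdx.ofOne hm a)

theorem hmFn_hmRestrict (hm : 1 ≤ m) (F : Hm Ω m X) : hmFn (hmRestrict hm F) = hmFn F := rfl

theorem hmNorm_hmFn_le (F : Hm Ω m X) : hmNorm m (hmFn F) ≤ ‖F‖ₑ :=
  iInf₂_le (f := fun (G : Hm Ω m X) (_ : hmFn G = hmFn F) => ‖G‖ₑ) F rfl

theorem norm_le_of_enorm_le {Y Z : Type*} [NormedAddCommGroup Y] [NormedAddCommGroup Z] {y : Y}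
    {z : Z} {a : ℝ} (h : ‖y‖ₑ ≤ ENNReal.ofReal a * ‖z‖ₑ) : ‖y‖ ≤ |a| * ‖z‖ := by
  rw [← ofReal_norm, ← ofReal_norm, ← ENNReal.ofReal_mul' (norm_nonneg _)] at h
  have h2 : ENNReal.ofReal ‖y‖ ≤ ENNReal.ofReal (|a| * ‖z‖) :=
    h.trans (ENNReal.ofReal_le_ofReal (by gcongr; exact le_abs_self a))
  exact (ENNReal.ofReal_le_ofReal_iff (by positivity)).1 h2

end HmMaps

theorem enorm_sub_starProjection_le {H : Type*} [NormedAddCommGroup H] [InnerProductSpace ℝ H]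
    (Z : Submodule ℝ H) [Z.HasOrthogonalProjection] (x : H) :
    ‖x - Z.starProjection x‖ₑ ≤ Metric.infEDist x Z := by
  refine Metric.le_infEDist.2 fun y hy => ?_
  rw [edist_eq_enorm_sub, ← ofReal_norm, ← ofReal_norm]
  refine ENNReal.ofReal_le_ofReal ?_
  rw [Z.starProjection_minimal]
  exact ciInf_le ⟨0, by rintro _ ⟨x, rfl⟩; exact norm_nonneg _⟩ (⟨y, hy⟩ : Z)

section Approximation

variable {n : ℕ} {Ω : Set (Vec n)}

theorem ApproxOrder.norm_le {X : Type*} [NormedAddCommGroup X] [InnerProductSpace ℝ X]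
    [CompleteSpace X] {Ξ Ξh : Submodule ℝ (L2 Ω X)} {h c : ℝ} {k m : ℕ}
    (H : ApproxOrder Ξ Ξh h c k) [FiniteDimensional ℝ Ξh] (hh : 0 < h) (hm : 1 ≤ m) (hmk : m ≤ k)
    {F : Hm Ω m X} {f : L2 Ω X} (hF : hmFn F = f) (hΞ : f ∈ Ξ) :
    ‖f - Ξh.starProjection f‖ ≤ h ^ m * (|c| * ‖F‖) := by
  have h1 := (enorm_sub_starProjection_le Ξh f).trans (H m hm hmk f hΞ)
  have h2 : hmNorm m f ≤ ‖F‖ₑ := by rw [← hF]; exact hmNorm_hmFn_le F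
  refine (norm_le_of_enorm_le (h1.trans (mul_le_mul_right h2 _))).trans_eq ?_
  rw [abs_mul, abs_of_pos (pow_pos hh m)]; ring

/-- The embeddings and divergences of the spaces of the Biot system. -/
def embeddings (Ω : Set (Vec n)) :
    Embeddings (L2 Ω (Mat n)) (L2 Ω (Vec n)) (L2 Ω (Vec n)) (L2 Ω ℝ) (HdivMat Ω) (HdivVec Ω) where
  ι := (mfn Ω).mkContinuous 1 fun τ => by rw [one_mul]; exact WithLp.norm_fst_le _ τ.1
  δ := (mdiv Ω).mkContinuous 1 fun τ => by rw [one_mul]; exact WithLp.norm_snd_le _ τ.1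
  j := (vfn Ω).mkContinuous 1 fun τ => by rw [one_mul]; exact WithLp.norm_fst_le _ τ.1
  d := (vdiv Ω).mkContinuous 1 fun τ => by rw [one_mul]; exact WithLp.norm_snd_le _ τ.1
  ι_le := fun τ => WithLp.norm_fst_le _ τ.1
  j_le := fun τ => WithLp.norm_fst_le _ τ.1

end Approximation

/-! ### Stable finite element spaces as discretizations of the abstract system -/

section Approximation

variable {n : ℕ} {Ω : Set (Vec n)}

theorem embeddings_ι (τ : HdivMat Ω) : (embeddings Ω).ι τ = mfn Ω τ := rfl

theorem embeddings_δ (τ : HdivMat Ω) : (embeddings Ω).δ τ = mdiv Ω τ := rfl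

theorem embeddings_d (w : HdivVec Ω) : (embeddings Ω).d w = vdiv Ω w := rfl

theorem le_abs_mul {a b c : ℝ} (h : a ≤ c * b) (hb : 0 ≤ b) : a ≤ |c| * b :=
  h.trans (mul_le_mul_of_nonneg_right (le_abs_self c) hb)

theorem Stable.embeddings_infsup_W {Y : Spaces Ω} {h c : ℝ} {r r' : ℕ} (H : Stable Y h c r r')
    (q : L2 Ω ℝ) (hq : q ∈ Y.Q) : ∃ w ∈ Y.W, (embeddings Ω).d w = q ∧ ‖w‖ ≤ |c| * ‖q‖ :=
  (H.infsup_W q hq).elim fun w h =>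
    ⟨w, h.1, (embeddings_d w).trans h.2.1, le_abs_mul h.2.2 (norm_nonneg _)⟩

theorem Stable.embeddings_infsup_S {Y : Spaces Ω} {h c : ℝ} {r r' : ℕ} (H : Stable Y h c r r')
    (v : L2 Ω (Vec n)) (hv : v ∈ Y.V) (η : L2 Ω (Mat n)) (hη : η ∈ Y.G) :
    ∃ τ ∈ Y.S, (embeddings Ω).δ τ = v ∧
      (∀ η' ∈ Y.G, ⟪(embeddings Ω).ι τ, η'⟫_ℝ = ⟪η, η'⟫_ℝ) ∧ ‖τ‖ ≤ |c| * (‖v‖ + ‖η‖) :=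
  (H.infsup_S v hv η hη).elim fun τ h =>
    ⟨τ, h.1, (embeddings_δ τ).trans h.2.1, fun η' hη' => by rw [embeddings_ι]; exact h.2.2.1 η' hη',
      le_abs_mul h.2.2.2 (add_nonneg (norm_nonneg _) (norm_nonneg _))⟩

theorem Stable.embeddings_div_S {Y : Spaces Ω} {h c : ℝ} {r r' : ℕ} (H : Stable Y h c r r') :
    ∀ τ ∈ Y.S, (embeddings Ω).δ τ ∈ Y.V := fun τ hτ => by
  rw [← H.div_S]; exact Submodule.mem_map_of_mem (f := mdiv Ω) hτ

theorem Stable.embeddings_div_W {Y : Spaces Ω} {h c : ℝ} {r r' : ℕ} (H : Stable Y h c r r') :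
    ∀ w ∈ Y.W, (embeddings Ω).d w ∈ Y.Q := fun w hw => by
  rw [← H.div_W]; exact Submodule.mem_map_of_mem (f := vdiv Ω) hw

/-- The discretization given by stable finite element spaces. -/
def Stable.discretization {Y : Spaces Ω} {h c : ℝ} {r r' : ℕ} (H : Stable Y h c r r')
    {O : Operators (L2 Ω (Mat n)) (L2 Ω (Vec n)) (L2 Ω ℝ)} (hO : O.skew = skewFields Ω) :
    Discretization O (embeddings Ω) |c| where
  S := Y.S
  V := Y.V
  G := Y.G
  W := Y.W
  Q := Y.Q
  finite_S := H.finite_S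
  finite_V := H.finite_V
  finite_G := H.finite_G
  finite_W := H.finite_W
  finite_Q := H.finite_Q
  G_skew := hO ▸ H.G_skew
  div_S := H.embeddings_div_S
  div_W := H.embeddings_div_W
  c_nonneg := abs_nonneg c
  infsup_W := H.embeddings_infsup_W
  infsup_S := H.embeddings_infsup_S

theorem Stable.divMatch {Y : Spaces Ω} {h c : ℝ} {r r' : ℕ} (H : Stable Y h c r r')
    {O : Operators (L2 Ω (Mat n)) (L2 Ω (Vec n)) (L2 Ω ℝ)} (hO : O.skew = skewFields Ω)
    {τ σ : HdivMat Ω} (h1 : ∀ v ∈ Y.V, ⟪mdiv Ω τ, v⟫_ℝ = ⟪mdiv Ω σ, v⟫_ℝ) :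
    (H.discretization hO).DivMatch τ σ := fun v hv => by
  rw [embeddings_δ, embeddings_δ]; exact h1 v hv

theorem norm_sub_le_of_enorm_le {X : Type*} [NormedAddCommGroup X] [NormedSpace ℝ X]
    [CompleteSpace X] {h c : ℝ} (hh : 0 < h) {m : ℕ} {F : Hm Ω m X} {e : L2 Ω X}
    (H : ‖e‖ₑ ≤ ENNReal.ofReal (c * h ^ m) * hmNorm m (hmFn F)) : ‖e‖ ≤ h ^ m * (|c| * ‖F‖) := by
  have h2 := norm_le_of_enorm_le (H.trans (mul_le_mul_right (hmNorm_hmFn_le F) _))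
  rw [abs_mul, abs_of_pos (pow_pos hh m)] at h2
  exact h2.trans_eq (by ring)

/-- The tensor interpolation as an operator on `H^m`. -/
theorem Stable.exists_tensor_interp {Y : Spaces Ω} {h c : ℝ} {r r' : ℕ} (H : Stable Y h c r r')
    (hh : 0 < h) {m : ℕ} (hm : 1 ≤ m) (hmr : m ≤ r) :
    ∃ P : Hm Ω m (Mat n) → HdivMat Ω, (∀ F, P F ∈ Y.S) ∧
      (∀ F, ∀ w, mfn Ω w = hmFn F → ∀ q ∈ Y.V, ⟪mdiv Ω (P F), q⟫_ℝ = ⟪mdiv Ω w, q⟫_ℝ) ∧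
      ∀ F, ‖hmFn F - mfn Ω (P F)‖ ≤ h ^ m * (|c| * ‖F‖) := by
  have h0 := H.interp_S
  refine h0.elim fun P hP => ⟨fun F => P (hmRestrict hm F), ?_, ?_, ?_⟩
  · exact fun F => hP.1 (hmRestrict hm F)
  · intro F w hw
    rw [← hmFn_hmRestrict hm F] at hw
    exact hP.2.1 (hmRestrict hm F) w hw
  · intro F
    have h1 := hP.2.2 m hm hmr (hmRestrict hm F)
    rw [hmFn_hmRestrict] at h1
    exact norm_sub_le_of_enorm_le hh h1

/-- The flux interpolation as a continuous linear map on `H^m`. -/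
theorem Stable.exists_flux_interp {Y : Spaces Ω} {h c : ℝ} {r r' : ℕ} (H : Stable Y h c r r')
    (hh : 0 < h) {m : ℕ} (hm : 1 ≤ m) (hmr : m ≤ r) :
    ∃ P : Hm Ω m (Vec n) →L[ℝ] HdivVec Ω, (∀ F, P F ∈ Y.W) ∧
      (∀ F, ∀ w, vfn Ω w = hmFn F → ∀ q ∈ Y.Q, ⟪vdiv Ω (P F), q⟫_ℝ = ⟪vdiv Ω w, q⟫_ℝ) ∧
      ∀ F, ‖hmFn F - vfn Ω (P F)‖ ≤ h ^ m * (|c| * ‖F‖) := by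
  have h0 := H.interp_W
  -- Continuity and linearity are kept for the flux interpolation because the interpolant of a
  -- time-dependent flux will be differentiated in time.
  refine h0.elim fun P hP => ⟨P ∘L hmRestrict hm, ?_, ?_, ?_⟩
  · exact fun F => hP.1 (hmRestrict hm F)
  · intro F w hw
    rw [← hmFn_hmRestrict hm F] at hw
    exact hP.2.1 (hmRestrict hm F) w hw
  · intro F
    have h1 := hP.2.2 m hm hmr (hmRestrict hm F)
    rw [hmFn_hmRestrict] at h1
    exact norm_sub_le_of_enorm_le hh h1

/-- The error of the divergence preserving projection. -/
theorem Stable.interp_le {Y : Spaces Ω} {h c : ℝ} {r r' : ℕ} (H : Stable Y h c r r')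
    {O : Operators (L2 Ω (Mat n)) (L2 Ω (Vec n)) (L2 Ω ℝ)} (hO : O.skew = skewFields Ω)
    (hh : 0 < h) {m : ℕ} (hm : 1 ≤ m) (hmr : m ≤ r) {L : HdivMat Ω →L[ℝ] HdivMat Ω}
    (hL : ∀ σ, ∀ τ ∈ Y.S, (H.discretization hO).DivMatch τ σ →
      ‖mfn Ω σ - mfn Ω (L σ)‖ ≤ (1 + |c|) * ‖mfn Ω σ - mfn Ω τ‖) {σ : HdivMat Ω}
    {F : Hm Ω m (Mat n)} (hF : hmFn F = mfn Ω σ) :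
    ‖mfn Ω (σ - L σ)‖ ≤ h ^ m * ((1 + |c|) * |c| * ‖F‖) :=
  (H.exists_tensor_interp hh hm hmr).elim fun P hP => by
    have h1 := hL σ (P F) (hP.1 F) (H.divMatch hO (hP.2.1 F σ hF.symm))
    have h2 := hP.2.2 F
    rw [hF] at h2
    rw [map_sub]
    refine h1.trans ((mul_le_mul_of_nonneg_left h2
      (add_nonneg zero_le_one (abs_nonneg c))).trans_eq ?_)
    ring

end Approximation

/-! ### Differences of the exact and the discrete variational equations -/

section Subtraction

variable {E V F Q Sg Wd : Type*} [NormedAddCommGroup E] [InnerProductSpace ℝ E]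
  [NormedAddCommGroup V] [InnerProductSpace ℝ V] [NormedAddCommGroup F] [InnerProductSpace ℝ F]
  [NormedAddCommGroup Q] [InnerProductSpace ℝ Q] [NormedAddCommGroup Sg] [NormedSpace ℝ Sg]
  [NormedAddCommGroup Wd] [NormedSpace ℝ Wd] (O : Operators E F Q) (M : Embeddings E V F Q Sg Wd)

theorem stress_sub {σ σ' τ : Sg} {p p' : Q} {u u' : V} {γ γ' : E}
    (h1 : ⟪O.A (O.eff (M.ι σ) p), O.eff (M.ι τ) 0⟫_ℝ + ⟪u, M.δ τ⟫_ℝ + ⟪γ, M.ι τ⟫_ℝ = 0)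
    (h2 : ⟪O.A (O.eff (M.ι σ') p'), O.eff (M.ι τ) 0⟫_ℝ + ⟪u', M.δ τ⟫_ℝ + ⟪γ', M.ι τ⟫_ℝ = 0) :
    ⟪O.A (O.eff (M.ι (σ - σ')) (p - p')), M.ι τ⟫_ℝ + ⟪u - u', M.δ τ⟫_ℝ + ⟪γ - γ', M.ι τ⟫_ℝ
      = 0 := by
  have e : O.eff (M.ι τ) 0 = M.ι τ := by unfold Operators.eff; rw [map_zero, add_zero]
  rw [e] at h1 h2
  rw [map_sub, ErrorEqs.eff_sub, map_sub, inner_sub_left, inner_sub_left, inner_sub_left]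
  linarith

theorem momentum_sub {σ σ' : Sg} {v f : V} {e e' : E} (h1 : ⟪M.δ σ, v⟫_ℝ + ⟪e, 0⟫_ℝ = -⟪f, v⟫_ℝ)
    (h2 : ⟪M.δ σ', v⟫_ℝ + ⟪e', 0⟫_ℝ = -⟪f, v⟫_ℝ) : ⟪M.δ (σ - σ'), v⟫_ℝ = 0 := by
  rw [inner_zero_right] at h1 h2
  rw [map_sub, inner_sub_left]
  linarith

theorem symmetry_sub {σ σ' : Sg} {v v' f : V} {η : E}
    (h1 : ⟪v, 0⟫_ℝ + ⟪M.ι σ, η⟫_ℝ = -⟪f, 0⟫_ℝ) (h2 : ⟪v', 0⟫_ℝ + ⟪M.ι σ', η⟫_ℝ = -⟪f, 0⟫_ℝ) :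
    ⟪M.ι (σ - σ'), η⟫_ℝ = 0 := by
  rw [inner_zero_right, inner_zero_right] at h1 h2
  rw [map_sub, inner_sub_left]
  linarith

theorem darcy_sub {z z' w : Wd} {p p' : Q} (h1 : ⟪O.K (M.j z), M.j w⟫_ℝ + ⟪p, M.d w⟫_ℝ = 0)
    (h2 : ⟪O.K (M.j z'), M.j w⟫_ℝ + ⟪p', M.d w⟫_ℝ = 0) :
    ⟪O.K (M.j (z - z')), M.j w⟫_ℝ + ⟪p - p', M.d w⟫_ℝ = 0 := by
  rw [map_sub, map_sub, inner_sub_left, inner_sub_left]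
  linarith

theorem mass_sub {σ σ' : Sg} {z z' : Wd} {p p' q g : Q}
    (h1 : ⟪O.S p, q⟫_ℝ + ⟪O.A (O.eff (M.ι σ) p), O.eff 0 q⟫_ℝ - ⟪M.d z, q⟫_ℝ = ⟪g, q⟫_ℝ)
    (h2 : ⟪O.S p', q⟫_ℝ + ⟪O.A (O.eff (M.ι σ') p'), O.eff 0 q⟫_ℝ - ⟪M.d z', q⟫_ℝ = ⟪g, q⟫_ℝ) :
    ⟪O.S (p - p'), q⟫_ℝ + ⟪O.A (O.eff (M.ι (σ - σ')) (p - p')), O.P q⟫_ℝ - ⟪M.d (z - z'), q⟫_ℝ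
      = 0 := by
  have e : O.eff 0 q = O.P q := by unfold Operators.eff; rw [zero_add]
  rw [e] at h1 h2
  rw [map_sub O.S, map_sub M.ι, map_sub M.d, ErrorEqs.eff_sub, map_sub O.A, inner_sub_left,
    inner_sub_left, inner_sub_left]
  linarith

end Subtraction

section ErrorEquations

variable {n : ℕ} {Ω : Set (Vec n)} {D : Coeffs n} {T : ℝ} {Y : Spaces Ω}
  {O : Operators (L2 Ω (Mat n)) (L2 Ω (Vec n)) (L2 Ω ℝ)} {f : ℝ → L2 Ω (Vec n)}
  {g : ℝ → L2 Ω ℝ} {s sh : Fields Ω} {t : ℝ}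

theorem IsSolution.stress_eq
    (hA : ∀ σ p τ q, formA D σ p τ q = ⟪O.A (O.eff σ p), O.eff τ q⟫_ℝ)
    (hs : IsSolution D T Y f g s) (ht : t ∈ Icc 0 T) (τ : HdivMat Ω) (hτ : τ ∈ Y.S) :
    ⟪O.A (O.eff (mfn Ω (s.σ t)) (s.p t)), O.eff (mfn Ω τ) 0⟫_ℝ
      + ⟪s.u t, mdiv Ω τ⟫_ℝ + ⟪s.γ t, mfn Ω τ⟫_ℝ = 0 := by
  rw [← hA]; exact hs.eq1 t ht τ hτ

theorem IsSolution.darcy_eq (hK : ∀ z w, formκ D z w = ⟪O.K z, w⟫_ℝ)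
    (hs : IsSolution D T Y f g s) (ht : t ∈ Icc 0 T) (w : HdivVec Ω) (hw : w ∈ Y.W) :
    ⟪O.K (vfn Ω (s.z t)), vfn Ω w⟫_ℝ + ⟪s.p t, vdiv Ω w⟫_ℝ = 0 := by
  rw [← hK]; exact hs.eq3 t ht w hw

theorem IsSolution.mass_eq
    (hA : ∀ σ p τ q, formA D σ p τ q = ⟪O.A (O.eff σ p), O.eff τ q⟫_ℝ)
    (hS : ∀ p q, formS D p q = ⟪O.S p, q⟫_ℝ)
    (hs : IsSolution D T Y f g s) (ht : t ∈ Icc 0 T) (q : L2 Ω ℝ) (hq : q ∈ Y.Q) :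
    ⟪O.S (dt T s.p t), q⟫_ℝ + ⟪O.A (O.eff (mfn Ω (dt T s.σ t)) (dt T s.p t)), O.eff 0 q⟫_ℝ
      - ⟪vdiv Ω (s.z t), q⟫_ℝ = ⟪g t, q⟫_ℝ := by
  rw [← hA, ← hS]; exact hs.eq4 t ht q hq

/-- The exact and the semidiscrete solution satisfy the error equations. -/
theorem errorEqs {h c : ℝ} {r r' : ℕ} (H : Stable Y h c r r') (hO : O.skew = skewFields Ω)
    (hA : ∀ σ p τ q, formA D σ p τ q = ⟪O.A (O.eff σ p), O.eff τ q⟫_ℝ)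
    (hK : ∀ z w, formκ D z w = ⟪O.K z, w⟫_ℝ) (hS : ∀ p q, formS D p q = ⟪O.S p, q⟫_ℝ)
    (hs : IsSolution D T (fullSpaces Ω) f g s) (hsh : IsSolution D T Y f g sh) :
    ErrorEqs (H.discretization hO) T s.σ sh.σ s.u sh.u s.γ sh.γ s.z sh.z s.p sh.p where
  σ_reg := hs.σ_reg
  σh_reg := hsh.σ_reg
  p_reg := hs.p_reg
  ph_reg := hsh.p_reg
  σh_mem := hsh.σ_mem
  uh_mem := hsh.u_mem
  γh_mem := hsh.γ_mem
  zh_mem := hsh.z_mem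
  ph_mem := hsh.p_mem
  γ_skew := fun t ht => by rw [hO]; exact hs.γ_mem t ht
  eq1 := fun t ht τ hτ => stress_sub O (embeddings Ω) (hs.stress_eq hA ht τ Submodule.mem_top)
    (hsh.stress_eq hA ht τ hτ)
  eq2v := fun t ht v hv => momentum_sub (embeddings Ω)
    (hs.eq2 t ht v Submodule.mem_top 0 (Submodule.zero_mem _))
    (hsh.eq2 t ht v hv 0 (Submodule.zero_mem _))
  eq2η := fun t ht η hη => symmetry_sub (embeddings Ω)
    (hs.eq2 t ht 0 Submodule.mem_top η (H.G_skew hη))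
    (hsh.eq2 t ht 0 (Submodule.zero_mem _) η hη)
  eq3h := fun t ht => hsh.darcy_eq hK ht
  eq3 := fun t ht w hw => darcy_sub O (embeddings Ω) (hs.darcy_eq hK ht w Submodule.mem_top)
    (hsh.darcy_eq hK ht w hw)
  eq4 := fun t ht q hq => mass_sub O (embeddings Ω) (hs.mass_eq hA hS ht q Submodule.mem_top)
    (hsh.mass_eq hA hS ht q hq)

end ErrorEquations

/-! ### Representatives of the space-time norms -/

/-- Every norm of the solution in the error bounds is an infimum over representatives and may be
infinite. A real number `K` strictly above the norm yields actual representatives of size below `K`,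
and an infinite norm leaves nothing to prove. -/
theorem le_mul_of_forall_lt {X B : ℝ≥0∞} {a : ℝ} (ha : 0 < a)
    (H : ∀ K : ℝ, 0 < K → B < ENNReal.ofReal K → X ≤ ENNReal.ofReal (a * K)) :
    X ≤ ENNReal.ofReal a * B := by
  have ha' : ENNReal.ofReal a ≠ 0 := by simpa using ha
  rw [mul_comm, ← ENNReal.div_le_iff_le_mul (Or.inl ha') (Or.inl ENNReal.ofReal_ne_top)]
  refine le_of_forall_gt_imp_ge_of_dense fun b hb => ?_
  rcases eq_or_ne b ∞ with rfl | hbt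
  · exact le_top
  rw [ENNReal.div_le_iff_le_mul (Or.inl ha') (Or.inl ENNReal.ofReal_ne_top)]
  have hb0 : 0 < b.toReal := ENNReal.toReal_pos (ne_bot_of_gt hb) hbt
  have := H b.toReal hb0 (by rwa [ENNReal.ofReal_toReal hbt])
  rwa [mul_comm, ENNReal.ofReal_mul hb0.le, ENNReal.ofReal_toReal hbt] at this

section Time

variable {H : Type*} [NormedAddCommGroup H] {T : ℝ}

theorem integral_norm_le_of_eLpNorm_one {F : ℝ → H} {K : ℝ} (hK : 0 ≤ K)
    (hF : AEStronglyMeasurable F (timeMeasure T))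
    (h : eLpNorm F 1 (timeMeasure T) ≤ ENNReal.ofReal K) : ∫ t, ‖F t‖ ∂(timeMeasure T) ≤ K := by
  rw [integral_norm_eq_lintegral_enorm hF, ← eLpNorm_one_eq_lintegral_enorm]
  exact ENNReal.toReal_le_of_le_ofReal hK h

theorem integral_sq_le_of_eLpNorm_two {F : ℝ → H} {K : ℝ} (hK : 0 ≤ K)
    (hF : AEStronglyMeasurable F (timeMeasure T))
    (h : eLpNorm F 2 (timeMeasure T) ≤ ENNReal.ofReal K) :
    Integrable (fun t => ‖F t‖ ^ 2) (timeMeasure T) ∧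
      ∫ t, ‖F t‖ ^ 2 ∂(timeMeasure T) ≤ K ^ 2 := by
  have hm : MemLp F 2 (timeMeasure T) := ⟨hF, h.trans_lt ENNReal.ofReal_lt_top⟩
  have hi : Integrable (fun t => ‖F t‖ ^ 2) (timeMeasure T) := hm.integrable_norm_pow two_ne_zero
  refine ⟨hi, ?_⟩
  have h0 : 0 ≤ ∫ t, ‖F t‖ ^ 2 ∂(timeMeasure T) := integral_nonneg fun _ => sq_nonneg _
  rw [hm.eLpNorm_eq_integral_rpow_norm two_ne_zero ENNReal.ofNat_ne_top] at h
  have h1 := (ENNReal.ofReal_le_ofReal_iff hK).1 h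
  simp only [ENNReal.toReal_ofNat, Real.rpow_ofNat] at h1
  rw [← one_div, ← Real.sqrt_eq_rpow] at h1
  exact (Real.sqrt_le_left hK).1 h1

/-- Hölder's inequality on `[0, T]` costs √T for `q = 2` and nothing for `q = 1`; the factor covers
both cases. -/
theorem eLpNorm_one_le {F : ℝ → H} {q : ℝ≥0∞} (hq : q = 1 ∨ q = 2) (hT : 0 < T)
    (hF : AEStronglyMeasurable F (timeMeasure T)) :
    eLpNorm F 1 (timeMeasure T) ≤ ENNReal.ofReal (1 + √T) * eLpNorm F q (timeMeasure T) := by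
  rcases hq with rfl | rfl
  · refine le_mul_of_one_le_left' ?_
    rw [ENNReal.one_le_ofReal]
    linarith [Real.sqrt_nonneg T]
  · have h := eLpNorm_le_eLpNorm_mul_rpow_measure_univ (p := 1) (q := 2) one_le_two hF
    refine h.trans ?_
    rw [mul_comm]
    refine mul_le_mul_left ?_ _
    have e : (timeMeasure T) univ = ENNReal.ofReal T := by simp [timeMeasure]
    rw [e, ENNReal.ofReal_rpow_of_pos hT]
    refine ENNReal.ofReal_le_ofReal ?_
    have e2 : (1 / (1 : ℝ≥0∞).toReal - 1 / (2 : ℝ≥0∞).toReal) = 1 / 2 := by norm_num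
    rw [e2, ← Real.sqrt_eq_rpow]
    linarith

/-- The constant in the embeddings of the function spaces on `[0, T]`. -/
def timeConst (T : ℝ) : ℝ := (1 / T + 1) * (1 + √T)

theorem timeConst_pos (hT : 0 < T) : 0 < timeConst T := by unfold timeConst; positivity

theorem one_le_timeConst (hT : 0 < T) : 1 ≤ timeConst T := by
  have : 0 < 1 / T := by positivity
  have := Real.sqrt_nonneg T
  unfold timeConst; nlinarith

theorem one_add_sqrt_le_timeConst (hT : 0 < T) : 1 + √T ≤ timeConst T := by
  have : 0 < 1 / T := by positivity
  have := Real.sqrt_nonneg T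
  unfold timeConst; nlinarith

theorem integral_norm_le_of_eLpNorm {F : ℝ → H} {q : ℝ≥0∞} (hq : q = 1 ∨ q = 2) (hT : 0 < T)
    {K : ℝ} (hK : 0 ≤ K) (hF : AEStronglyMeasurable F (timeMeasure T))
    (h : eLpNorm F q (timeMeasure T) ≤ ENNReal.ofReal K) :
    ∫ t, ‖F t‖ ∂(timeMeasure T) ≤ (1 + √T) * K := by
  have := Real.sqrt_nonneg T
  refine integral_norm_le_of_eLpNorm_one (by positivity) hF ?_
  rw [ENNReal.ofReal_mul (by positivity)]
  exact (eLpNorm_one_le hq hT hF).trans (mul_le_mul_right h _)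

variable [NormedSpace ℝ H]

theorem IsW1.aestronglyMeasurable {q : ℝ≥0∞} (hq : 1 ≤ q) (hT : 0 ≤ T) {F F' : ℝ → H}
    (h : IsW1 T q F F') : AEStronglyMeasurable F (timeMeasure T) :=
  (h.continuousOn hq hT).aestronglyMeasurable measurableSet_Icc

theorem IsW1.norm_le_const {q : ℝ≥0∞} (hq : q = 1 ∨ q = 2) (hT : 0 < T) {F F' : ℝ → H}
    (h : IsW1 T q F F') {K : ℝ} (hK : 0 ≤ K) (hF : eLpNorm F q (timeMeasure T) ≤ ENNReal.ofReal K)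
    (hF' : eLpNorm F' q (timeMeasure T) ≤ ENNReal.ofReal K) {t : ℝ} (ht : t ∈ Icc 0 T) :
    ‖F t‖ ≤ timeConst T * K := by
  have hq1 : 1 ≤ q := by rcases hq with rfl | rfl <;> norm_num
  have h1 := h.norm_le hq1 hT ht
  have hm := h.aestronglyMeasurable hq1 hT.le
  have h2 := integral_norm_le_of_eLpNorm hq hT hK hm hF
  have h3 := integral_norm_le_of_eLpNorm hq hT hK h.1.1 hF'
  -- In `timeConst`, the factor `1 / T + 1` stems from dividing the averaged bound by `T`, and `1 +
  -- √T` from Hölder's inequality.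
  have h4 : T * ‖F t‖ ≤ T * (timeConst T * K) := by
    have e : T * (timeConst T * K) = (1 + √T) * K + T * ((1 + √T) * K) := by
      unfold timeConst; field_simp
    rw [e]
    exact h1.trans (add_le_add h2 (mul_le_mul_of_nonneg_left h3 hT.le))
  exact le_of_mul_le_mul_left h4 hT

end Time

section AbstractRepresentatives

variable {H X : Type*} [NormedAddCommGroup H] [NormedSpace ℝ H] [NormedAddCommGroup X]
  [NormedSpace ℝ X] {T : ℝ} {q : ℝ≥0∞} {i : H →L[ℝ] X} {f : ℝ → X} {K : ℝ} {F F' : ℝ → H}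

/-- `F` represents `f` in the smaller space `H`, with time derivative `F'`, and the norm of `F` in
`W^{1,q}(J; H)` is at most `K`. -/
structure IsRep (T : ℝ) (q : ℝ≥0∞) (i : H →L[ℝ] X) (f : ℝ → X) (K : ℝ) (F F' : ℝ → H) : Prop where
  isW1 : IsW1 T q F F'
  rep : ∀ t ∈ Icc 0 T, i (F t) = f t
  norm_le : ∀ t ∈ Icc 0 T, ‖F t‖ ≤ timeConst T * K
  integral_le : ∫ t, ‖F' t‖ ∂(timeMeasure T) ≤ timeConst T * K
  eLpNorm_le : eLpNorm F' q (timeMeasure T) ≤ ENNReal.ofReal K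

theorem IsW1.isRep (hq : q = 1 ∨ q = 2) (hT : 0 < T) (hK : 0 ≤ K) (h1 : IsW1 T q F F')
    (h2 : ∀ t ∈ Icc 0 T, i (F t) = f t) (hF : eLpNorm F q (timeMeasure T) ≤ ENNReal.ofReal K)
    (hF' : eLpNorm F' q (timeMeasure T) ≤ ENNReal.ofReal K) : IsRep T q i f K F F' :=
  ⟨h1, h2, fun _ ht => h1.norm_le_const hq hT hK hF hF' ht,
    (integral_norm_le_of_eLpNorm hq hT hK h1.1.1 hF').trans
      (mul_le_mul_of_nonneg_right (one_add_sqrt_le_timeConst hT) hK), hF'⟩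

theorem IsRep.ae_hasDerivAt [CompleteSpace H] [CompleteSpace X] (hq : 1 ≤ q) (hT : 0 < T)
    (h : IsRep T q i f K F F') : ∀ᵐ t ∂(timeMeasure T), HasDerivAt f (i (F' t)) t := by
  filter_upwards [(h.isW1.map hq hT.le i).ae_hasDerivAt hq hT.le,
    ae_timeMeasure_mem_Ioo] with t h1 h2
  refine h1.congr_of_eventuallyEq ?_
  filter_upwards [Ioo_mem_nhds h2.1 h2.2] with s hs
  rw [h.rep s (Ioo_subset_Icc_self hs)]

end AbstractRepresentatives

section Representatives

variable {n : ℕ} {Ω : Set (Vec n)} {X : Type*} [NormedAddCommGroup X] [NormedSpace ℝ X]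
  [CompleteSpace X] {T : ℝ} {m : ℕ} {f : ℝ → L2 Ω X}

theorem exists_rep_of_normW1qHm_lt {q a : ℝ≥0∞} (h : normW1qHm T q m f < a) :
    ∃ F F' : ℝ → Hm Ω m X, IsW1 T q F F' ∧ (∀ t ∈ Icc 0 T, hmFn (F t) = f t) ∧
      eLpNorm F q (timeMeasure T) + eLpNorm F' q (timeMeasure T) < a := by
  simp only [normW1qHm, iInf_lt_iff] at h
  obtain ⟨F, F', h1, h2, h3⟩ := h
  exact ⟨F, F', h1, h2, h3⟩

theorem exists_rep_of_normLqHm_lt {q a : ℝ≥0∞} (h : normLqHm T q m f < a) :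
    ∃ F : ℝ → Hm Ω m X, AEStronglyMeasurable F (timeMeasure T) ∧
      (∀ᵐ t ∂(timeMeasure T), hmFn (F t) = f t) ∧ eLpNorm F q (timeMeasure T) < a := by
  simp only [normLqHm, iInf_lt_iff] at h
  obtain ⟨F, h1, h2, h3⟩ := h
  exact ⟨F, h1, h2, h3⟩

theorem exists_isRep {q : ℝ≥0∞} (hq : q = 1 ∨ q = 2) (hT : 0 < T) {K : ℝ} (hK : 0 < K)
    (h : normW1qHm T q m f < ENNReal.ofReal K) :
    ∃ F F' : ℝ → Hm Ω m X, IsRep T q (hmFnL Ω m X) f K F F' := by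
  obtain ⟨F, F', h1, h2, h3⟩ := exists_rep_of_normW1qHm_lt h
  exact ⟨F, F', h1.isRep hq hT hK.le h2 (le_self_add.trans h3.le) (le_add_self.trans h3.le)⟩

theorem normW1qHm_one_le (hT : 0 < T) :
    normW1qHm T 1 m f ≤ ENNReal.ofReal (1 + √T) * normW1qHm T 2 m f := by
  have hs := Real.sqrt_nonneg T
  refine le_mul_of_forall_lt (by positivity) fun K hK h => ?_
  obtain ⟨F, F', h1, h2, h3⟩ := exists_rep_of_normW1qHm_lt h
  have hm := h1.aestronglyMeasurable one_le_two hT.le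
  have hF' : IsW1 T 1 F F' := ⟨h1.1.mono_exponent one_le_two, h1.2⟩
  refine (iInf₂_le_of_le F F' (iInf₂_le_of_le hF' h2 le_rfl)).trans ?_
  rw [ENNReal.ofReal_mul (by positivity)]
  refine (add_le_add (eLpNorm_one_le (Or.inr rfl) hT hm)
    (eLpNorm_one_le (Or.inr rfl) hT h1.1.1)).trans ?_
  rw [← mul_add]
  exact mul_le_mul_right h3.le _

/-- Functions in `W^{1,1}(J)` are bounded in time, and bounded functions on `J` are square
integrable with the factor √T. -/
theorem normLqHm_two_le (hT : 0 < T) :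
    normLqHm T 2 m f ≤ ENNReal.ofReal (√T * timeConst T) * normW1qHm T 1 m f := by
  have hc := timeConst_pos hT
  refine le_mul_of_forall_lt (by positivity) fun K hK h => ?_
  obtain ⟨F, F', h1⟩ := exists_isRep (Or.inl rfl) hT hK h
  have hm := h1.isW1.aestronglyMeasurable le_rfl hT.le
  refine (iInf₂_le_of_le F hm (iInf_le_of_le (ae_timeMeasure.2 (ae_of_all _ h1.rep)) le_rfl)).trans ?_
  refine (eLpNorm_le_of_ae_bound (C := timeConst T * K)
    (ae_timeMeasure.2 (ae_of_all _ h1.norm_le))).trans ?_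
  have e : (timeMeasure T) univ = ENNReal.ofReal T := by simp [timeMeasure]
  rw [e, ENNReal.ofReal_rpow_of_pos hT, ← ENNReal.ofReal_mul (by positivity)]
  refine ENNReal.ofReal_le_ofReal ?_
  rw [ENNReal.toReal_ofNat, Real.sqrt_eq_rpow, one_div]
  exact le_of_eq (by ring)

/-- M_m is at most a constant times N_m, so the first energy estimate is available wherever the
bound is stated with N_m. -/
theorem boundMax_le (hT : 0 < T) (s : Fields Ω) :
    boundMax T m s ≤ ENNReal.ofReal (1 + √T + √T * timeConst T) * boundSum T m s := by
  have hc := timeConst_pos hT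
  have hs := Real.sqrt_nonneg T
  have h1 : ENNReal.ofReal (1 + √T) ≤ ENNReal.ofReal (1 + √T + √T * timeConst T) :=
    ENNReal.ofReal_le_ofReal (by nlinarith)
  have h2 : ENNReal.ofReal (√T * timeConst T) ≤ ENNReal.ofReal (1 + √T + √T * timeConst T) :=
    ENNReal.ofReal_le_ofReal (by linarith)
  refine max_le ?_ ?_
  · refine (add_le_add (add_le_add (normW1qHm_one_le hT) (normW1qHm_one_le hT))
      (normW1qHm_one_le hT)).trans ?_
    rw [← mul_add, ← mul_add]
    exact mul_le_mul' h1 le_self_add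
  · exact (normLqHm_two_le hT).trans (mul_le_mul' h2 le_add_self)

end Representatives

/-! ### Error bounds for solutions in spaces with approximation properties -/

section SquareIntegrals

variable {T : ℝ}

theorem integral_sum_le {u v w : ℝ → ℝ} {a B : ℝ} (ha : 0 ≤ a)
    (hu : Integrable u (timeMeasure T)) (hv : Integrable v (timeMeasure T))
    (hw : Integrable w (timeMeasure T)) (hu' : ∫ t, u t ∂(timeMeasure T) ≤ B)
    (hv' : ∫ t, v t ∂(timeMeasure T) ≤ B) (hw' : ∫ t, w t ∂(timeMeasure T) ≤ B) :
    Integrable (fun t => a * (u t + v t + w t)) (timeMeasure T) ∧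
      ∫ t, a * (u t + v t + w t) ∂(timeMeasure T) ≤ 3 * a * B := by
  have h1 : Integrable (fun t => u t + v t) (timeMeasure T) := hu.add hv
  refine ⟨(h1.add hw).const_mul a, ?_⟩
  rw [integral_const_mul, integral_add h1 hw, integral_add hu hv]
  have h3 := add_le_add (add_le_add hu' hv') hw'
  exact (mul_le_mul_of_nonneg_left h3 ha).trans_eq (by ring)

theorem integral_sum_sq_le {u v w : ℝ → ℝ} {a B : ℝ}
    (hu : Integrable u (timeMeasure T)) (hv : Integrable v (timeMeasure T))
    (hw : Integrable w (timeMeasure T)) (hu2 : Integrable (fun t => u t ^ 2) (timeMeasure T))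
    (hv2 : Integrable (fun t => v t ^ 2) (timeMeasure T))
    (hw2 : Integrable (fun t => w t ^ 2) (timeMeasure T))
    (hu' : ∫ t, u t ^ 2 ∂(timeMeasure T) ≤ B ^ 2) (hv' : ∫ t, v t ^ 2 ∂(timeMeasure T) ≤ B ^ 2)
    (hw' : ∫ t, w t ^ 2 ∂(timeMeasure T) ≤ B ^ 2) :
    Integrable (fun t => (a * (u t + v t + w t)) ^ 2) (timeMeasure T) ∧
      ∫ t, (a * (u t + v t + w t)) ^ 2 ∂(timeMeasure T) ≤ (3 * a * B) ^ 2 := by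
  have h1 : Integrable (fun t => u t ^ 2 + v t ^ 2) (timeMeasure T) := hu2.add hv2
  have h2 : Integrable (fun t => 3 * a ^ 2 * (u t ^ 2 + v t ^ 2 + w t ^ 2)) (timeMeasure T) :=
    (h1.add hw2).const_mul _
  have h3 (t : ℝ) : (a * (u t + v t + w t)) ^ 2 ≤ 3 * a ^ 2 * (u t ^ 2 + v t ^ 2 + w t ^ 2) := by
    have : (u t + v t + w t) ^ 2 ≤ 3 * (u t ^ 2 + v t ^ 2 + w t ^ 2) := by
      nlinarith [sq_nonneg (u t - v t), sq_nonneg (u t - w t), sq_nonneg (v t - w t)]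
    rw [mul_pow]
    nlinarith [mul_le_mul_of_nonneg_left this (sq_nonneg a)]
  have h4 : Integrable (fun t => (a * (u t + v t + w t)) ^ 2) (timeMeasure T) := by
    refine h2.mono' ((((hu.add hv).add hw).const_mul a).1.pow 2) (ae_of_all _ fun t => ?_)
    rw [Real.norm_of_nonneg (sq_nonneg _)]
    exact h3 t
  refine ⟨h4, (integral_mono h4 h2 h3).trans ?_⟩
  rw [integral_const_mul, integral_add h1 hw2, integral_add hu2 hv2]
  have h5 := add_le_add (add_le_add hu' hv') hw'
  exact (mul_le_mul_of_nonneg_left h5 (by positivity)).trans_eq (by ring)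

theorem sq_integrable_const_mul {u : ℝ → ℝ} {a K B : ℝ} (ha : 0 ≤ a) (hK : 0 ≤ K)
    (hB : a * K ≤ B) (hu : Integrable (fun t => u t ^ 2) (timeMeasure T))
    (hu' : ∫ t, u t ^ 2 ∂(timeMeasure T) ≤ K ^ 2) :
    Integrable (fun t => (a * u t) ^ 2) (timeMeasure T) ∧
      ∫ t, (a * u t) ^ 2 ∂(timeMeasure T) ≤ B ^ 2 := by
  simp only [mul_pow]
  refine ⟨hu.const_mul _, ?_⟩
  rw [integral_const_mul]
  have : a ^ 2 * K ^ 2 ≤ B ^ 2 := by rw [← mul_pow]; gcongr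
  exact (mul_le_mul_of_nonneg_left hu' (sq_nonneg _)).trans this

end SquareIntegrals

section AbstractBounds

variable {E V F Q Sg Wd : Type*} [NormedAddCommGroup E] [InnerProductSpace ℝ E]
  [NormedAddCommGroup V] [InnerProductSpace ℝ V] [NormedAddCommGroup F] [InnerProductSpace ℝ F]
  [NormedAddCommGroup Q] [InnerProductSpace ℝ Q] [NormedAddCommGroup Sg] [NormedSpace ℝ Sg]
  [NormedAddCommGroup Wd] [NormedSpace ℝ Wd] {HE HF HQ : Type*} [NormedAddCommGroup HE]
  [NormedSpace ℝ HE] [NormedAddCommGroup HF] [NormedSpace ℝ HF] [NormedAddCommGroup HQ]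
  [NormedSpace ℝ HQ] {O : Operators E F Q} {M : Embeddings E V F Q Sg Wd} {c : ℝ}

/-- Functions in the smaller spaces `HE`, `HF`, `HQ` are approximated with errors of size `ε`. -/
structure Approximates (D : Discretization O M c) (iE : HE →L[ℝ] E) (iF : HF →L[ℝ] F)
    (iQ : HQ →L[ℝ] Q) (L : Sg →L[ℝ] Sg) (P : HF →L[ℝ] Wd) (ε a : ℝ) : Prop where
  one_le : 1 ≤ a
  ε_pos : 0 < ε
  interp : ∀ σ, L σ ∈ D.S ∧ D.DivMatch (L σ) σ ∧ ∀ η ∈ D.G, ⟪M.ι (L σ), η⟫_ℝ = ⟪M.ι σ, η⟫_ℝ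
  σ_le : ∀ σ w, iE w = M.ι σ → ‖M.ι (σ - L σ)‖ ≤ ε * (a * ‖w‖)
  p_le : ∀ w, ‖iQ w - D.Q.starProjection (iQ w)‖ ≤ ε * (a * ‖w‖)
  γ_le : ∀ w, iE w ∈ O.skew → ‖iE w - D.G.starProjection (iE w)‖ ≤ ε * (a * ‖w‖)
  z_mem : ∀ w, P w ∈ D.W
  z_match : ∀ w z, iF w = M.j z → ∀ q ∈ D.Q, ⟪M.d (P w), q⟫_ℝ = ⟪M.d z, q⟫_ℝ
  z_le : ∀ w, ‖iF w - M.j (P w)‖ ≤ ε * (a * ‖w‖)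

/-- The bound of the consistency errors. -/
def consistencyBound (a T K : ℝ) : ℝ := 3 * a * (timeConst T * K)

theorem le_consistencyBound {a T K x : ℝ} (ha : 0 ≤ a) (hT : 0 < T) (hK : 0 ≤ K)
    (hx : x ≤ timeConst T * K) : a * x ≤ consistencyBound a T K := by
  have h2 := timeConst_pos hT
  have h4 : 0 ≤ a * (timeConst T * K) := by positivity
  have h5 : a * x ≤ a * (timeConst T * K) := by gcongr
  unfold consistencyBound; linarith

variable {D : Discretization O M c} {T : ℝ} {iE : HE →L[ℝ] E} {iF : HF →L[ℝ] F} {iQ : HQ →L[ℝ] Q}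
  {L : Sg →L[ℝ] Sg} {P : HF →L[ℝ] Wd} {ε a K : ℝ} {σ σh : ℝ → Sg} {u uh : ℝ → V} {γ γh : ℝ → E}
  {z zh : ℝ → Wd} {p ph : ℝ → Q} {wσ wσ' wγ wγ' : ℝ → HE} {wp wp' : ℝ → HQ} {wz wz' : ℝ → HF}
  [CompleteSpace E] [CompleteSpace Q] [CompleteSpace HE] [CompleteSpace HQ]

/-- The approximation properties apply to time derivatives too: almost everywhere a representative
has a derivative in the smaller space, and by uniqueness of derivatives it represents the time
derivative of the solution. -/
theorem ErrorEqs.consistent (h : ErrorEqs D T σ σh u uh γ γh z zh p ph)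
    (H : Approximates D iE iF iQ L P ε a) (hT : 0 < T) {q : ℝ≥0∞} (hq : 1 ≤ q) (hK : 0 ≤ K)
    (hσ : IsRep T q iE (fun t => M.ι (σ t)) K wσ wσ') (hp : IsRep T q iQ p K wp wp')
    (hγ : IsRep T q iE γ K wγ wγ') (hσ0 : ‖M.ι (σ 0 - σh 0)‖ ≤ ε * (a * K))
    (hp0 : ‖p 0 - ph 0‖ ≤ ε * (a * K)) :
    Consistent D T L σ σh γ p ph ε (consistencyBound a T K) (fun t => iE (wγ' t))
      (fun t => a * (‖wσ' t‖ + ‖wp' t‖ + ‖wγ' t‖)) := by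
  have hε := H.ε_pos.le
  have ha : 0 ≤ a := zero_le_one.trans H.one_le
  have hc := timeConst_pos hT
  have hKK : K ≤ timeConst T * K := le_mul_of_one_le_left hK (one_le_timeConst hT)
  have hγd := hγ.ae_hasDerivAt hq hT
  -- The factor 3 in `consistencyBound` comes from summing the time derivatives of stress, pressure
  -- and rotation.
  have hrint := integral_sum_le ha (hσ.isW1.integrable hq).norm (hp.isW1.integrable hq).norm
    (hγ.isW1.integrable hq).norm hσ.integral_le hp.integral_le hγ.integral_le
  have hb {x : ℝ} (hx : x ≤ timeConst T * K) : ε * (a * x) ≤ ε * consistencyBound a T K :=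
    mul_le_mul_of_nonneg_left (le_consistencyBound ha hT hK hx) hε
  refine ⟨H.interp, hε, ?_, fun t ht => ?_, fun t ht => ?_, fun t ht => ?_, hγd, fun t => ?_,
    hrint.1, hrint.2, ?_, ?_, ?_, hσ0.trans (hb hKK), hp0.trans (hb hKK)⟩
  · unfold consistencyBound; positivity
  · exact (H.σ_le _ _ (hσ.rep t ht)).trans (hb (hσ.norm_le t ht))
  · rw [← hp.rep t ht]
    exact (H.p_le _).trans (hb (hp.norm_le t ht))
  · have := h.γ_skew t ht
    rw [← hγ.rep t ht] at this ⊢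
    exact (H.γ_le _ this).trans (hb (hγ.norm_le t ht))
  · positivity
  · filter_upwards [hσ.ae_hasDerivAt hq hT, ae_timeMeasure_mem_Ioo] with t h1 h2
    have h3 : M.ι (dt T σ t) = iE (wσ' t) :=
      (M.ι.hasFDerivAt.comp_hasDerivAt t (hasDerivAt_dt h.σ_reg h2)).unique h1
    refine (H.σ_le _ _ h3.symm).trans ?_
    gcongr
    linarith [norm_nonneg (wp' t), norm_nonneg (wγ' t)]
  · filter_upwards [hp.ae_hasDerivAt hq hT, ae_timeMeasure_mem_Ioo] with t h1 h2
    rw [(hasDerivAt_dt h.p_reg h2).unique h1]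
    refine (H.p_le _).trans ?_
    gcongr
    linarith [norm_nonneg (wσ' t), norm_nonneg (wγ' t)]
  · filter_upwards [hγd, ae_timeMeasure_mem_Ioo] with t ht ht'
    refine (H.γ_le _ (mem_of_hasDerivAt O.skew_closed ht' ht h.γ_skew)).trans ?_
    gcongr
    linarith [norm_nonneg (wσ' t), norm_nonneg (wp' t)]

/-- The constant in the bound of the rotation error. -/
def Operators.rotConst (O : Operators E F Q) (c : ℝ) : ℝ := c * (‖O.A‖ * O.effConst + 1) + 1

/-- The constant in the bound of the displacement error. -/
def Operators.dispConst (O : Operators E F Q) (c : ℝ) : ℝ :=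
  c * (‖O.A‖ * O.effConst + O.rotConst c)

/-- The constant in the bound of the pressure error. -/
def Operators.presConst (O : Operators E F Q) (c : ℝ) : ℝ := c * (‖O.K‖ * O.fluxConst) + 1

/-- The bounds for solutions with a flux that is merely square integrable in time. -/
theorem ErrorEqs.bounds (h : ErrorEqs D T σ σh u uh γ γh z zh p ph)
    (H : Approximates D iE iF iQ L P ε a) (hT : 0 < T) {q : ℝ≥0∞} (hq : 1 ≤ q) (hK : 0 ≤ K)
    (hσ : IsRep T q iE (fun t => M.ι (σ t)) K wσ wσ') (hp : IsRep T q iQ p K wp wp')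
    (hγ : IsRep T q iE γ K wγ wγ') (hσ0 : ‖M.ι (σ 0 - σh 0)‖ ≤ ε * (a * K))
    (hp0 : ‖p 0 - ph 0‖ ≤ ε * (a * K)) (hzm : AEStronglyMeasurable wz (timeMeasure T))
    (hz : ∀ᵐ t ∂(timeMeasure T), iF (wz t) = M.j (z t))
    (hzK : eLpNorm wz 2 (timeMeasure T) ≤ ENNReal.ofReal K) {t : ℝ} (ht : t ∈ Icc 0 T) :
    ‖O.eff (M.ι (σ t - σh t)) (p t - ph t)‖ ≤ O.effConst * (ε * consistencyBound a T K) ∧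
    ‖γ t - γh t‖ ≤ O.rotConst c * (ε * consistencyBound a T K) ∧
    ‖D.V.starProjection (u t) - uh t‖ ≤ O.dispConst c * (ε * consistencyBound a T K) := by
  have ha : 0 ≤ a := zero_le_one.trans H.one_le
  have hcons := h.consistent H hT hq hK hσ hp hγ hσ0 hp0
  have hKK : K ≤ timeConst T * K := le_mul_of_one_le_left hK (one_le_timeConst hT)
  obtain ⟨hk1, hk2⟩ := integral_sq_le_of_eLpNorm_two hK hzm hzK
  obtain ⟨hk1, hk2⟩ := sq_integrable_const_mul ha hK (le_consistencyBound ha hT hK hKK) hk1 hk2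
  -- The interpolant of the flux is chosen at each time separately; in this estimate it needs no
  -- regularity in time.
  have a1 := h.eff_error hcons hT hk1 (fun t => sq_nonneg _) hk2 (by
    filter_upwards [hz] with t ht
    refine ⟨P (wz t), H.z_mem _, H.z_match _ _ ht, ?_⟩
    rw [← mul_pow, map_sub, ← ht]
    exact pow_le_pow_left₀ (norm_nonneg _) (H.z_le _) 2) ht
  have a2 := h.rotation_error hcons ht a1
  exact ⟨a1, a2, h.displacement_error ht a1 a2⟩

/-- The bounds for solutions with square integrable time derivatives. -/
theorem ErrorEqs.flux_bounds [CompleteSpace F] [CompleteSpace HF]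
    (h : ErrorEqs D T σ σh u uh γ γh z zh p ph)
    (H : Approximates D iE iF iQ L P ε a) (hT : 0 < T) (hK : 0 ≤ K)
    (hσ : IsRep T 2 iE (fun t => M.ι (σ t)) K wσ wσ') (hp : IsRep T 2 iQ p K wp wp')
    (hγ : IsRep T 2 iE γ K wγ wγ') (hσ0 : ‖M.ι (σ 0 - σh 0)‖ ≤ ε * (a * K))
    (hp0 : ‖p 0 - ph 0‖ ≤ ε * (a * K)) (hz : IsRep T 1 iF (fun t => M.j (z t)) K wz wz')
    (hz0 : ‖M.j (z 0 - zh 0)‖ ≤ ε * (a * K)) {t : ℝ} (ht : t ∈ Icc 0 T)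
    (hC : ‖O.eff (M.ι (σ t - σh t)) (p t - ph t)‖
      ≤ O.effConst * (ε * consistencyBound a T K)) :
    ‖M.j (z t - zh t)‖ ≤ O.fluxConst * (ε * consistencyBound a T K) ∧
    ‖p t - ph t‖ ≤ O.presConst c * (ε * consistencyBound a T K) ∧
    ‖M.ι (σ t - σh t)‖
      ≤ (O.effConst + ‖O.P‖ * O.presConst c) * (ε * consistencyBound a T K) := by
  have ha : 0 ≤ a := zero_le_one.trans H.one_le
  have hε := H.ε_pos.le
  have hc := timeConst_pos hT
  have hcons := h.consistent H hT one_le_two hK hσ hp hγ hσ0 hp0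
  have hKK : K ≤ timeConst T * K := le_mul_of_one_le_left hK (one_le_timeConst hT)
  have hb {x : ℝ} (hx : x ≤ timeConst T * K) : ε * (a * x) ≤ ε * consistencyBound a T K :=
    mul_le_mul_of_nonneg_left (le_consistencyBound ha hT hK hx) hε
  obtain ⟨i1, j1⟩ := integral_sq_le_of_eLpNorm_two hK hσ.isW1.1.1 hσ.eLpNorm_le
  obtain ⟨i2, j2⟩ := integral_sq_le_of_eLpNorm_two hK hp.isW1.1.1 hp.eLpNorm_le
  obtain ⟨i3, j3⟩ := integral_sq_le_of_eLpNorm_two hK hγ.isW1.1.1 hγ.eLpNorm_le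
  obtain ⟨i4, j4⟩ := integral_sum_sq_le (a := a) (hσ.isW1.integrable one_le_two).norm
    (hp.isW1.integrable one_le_two).norm (hγ.isW1.integrable one_le_two).norm i1 i2 i3 j1 j2 j3
  -- The interpolated flux is the image of a function in `W^{1,1}(J; HF)` under a continuous linear
  -- map, so it is absolutely continuous and its derivative is the interpolant of `wz'`.
  have hzt := hz.isW1.map le_rfl hT.le (M.j ∘L P)
  have hzi := (hz.isW1.integrable le_rfl).norm.const_mul a
  have a1 : ‖M.j (z t - zh t)‖ ≤ O.fluxConst * (ε * consistencyBound a T K) := by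
    refine h.flux_error hcons hT i4 (j4.trans ?_) (hz.ae_hasDerivAt le_rfl hT)
      (hzt.ae_hasDerivAt le_rfl hT.le) (hzt.absolutelyContinuous le_rfl hT.le)
      (fun t ht => ⟨H.z_mem _, H.z_match _ _ (hz.rep t ht)⟩) hzi
      (fun t => mul_nonneg ha (norm_nonneg _)) ?_ (ae_of_all _ fun t => H.z_le (wz' t))
      (fun t ht => ?_) (hz0.trans (hb hKK)) ht
    · have h0 : 0 ≤ 3 * a * K := by positivity
      refine pow_le_pow_left₀ h0 ?_ 2
      exact mul_le_mul_of_nonneg_left hKK (by positivity)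
    · rw [integral_const_mul]
      exact le_consistencyBound ha hT hK hz.integral_le
    · rw [map_sub, ← hz.rep t ht]
      exact (H.z_le _).trans (hb (hz.norm_le t ht))
  have a2 := h.pressure_error hcons ht a1
  exact ⟨a1, a2, stress_error hC a2⟩

end AbstractBounds

/-! ### Error bounds for the Biot system -/

/-- The size of the approximation errors, relative to the norms of the solution. -/
def consistencyConst (c c₀ : ℝ) : ℝ := (1 + |c|) ^ 2 + |c₀|

theorem one_le_consistencyConst (c c₀ : ℝ) : 1 ≤ consistencyConst c c₀ := by
  have := abs_nonneg c
  have := abs_nonneg c₀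
  unfold consistencyConst; nlinarith

theorem abs_le_consistencyConst (c c₀ : ℝ) : |c| ≤ consistencyConst c c₀ := by
  have := abs_nonneg c
  have := abs_nonneg c₀
  unfold consistencyConst; nlinarith

theorem mul_abs_le_consistencyConst (c c₀ : ℝ) : (1 + |c|) * |c| ≤ consistencyConst c c₀ := by
  have := abs_nonneg c
  have := abs_nonneg c₀
  unfold consistencyConst; nlinarith

theorem abs_init_le_consistencyConst (c c₀ : ℝ) : |c₀| ≤ consistencyConst c c₀ := by
  have := abs_nonneg c
  unfold consistencyConst; nlinarith

section StableSpaces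

variable {n : ℕ} {Ω : Set (Vec n)} {D : Coeffs n} {T : ℝ} {Y : Spaces Ω} {h c : ℝ} {r r' m : ℕ}
  {O : Operators (L2 Ω (Mat n)) (L2 Ω (Vec n)) (L2 Ω ℝ)}

theorem Stable.norm_sub_Q_le (H : Stable Y h c r r') (hO : O.skew = skewFields Ω) (hh : 0 < h)
    (hm : 1 ≤ m) (hmr : m ≤ r) (F : Hm Ω m ℝ) :
    ‖hmFn F - (H.discretization hO).Q.starProjection (hmFn F)‖ ≤ h ^ m * (|c| * ‖F‖) := by
  have := H.finite_Q
  exact H.order_Q.norm_le hh hm hmr rfl Submodule.mem_top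

theorem Stable.norm_sub_V_le (H : Stable Y h c r r') (hO : O.skew = skewFields Ω) (hh : 0 < h)
    (hm : 1 ≤ m) (hmr : m ≤ r') (F : Hm Ω m (Vec n)) :
    ‖hmFn F - (H.discretization hO).V.starProjection (hmFn F)‖ ≤ h ^ m * (|c| * ‖F‖) := by
  have := H.finite_V
  exact H.order_V.norm_le hh hm hmr rfl Submodule.mem_top

theorem Stable.norm_sub_G_le (H : Stable Y h c r r') (hO : O.skew = skewFields Ω) (hh : 0 < h)
    (hm : 1 ≤ m) (hmr : m ≤ r) (F : Hm Ω m (Mat n)) (hF : hmFn F ∈ skewFields Ω) :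
    ‖hmFn F - (H.discretization hO).G.starProjection (hmFn F)‖ ≤ h ^ m * (|c| * ‖F‖) := by
  have := H.finite_G
  exact H.order_G.norm_le hh hm hmr rfl hF

theorem mul_pow_le {ε a b x : ℝ} (hε : 0 ≤ ε) (hab : a ≤ b) (hx : 0 ≤ x) :
    ε * (a * x) ≤ ε * (b * x) := by gcongr

/-- The Sobolev spaces are approximated by stable finite element spaces. -/
theorem Stable.exists_approximates (H : Stable Y h c r r') (hO : O.skew = skewFields Ω)
    (hh : 0 < h) (hm : 1 ≤ m) (hmr : m ≤ r) (c₀ : ℝ) :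
    ∃ L P, Approximates (H.discretization hO) (hmFnL Ω m (Mat n)) (hmFnL Ω m (Vec n))
      (hmFnL Ω m ℝ) L P (h ^ m) (consistencyConst c c₀) := by
  have h1 := (H.discretization hO).exists_interpolation
  have h2 := H.exists_flux_interp hh hm hmr
  refine h1.elim fun L hL => h2.elim fun P hP => ⟨L, P, ?_⟩
  have hε := (pow_pos hh m).le
  refine
    { one_le := one_le_consistencyConst c c₀
      ε_pos := pow_pos hh m
      interp := fun σ => ⟨(hL σ).1, (hL σ).2.1, (hL σ).2.2.1⟩
      σ_le := fun σ w hw => ?_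
      p_le := fun w => ?_
      γ_le := fun w hw => ?_
      z_mem := hP.1
      z_match := fun w z hz => hP.2.1 w z hz.symm
      z_le := fun w => ?_ }
  · exact (H.interp_le hO hh hm hmr (fun σ => (hL σ).2.2.2) hw).trans
      (mul_pow_le hε (mul_abs_le_consistencyConst c c₀) (norm_nonneg _))
  · exact (H.norm_sub_Q_le hO hh hm hmr w).trans
      (mul_pow_le hε (abs_le_consistencyConst c c₀) (norm_nonneg _))
  · exact (H.norm_sub_G_le hO hh hm hmr w (hO.le hw)).trans
      (mul_pow_le hε (abs_le_consistencyConst c c₀) (norm_nonneg _))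
  · exact (hP.2.2 w).trans (mul_pow_le hε (abs_le_consistencyConst c c₀) (norm_nonneg _))

end StableSpaces

section PointwiseBounds

variable {n : ℕ} {Ω : Set (Vec n)} {D : Coeffs n} {T : ℝ} {Y : Spaces Ω} {h c : ℝ} {r r' m : ℕ}
  {O : Operators (L2 Ω (Mat n)) (L2 Ω (Vec n)) (L2 Ω ℝ)}

theorem embeddings_ι_sub (σ τ : HdivMat Ω) :
    (embeddings Ω).ι (σ - τ) = mfn Ω σ - mfn Ω τ := (mfn Ω).map_sub σ τ

theorem embeddings_j_sub (z w : HdivVec Ω) :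
    (embeddings Ω).j (z - w) = vfn Ω z - vfn Ω w := (vfn Ω).map_sub z w

theorem norm_le_of_enorm_le_of_lt {Z : Type*} [NormedAddCommGroup Z] {x : Z} {B : ℝ≥0∞}
    {c c₀ K : ℝ} (hh : 0 < h) (hK : 0 ≤ K) (H : ‖x‖ₑ ≤ ENNReal.ofReal (c₀ * h ^ m) * B)
    (hB : B < ENNReal.ofReal K) : ‖x‖ ≤ h ^ m * (consistencyConst c c₀ * K) := by
  have h1 : ‖x‖ₑ ≤ ENNReal.ofReal (|c₀| * h ^ m) * ENNReal.ofReal K := by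
    refine H.trans (mul_le_mul' (ENNReal.ofReal_le_ofReal ?_) hB.le)
    exact mul_le_mul_of_nonneg_right (le_abs_self _) (pow_pos hh m).le
  rw [← ofReal_norm, ← ENNReal.ofReal_mul (by positivity)] at h1
  have h2 : 0 ≤ |c₀| * h ^ m * K := by positivity
  have h3 := (ENNReal.ofReal_le_ofReal_iff h2).1 h1
  have h4 := mul_pow_le (pow_pos hh m).le (abs_init_le_consistencyConst c c₀) hK
  linarith

theorem lt_of_boundMax_lt {s : Fields Ω} {a : ℝ≥0∞} (h : boundMax T m s < a) :
    normW1qHm T 1 m (fun t => mfn Ω (s.σ t)) < a ∧ normW1qHm T 1 m s.p < a ∧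
      normW1qHm T 1 m s.γ < a ∧ normLqHm T 2 m (fun t => vfn Ω (s.z t)) < a := by
  unfold boundMax at h
  have h1 := (le_max_left _ _).trans_lt h
  exact ⟨(le_self_add.trans le_self_add).trans_lt h1, (le_add_self.trans le_self_add).trans_lt h1,
    le_add_self.trans_lt h1, (le_max_right _ _).trans_lt h⟩

theorem lt_of_boundSum_lt {s : Fields Ω} {a : ℝ≥0∞} (h : boundSum T m s < a) :
    normW1qHm T 2 m (fun t => mfn Ω (s.σ t)) < a ∧ normW1qHm T 2 m s.p < a ∧
      normW1qHm T 2 m s.γ < a ∧ normW1qHm T 1 m (fun t => vfn Ω (s.z t)) < a := by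
  unfold boundSum at h
  have h1 := le_self_add.trans_lt h
  exact ⟨(le_self_add.trans le_self_add).trans_lt h1, (le_add_self.trans le_self_add).trans_lt h1,
    le_add_self.trans_lt h1, le_add_self.trans_lt h⟩

theorem Stable.error_bounds (H : Stable Y h c r r') (hO : O.skew = skewFields Ω)
    (hA : ∀ σ p τ q, formA D σ p τ q = ⟪O.A (O.eff σ p), O.eff τ q⟫_ℝ)
    (hK : ∀ z w, formκ D z w = ⟪O.K z, w⟫_ℝ) (hS : ∀ p q, formS D p q = ⟪O.S p, q⟫_ℝ)
    (hh : 0 < h) (hm : 1 ≤ m) (hmr : m ≤ r) (hT : 0 < T) {f : ℝ → L2 Ω (Vec n)} {g : ℝ → L2 Ω ℝ}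
    {s sh : Fields Ω} (hs : IsSolution D T (fullSpaces Ω) f g s) (hsh : IsSolution D T Y f g sh)
    {c₀ K : ℝ} (hI : InitialAccuracy T h c₀ m s sh) (hK0 : 0 < K)
    (hB : boundMax T m s < ENNReal.ofReal K) {t : ℝ} (ht : t ∈ Icc 0 T) :
    ‖O.eff ((embeddings Ω).ι (s.σ t - sh.σ t)) (s.p t - sh.p t)‖
      ≤ O.effConst * (h ^ m * consistencyBound (consistencyConst c c₀) T K) ∧
    ‖s.γ t - sh.γ t‖ ≤ O.rotConst |c| * (h ^ m * consistencyBound (consistencyConst c c₀) T K) ∧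
    ‖(H.discretization hO).V.starProjection (s.u t) - sh.u t‖
      ≤ O.dispConst |c| * (h ^ m * consistencyBound (consistencyConst c c₀) T K) := by
  have hσ0 := norm_le_of_enorm_le_of_lt (c := c) hh hK0.le (le_self_add.trans hI.1) hB
  have hp0 := norm_le_of_enorm_le_of_lt (c := c) hh hK0.le (le_add_self.trans hI.1) hB
  rw [← embeddings_ι_sub] at hσ0
  have hB' := lt_of_boundMax_lt hB
  refine (exists_isRep (Or.inl rfl) hT hK0 hB'.1).elim fun Fσ h1 => h1.elim fun Fσ' hσ => ?_
  refine (exists_isRep (Or.inl rfl) hT hK0 hB'.2.1).elim fun Fp h1 => h1.elim fun Fp' hp => ?_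
  refine (exists_isRep (Or.inl rfl) hT hK0 hB'.2.2.1).elim fun Fγ h1 => h1.elim fun Fγ' hγ => ?_
  refine (exists_rep_of_normLqHm_lt hB'.2.2.2).elim fun Fz hz => ?_
  refine (H.exists_approximates hO hh hm hmr c₀).elim fun L h1 => h1.elim fun P hP => ?_
  exact (errorEqs H hO hA hK hS hs hsh).bounds hP hT le_rfl hK0.le hσ hp hγ hσ0 hp0 hz.1 hz.2.1
    hz.2.2.le ht

theorem Stable.flux_error_bounds (H : Stable Y h c r r') (hO : O.skew = skewFields Ω)
    (hA : ∀ σ p τ q, formA D σ p τ q = ⟪O.A (O.eff σ p), O.eff τ q⟫_ℝ)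
    (hK : ∀ z w, formκ D z w = ⟪O.K z, w⟫_ℝ) (hS : ∀ p q, formS D p q = ⟪O.S p, q⟫_ℝ)
    (hh : 0 < h) (hm : 1 ≤ m) (hmr : m ≤ r) (hT : 0 < T) {f : ℝ → L2 Ω (Vec n)} {g : ℝ → L2 Ω ℝ}
    {s sh : Fields Ω} (hs : IsSolution D T (fullSpaces Ω) f g s) (hsh : IsSolution D T Y f g sh)
    {c₀ K : ℝ} (hI : InitialAccuracy T h c₀ m s sh) (hK0 : 0 < K)
    (hB : boundMax T m s < ENNReal.ofReal K) (hB2 : boundSum T m s < ENNReal.ofReal K)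
    {t : ℝ} (ht : t ∈ Icc 0 T) :
    ‖(embeddings Ω).j (s.z t - sh.z t)‖
      ≤ O.fluxConst * (h ^ m * consistencyBound (consistencyConst c c₀) T K) ∧
    ‖s.p t - sh.p t‖ ≤ O.presConst |c| * (h ^ m * consistencyBound (consistencyConst c c₀) T K) ∧
    ‖(embeddings Ω).ι (s.σ t - sh.σ t)‖ ≤ (O.effConst + ‖O.P‖ * O.presConst |c|) *
      (h ^ m * consistencyBound (consistencyConst c c₀) T K) := by
  have hC := (H.error_bounds hO hA hK hS hh hm hmr hT hs hsh hI hK0 hB ht).1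
  have hσ0 := norm_le_of_enorm_le_of_lt (c := c) hh hK0.le (le_self_add.trans hI.1) hB
  have hp0 := norm_le_of_enorm_le_of_lt (c := c) hh hK0.le (le_add_self.trans hI.1) hB
  have hz0 := norm_le_of_enorm_le_of_lt (c := c) hh hK0.le hI.2 hB2
  rw [← embeddings_ι_sub] at hσ0
  rw [← embeddings_j_sub] at hz0
  have hB' := lt_of_boundSum_lt hB2
  refine (exists_isRep (Or.inr rfl) hT hK0 hB'.1).elim fun Fσ h1 => h1.elim fun Fσ' hσ => ?_
  refine (exists_isRep (Or.inr rfl) hT hK0 hB'.2.1).elim fun Fp h1 => h1.elim fun Fp' hp => ?_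
  refine (exists_isRep (Or.inr rfl) hT hK0 hB'.2.2.1).elim fun Fγ h1 => h1.elim fun Fγ' hγ => ?_
  refine (exists_isRep (Or.inl rfl) hT hK0 hB'.2.2.2).elim fun Fz h1 => h1.elim fun Fz' hz => ?_
  refine (H.exists_approximates hO hh hm hmr c₀).elim fun L h1 => h1.elim fun P hP => ?_
  exact (errorEqs H hO hA hK hS hs hsh).flux_bounds hP hT hK0.le hσ hp hγ hσ0 hp0 hz hz0 ht hC

end PointwiseBounds

/-! ### Iterated partial derivatives -/

section PartialDerivatives

variable {n : ℕ} {Ω : Set (Vec n)}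

theorem contDiff_pd {φ : Vec n → ℝ} (i : Fin n) (h : ContDiff ℝ ∞ φ) : ContDiff ℝ ∞ (pd i φ) :=
  (h.fderiv_right (m := ∞) (by simp)).clm_apply contDiff_const

theorem pd_comm {φ : Vec n → ℝ} (h : ContDiff ℝ ∞ φ) (i j : Fin n) :
    pd i (pd j φ) = pd j (pd i φ) := by
  have hd : Differentiable ℝ (fderiv ℝ φ) :=
    (h.fderiv_right (m := ∞) (by simp)).differentiable (by simp)
  have h2 (a b : Fin n) (x : Vec n) : pd a (pd b φ) x =
      fderiv ℝ (fderiv ℝ φ) x (EuclideanSpace.single a 1) (EuclideanSpace.single b 1) := by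
    unfold pd
    rw [fderiv_clm_apply (hd x) (differentiableAt_const _)]
    simp
  ext x
  rw [h2, h2]
  exact (h.contDiffAt.isSymmSndFDerivAt (by
    rw [minSmoothness_of_isRCLikeNormedField]; exact WithTop.coe_le_coe.2 le_top)).eq _ _

/-- A partial derivative as a map of the smooth functions. -/
def pdSmooth (i : Fin n) (φ : {φ : Vec n → ℝ // ContDiff ℝ ∞ φ}) :
    {φ : Vec n → ℝ // ContDiff ℝ ∞ φ} := ⟨pd i φ.1, contDiff_pd i φ.2⟩

/-- On the type of smooth functions partial derivatives commute without side conditions, so the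
calculus of commuting self-maps applies to their iterates. -/
theorem pdSmooth_commute (i j : Fin n) : Function.Commute (pdSmooth i) (pdSmooth j) :=
  fun φ => Subtype.ext (pd_comm φ.2 i j)

/-- The derivatives with respect to the variables in a list. -/
def listPd (l : List (Fin n)) (a : Fin n → ℕ) (φ : {φ : Vec n → ℝ // ContDiff ℝ ∞ φ}) :
    {φ : Vec n → ℝ // ContDiff ℝ ∞ φ} := l.foldr (fun i ψ => (pdSmooth i)^[a i] ψ) φ

theorem coe_iterate_pdSmooth (i : Fin n) (k : ℕ) (φ : {φ : Vec n → ℝ // ContDiff ℝ ∞ φ}) :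
    ((pdSmooth i)^[k] φ).1 = (pd i)^[k] φ.1 := by
  induction k with
  | zero => rfl
  | succ k ih => rw [Function.iterate_succ_apply', Function.iterate_succ_apply', ← ih]; rfl

theorem coe_listPd (l : List (Fin n)) (a : Fin n → ℕ) (φ : {φ : Vec n → ℝ // ContDiff ℝ ∞ φ}) :
    (listPd l a φ).1 = l.foldr (fun i ψ => (pd i)^[a i] ψ) φ.1 := by
  induction l with
  | nil => rfl
  | cons i l ih =>
    rw [List.foldr_cons, ← ih, ← coe_iterate_pdSmooth]; rfl

theorem mpd_eq_listPd (a : Fin n → ℕ) {φ : Vec n → ℝ} (h : ContDiff ℝ ∞ φ) :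
    mpd a φ = (listPd (List.finRange n) a ⟨φ, h⟩).1 := (coe_listPd _ a ⟨φ, h⟩).symm

theorem listPd_pdSmooth (l : List (Fin n)) (a : Fin n → ℕ) (j : Fin n)
    (φ : {φ : Vec n → ℝ // ContDiff ℝ ∞ φ}) :
    listPd l a (pdSmooth j φ) = pdSmooth j (listPd l a φ) := by
  induction l with
  | nil => rfl
  | cons i l ih =>
    change (pdSmooth i)^[a i] (listPd l a (pdSmooth j φ)) = _
    rw [ih]
    exact (pdSmooth_commute i j).iterate_left (a i) _

/-- Since the list has no duplicates, the exponent of `j` is raised at most once, and the additional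
derivative can be moved to the front. -/
theorem listPd_add_single (l : List (Fin n)) (hl : l.Nodup) (a : Fin n → ℕ) (j : Fin n)
    (φ : {φ : Vec n → ℝ // ContDiff ℝ ∞ φ}) :
    listPd l (a + Pi.single j 1) φ = if j ∈ l then pdSmooth j (listPd l a φ) else listPd l a φ := by
  induction l with
  | nil => rfl
  | cons i l ih =>
    have ih := ih hl.of_cons
    change (pdSmooth i)^[(a + Pi.single j 1 : Fin n → ℕ) i] (listPd l (a + Pi.single j 1) φ) = _
    rw [ih]
    by_cases hij : j = i
    · subst hij
      rw [if_neg (List.nodup_cons.1 hl).1, if_pos List.mem_cons_self]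
      simp only [Pi.add_apply, Pi.single_eq_same, Function.iterate_succ_apply']
      rfl
    · simp only [Pi.add_apply, Pi.single_eq_of_ne (Ne.symm hij), add_zero, List.mem_cons, hij,
        false_or]
      split_ifs with h
      · exact (pdSmooth_commute i j).iterate_left (a i) _
      · rfl

theorem mpd_add_single (a : Fin n → ℕ) (j : Fin n) {φ : Vec n → ℝ} (h : ContDiff ℝ ∞ φ) :
    mpd (a + Pi.single j 1) φ = pd j (mpd a φ) := by
  rw [mpd_eq_listPd _ h, mpd_eq_listPd _ h,
    listPd_add_single _ (List.nodup_finRange n), if_pos (List.mem_finRange j)]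
  rfl

theorem mpd_pd (a : Fin n → ℕ) (j : Fin n) {φ : Vec n → ℝ} (h : ContDiff ℝ ∞ φ) :
    mpd a (pd j φ) = mpd (a + Pi.single j 1) φ := by
  rw [mpd_add_single a j h, mpd_eq_listPd _ (contDiff_pd j h), mpd_eq_listPd _ h]
  exact congrArg Subtype.val (listPd_pdSmooth _ a j ⟨φ, h⟩)

theorem mpd_zero (φ : Vec n → ℝ) : mpd 0 φ = φ := by
  unfold mpd
  induction List.finRange n with
  | nil => rfl
  | cons i l ih => rw [List.foldr_cons, ih]; rfl

theorem IsTest.pd {φ : Vec n → ℝ} (h : IsTest Ω φ) (i : Fin n) : IsTest Ω (pd i φ) :=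
  ⟨contDiff_pd i h.1, h.2.1.fderiv_apply ℝ _,
    ((tsupport_fderiv_apply_subset ℝ _).trans h.2.2)⟩

theorem IsTest.mpd {φ : Vec n → ℝ} (h : IsTest Ω φ) (a : Fin n → ℕ) : IsTest Ω (mpd a φ) := by
  unfold Biot.mpd
  induction List.finRange n with
  | nil => exact h
  | cons i l ih =>
    rw [List.foldr_cons]
    generalize a i = k
    induction k with
    | zero => exact ih
    | succ k ihk => rw [Function.iterate_succ_apply']; exact ihk.pd i

theorem IsTest.mul_smooth {φ b : Vec n → ℝ} (h : IsTest Ω φ) (hb : ContDiff ℝ ∞ b) :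
    IsTest Ω (fun x => φ x * b x) :=
  ⟨h.1.mul hb, h.2.1.mul_right, (tsupport_mul_subset_left (g := b)).trans h.2.2⟩

theorem pd_mul {φ b : Vec n → ℝ} (h : ContDiff ℝ ∞ φ) (hb : ContDiff ℝ ∞ b) (j : Fin n)
    (x : Vec n) : pd j (fun x => φ x * b x) x = pd j φ x * b x + φ x * pd j b x := by
  unfold pd
  rw [fderiv_fun_mul (h.differentiable (by simp) x) (hb.differentiable (by simp) x)]
  simp; ring

theorem contDiff_coord (j : Fin n) : ContDiff ℝ ∞ fun x : Vec n => x j :=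
  (EuclideanSpace.proj (𝕜 := ℝ) j).contDiff

theorem pd_coord (j : Fin n) (x : Vec n) : pd j (fun x : Vec n => x j) x = 1 := by
  have : fderiv ℝ (fun x : Vec n => x j) x = EuclideanSpace.proj (𝕜 := ℝ) j :=
    (EuclideanSpace.proj (𝕜 := ℝ) j).fderiv
  unfold pd
  rw [this]; simp

theorem IsTest.memLp {φ : Vec n → ℝ} (h : IsTest Ω φ) : MemLp φ 2 (volume.restrict Ω) :=
  memLp_reg Ω ⟨h.1, h.2.1⟩

end PartialDerivatives

/-! ### Weak derivatives of scalar functions -/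

section WeakDerivatives

variable {n : ℕ} {Ω : Set (Vec n)}

/-- `d` is the weak partial derivative `∂f/∂x_j` on `Ω`. -/
def HasWeakPd (Ω : Set (Vec n)) (j : Fin n) (f d : Vec n → ℝ) : Prop :=
  ∀ ψ : Vec n → ℝ, IsTest Ω ψ → ∫ x in Ω, ψ x * d x = -∫ x in Ω, pd j ψ x * f x

/-- All weak derivatives of `f` up to order `k` exist and satisfy `P`. -/
def WeakReg (Ω : Set (Vec n)) (P : (Vec n → ℝ) → Prop) : ℕ → (Vec n → ℝ) → Prop
  | 0, f => P f
  | k + 1, f => P f ∧ ∀ j, ∃ d, HasWeakPd Ω j f d ∧ WeakReg Ω P k d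

theorem WeakReg.prop {P : (Vec n → ℝ) → Prop} {k : ℕ} {f : Vec n → ℝ} (h : WeakReg Ω P k f) :
    P f := by
  cases k with
  | zero => exact h
  | succ k => exact h.1

theorem WeakReg.mono {P P' : (Vec n → ℝ) → Prop} (hP : ∀ f, P f → P' f) {k : ℕ}
    {f : Vec n → ℝ} (h : WeakReg Ω P k f) : WeakReg Ω P' k f := by
  induction k generalizing f with
  | zero => exact hP f h
  | succ k ih => exact ⟨hP f h.1, fun j => (h.2 j).imp fun d hd => ⟨hd.1, ih hd.2⟩⟩

theorem WeakReg.of_succ {P : (Vec n → ℝ) → Prop} {k : ℕ} {f : Vec n → ℝ}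
    (h : WeakReg Ω P (k + 1) f) : WeakReg Ω P k f := by
  induction k generalizing f with
  | zero => exact h.1
  | succ k ih => exact ⟨h.1, fun j => (h.2 j).imp fun d hd => ⟨hd.1, ih hd.2⟩⟩

theorem sum_add_single (a : Fin n → ℕ) (j : Fin n) :
    ∑ i, (a + Pi.single j 1 : Fin n → ℕ) i = (∑ i, a i) + 1 := by
  simp [Finset.sum_add_distrib]

/-- The test function `∂_j ψ` in the identity for `∂^a` and `ψ` in the one for `∂^{a+e_j}` produce
the same integral of `f`. -/
theorem hasWeakPd_of_isWeakDeriv {a : Fin n → ℕ} {j : Fin n} {f g g' : Vec n → ℝ}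
    (hg : IsWeakDeriv Ω a f g) (hg' : IsWeakDeriv Ω (a + Pi.single j 1) f g') :
    HasWeakPd Ω j g g' := by
  intro ψ hψ
  have h1 := hg (pd j ψ) (hψ.pd j)
  have h2 := hg' ψ hψ
  rw [mpd_pd a j hψ.1, h2, sum_add_single, pow_succ] at h1
  simp only [smul_eq_mul] at h1
  have h3 : ((-1 : ℝ) ^ ∑ i, a i) ≠ 0 := pow_ne_zero _ (by norm_num)
  have h4 : (-1 : ℝ) ^ (∑ i, a i) * (∫ x in Ω, pd j ψ x * g x + 0)
      = (-1 : ℝ) ^ (∑ i, a i) * -∫ x in Ω, ψ x * g' x := by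
    simp only [add_zero]; rw [← h1]; ring
  have h5 := mul_left_cancel₀ h3 h4
  simp only [add_zero] at h5
  linarith

/-- This passes from multi-indices to the recursive notion, which suits induction on the order. The
derivatives of `g a` are again members of the family. -/
theorem weakReg_of_family {P : (Vec n → ℝ) → Prop} {m : ℕ} (f : Vec n → ℝ)
    (g : (Fin n → ℕ) → Vec n → ℝ)
    (hg : ∀ a, ∑ i, a i ≤ m → P (g a) ∧ IsWeakDeriv Ω a f (g a)) {k : ℕ} {a : Fin n → ℕ}
    (ha : ∑ i, a i + k ≤ m) : WeakReg Ω P k (g a) := by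
  induction k generalizing a with
  | zero => exact (hg a ha).1
  | succ k ih =>
    have hs (j : Fin n) := sum_add_single a j
    refine ⟨(hg a (by omega)).1, fun j => ⟨g (a + Pi.single j 1), ?_, ih (by rw [hs j]; omega)⟩⟩
    exact hasWeakPd_of_isWeakDeriv (hg a (by omega)).2 (hg _ (by rw [hs j]; omega)).2

theorem isWeakDeriv_zero (f : Vec n → ℝ) : IsWeakDeriv Ω 0 f f := by
  intro φ _
  rw [mpd_zero]; simp

/-- The converse passage: one unit is removed from a nonzero entry of the multi-index, and the
induction hypothesis is applied to that first derivative. -/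
theorem WeakReg.exists_isWeakDeriv {P : (Vec n → ℝ) → Prop} {m : ℕ} {f : Vec n → ℝ}
    (h : WeakReg Ω P m f) (a : Fin n → ℕ) (ha : ∑ i, a i ≤ m) :
    ∃ g, P g ∧ IsWeakDeriv Ω a f g := by
  induction m generalizing f a with
  | zero =>
    have : a = 0 := by
      ext i
      have := Finset.single_le_sum (f := a) (fun i _ => Nat.zero_le _) (Finset.mem_univ i)
      simp only [Pi.zero_apply]
      omega
    subst this
    exact ⟨f, h, isWeakDeriv_zero f⟩
  | succ m ih =>
    by_cases h0 : a = 0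
    · subst h0
      exact ⟨f, h.1, isWeakDeriv_zero f⟩
    obtain ⟨j, hj⟩ := Function.ne_iff.1 h0
    have hb : a = (a - Pi.single j 1) + Pi.single j 1 := by
      ext i
      by_cases hij : i = j
      · subst hij
        simp only [Pi.zero_apply] at hj
        simp only [Pi.add_apply, Pi.sub_apply, Pi.single_eq_same]
        omega
      · simp [Pi.single_eq_of_ne hij]
    generalize a - Pi.single j 1 = b at hb
    subst hb
    rw [sum_add_single] at ha
    obtain ⟨d, hd, hr⟩ := h.2 j
    obtain ⟨g, hg, hw⟩ := ih hr b (by omega)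
    refine ⟨g, hg, fun φ hφ => ?_⟩
    have h1 := hw φ hφ
    have h2 := hd (Biot.mpd b φ) (hφ.mpd b)
    simp only [smul_eq_mul] at h1 ⊢
    rw [mpd_add_single b j hφ.1, sum_add_single, pow_succ]
    linarith

end WeakDerivatives

/-! ### The product rule for weak derivatives -/

section ProductRule

open scoped Convolution

variable {n : ℕ} {Ω : Set (Vec n)}

/-- The mollification of `f` with a bump function. -/
def mollify (φ : ContDiffBump (0 : Vec n)) (f : Vec n → ℝ) : Vec n → ℝ :=
  φ.normed volume ⋆[ContinuousLinearMap.lsmul ℝ ℝ, volume] f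

theorem contDiff_mollify (φ : ContDiffBump (0 : Vec n)) {f : Vec n → ℝ}
    (hf : LocallyIntegrable f volume) : ContDiff ℝ ∞ (mollify φ f) :=
  φ.hasCompactSupport_normed.contDiff_convolution_left (n := ⊤) _ φ.contDiff_normed hf

theorem abs_mollify_le (φ : ContDiffBump (0 : Vec n)) {f : Vec n → ℝ}
    (hf : LocallyIntegrable f volume) {B : ℝ} (hB : ∀ x, |f x| ≤ B) (x : Vec n) :
    |mollify φ f x| ≤ B := by
  have := dist_convolution_le (μ := volume) (x₀ := x) (z₀ := 0) ((abs_nonneg _).trans (hB x))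
    φ.support_normed_eq.subset φ.nonneg_normed φ.integral_normed hf.aestronglyMeasurable
    (fun y _ => by rw [dist_zero_right]; exact hB y)
  rwa [dist_zero_right] at this

theorem mollify_eq_integral (φ : ContDiffBump (0 : Vec n)) (f : Vec n → ℝ) (x : Vec n) :
    mollify φ f x = ∫ y, φ.normed volume (x - y) * f y := by
  unfold mollify
  rw [convolution_eq_swap]; rfl

theorem pd_mollify_eq_integral (φ : ContDiffBump (0 : Vec n)) {f : Vec n → ℝ}
    (hf : LocallyIntegrable f volume) (j : Fin n) (x : Vec n) :
    pd j (mollify φ f) x = ∫ y, pd j (φ.normed volume) (x - y) * f y := by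
  have h1 : HasFDerivAt (mollify φ f) _ x :=
    φ.hasCompactSupport_normed.hasFDerivAt_convolution_left (ContinuousLinearMap.lsmul ℝ ℝ)
      φ.contDiff_normed hf x
  have hc : ConvolutionExists (fderiv ℝ (φ.normed volume)) f
      ((ContinuousLinearMap.lsmul ℝ ℝ : ℝ →L[ℝ] ℝ →L[ℝ] ℝ).precompL (Vec n)) volume :=
    (φ.hasCompactSupport_normed.fderiv ℝ).convolutionExists_left _
      (φ.contDiff_normed.continuous_fderiv (n := 1) (by simp)) hf
  unfold pd
  rw [h1.fderiv, convolution_eq_swap, ContinuousLinearMap.integral_apply]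
  · rfl
  · exact (hc x).integrable_swap

theorem isTest_normed_sub (φ : ContDiffBump (0 : Vec n)) {x : Vec n}
    (hx : Metric.closedBall x φ.rOut ⊆ Ω) : IsTest Ω fun y => φ.normed volume (x - y) := by
  have hs : tsupport (fun y => φ.normed volume (x - y)) ⊆ Metric.closedBall x φ.rOut := by
    refine closure_minimal (fun y hy => ?_) Metric.isClosed_closedBall
    have : x - y ∈ Function.support (φ.normed volume) := hy
    rw [φ.support_normed_eq, mem_ball_zero_iff, ← dist_eq_norm] at this
    exact Metric.mem_closedBall'.2 this.le
  exact ⟨φ.contDiff_normed.comp (contDiff_const.sub contDiff_id),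
    HasCompactSupport.of_support_subset_isCompact (isCompact_closedBall x φ.rOut)
      (subset_closure.trans hs), hs.trans hx⟩

theorem pd_normed_sub (φ : ContDiffBump (0 : Vec n)) (j : Fin n) (x y : Vec n) :
    pd j (fun y => φ.normed volume (x - y)) y = -pd j (φ.normed volume) (x - y) := by
  have h1 : HasFDerivAt (φ.normed (volume : Measure (Vec n))) _ (x - y) :=
    (φ.contDiff_normed.differentiable (n := 1) (by simp) (x - y)).hasFDerivAt
  have h2 : HasFDerivAt (fun y : Vec n => x - y) (-ContinuousLinearMap.id ℝ (Vec n)) y :=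
    (hasFDerivAt_id y).const_sub x
  have h3 : HasFDerivAt (fun y => φ.normed volume (x - y)) _ y := h1.comp y h2
  unfold pd
  rw [h3.fderiv]
  simp

/-- As a function of `y`, the kernel at `x − y` is a test function on `Ω` when the ball around `x`
stays inside. The derivative falls on the kernel and is passed to `b` by the definition of the weak
derivative. -/
theorem pd_mollify (hΩ : MeasurableSet Ω) (φ : ContDiffBump (0 : Vec n)) {b b' : Vec n → ℝ}
    (hb : LocallyIntegrable (Ω.indicator b) volume) {j : Fin n} (h : HasWeakPd Ω j b b')
    {x : Vec n} (hx : Metric.closedBall x φ.rOut ⊆ Ω) :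
    pd j (mollify φ (Ω.indicator b)) x = mollify φ (Ω.indicator b') x := by
  have h1 := h _ (isTest_normed_sub φ hx)
  rw [← integral_indicator hΩ, ← integral_indicator hΩ] at h1
  rw [pd_mollify_eq_integral φ hb, mollify_eq_integral]
  have h2 (b : Vec n → ℝ) (y : Vec n) : φ.normed volume (x - y) * Ω.indicator b y =
      Ω.indicator (fun y => φ.normed volume (x - y) * b y) y := by
    rw [indicator_mul_right]
  have h3 (y : Vec n) : pd j (φ.normed volume) (x - y) * Ω.indicator b y =
      -Ω.indicator (fun y => pd j (fun y => φ.normed volume (x - y)) y * b y) y := by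
    rw [indicator_mul_right, pd_normed_sub]; ring
  simp_rw [h2, h3]
  rw [h1, integral_neg]

theorem HasWeakPd.congr {j : Fin n} {f f₁ d d₁ : Vec n → ℝ} (h : HasWeakPd Ω j f d)
    (hf : f =ᵐ[volume.restrict Ω] f₁) (hd : d =ᵐ[volume.restrict Ω] d₁) : HasWeakPd Ω j f₁ d₁ := by
  intro ψ hψ
  rw [← integral_congr_ae (hd.mono fun x hx => show ψ x * d x = ψ x * d₁ x by rw [hx]), h ψ hψ,
    integral_congr_ae (hf.mono fun x hx => show pd j ψ x * f x = pd j ψ x * f₁ x by rw [hx])]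

/-- `b` is bounded by `B` on `Ω`. -/
def BddOn (Ω : Set (Vec n)) (B : ℝ) (b : Vec n → ℝ) : Prop :=
  AEStronglyMeasurable b (volume.restrict Ω) ∧ ∀ᵐ x ∂volume.restrict Ω, |b x| ≤ B

/-- A version bounded at every point, so that its mollifications satisfy the same bound everywhere.
-/
theorem BddOn.exists_truncation {B : ℝ} (hB : 0 ≤ B) {b : Vec n → ℝ} (h : BddOn Ω B b) :
    ∃ b₁ : Vec n → ℝ, b =ᵐ[volume.restrict Ω] b₁ ∧ StronglyMeasurable b₁ ∧ ∀ x, |b₁ x| ≤ B := by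
  obtain ⟨b₀, hb₀, he⟩ := h.1
  refine ⟨fun x => max (-B) (min B (b₀ x)), ?_,
    stronglyMeasurable_const.sup (stronglyMeasurable_const.inf hb₀), fun x => abs_le.2
      ⟨le_max_left _ _, max_le (by linarith) (min_le_left _ _)⟩⟩
  filter_upwards [he, h.2] with x hx hb
  rw [hx] at hb ⊢
  rw [min_eq_right (abs_le.1 hb).2, max_eq_right (abs_le.1 hb).1]

theorem locallyIntegrable_indicator (hΩ : MeasurableSet Ω) {B : ℝ} {b : Vec n → ℝ}
    (h : StronglyMeasurable b) (hb : ∀ x, |b x| ≤ B) :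
    LocallyIntegrable (Ω.indicator b) volume := by
  refine (locallyIntegrable_const B).mono (h.indicator hΩ).aestronglyMeasurable
    (Eventually.of_forall fun x => ?_)
  refine (norm_indicator_le_norm_self b x).trans ((hb x).trans (le_abs_self B))

/-- Dominated convergence: the mollifications converge almost everywhere on `Ω` and are bounded by
`B`, while `h` is integrable. -/
theorem tendsto_integral_mollify (hΩ : MeasurableSet Ω) {φ : ℕ → ContDiffBump (0 : Vec n)}
    (hφ : Tendsto (fun k => (φ k).rOut) atTop (𝓝 0))
    (hφ' : ∀ᶠ k in atTop, (φ k).rOut ≤ 2 * (φ k).rIn) {B : ℝ} {b h : Vec n → ℝ}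
    (hb : StronglyMeasurable b) (hB : ∀ x, |b x| ≤ B) (hh : Integrable h (volume.restrict Ω)) :
    Tendsto (fun k => ∫ x in Ω, h x * mollify (φ k) (Ω.indicator b) x) atTop
      (𝓝 (∫ x in Ω, h x * b x)) := by
  have hl := locallyIntegrable_indicator hΩ hb hB
  have hB' (x : Vec n) : |Ω.indicator b x| ≤ B :=
    (norm_indicator_le_norm_self b x).trans (hB x)
  refine tendsto_integral_of_dominated_convergence (fun x => ‖h x‖ * B) (fun k => ?_)
    (hh.norm.mul_const B) (fun k => ?_) ?_
  · exact hh.1.mul (contDiff_mollify (φ k) hl).continuous.aestronglyMeasurable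
  · refine Eventually.of_forall fun x => ?_
    rw [norm_mul]
    exact mul_le_mul_of_nonneg_left (abs_mollify_le (φ k) hl hB' x) (norm_nonneg _)
  · have h1 := ContDiffBump.ae_convolution_tendsto_right_of_locallyIntegrable hφ hφ' hl
    filter_upwards [ae_restrict_of_ae h1, ae_restrict_mem hΩ] with x hx hxΩ
    rw [indicator_of_mem hxΩ] at hx
    exact hx.const_mul _

/-- With `b` mollified, its product with `ψ` is a test function for the weak derivative of `f`, and
the classical product rule applies to it. Since `f` and `f'` stay fixed, bounded almost everywhere
convergence of the mollified `b` and `b'` suffices in the limit. -/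
theorem HasWeakPd.mul (hΩ : IsOpen Ω) {j : Fin n} {b b' f f' : Vec n → ℝ} {B : ℝ} (hB : 0 ≤ B)
    (hb : BddOn Ω B b) (hb' : BddOn Ω B b') (hf : MemLp f 2 (volume.restrict Ω))
    (hf' : MemLp f' 2 (volume.restrict Ω)) (hbd : HasWeakPd Ω j b b') (hfd : HasWeakPd Ω j f f') :
    HasWeakPd Ω j (fun x => b x * f x) fun x => b' x * f x + b x * f' x := by
  obtain ⟨c, hc, hcm, hcB⟩ := hb.exists_truncation hB
  obtain ⟨c', hc', hcm', hcB'⟩ := hb'.exists_truncation hB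
  suffices h : HasWeakPd Ω j (fun x => c x * f x) fun x => c' x * f x + c x * f' x by
    refine h.congr ?_ ?_
    · filter_upwards [hc] with x hx; rw [hx]
    · filter_upwards [hc, hc'] with x hx hx'; rw [hx, hx']
  have hcd := hbd.congr hc hc'
  have hl := locallyIntegrable_indicator hΩ.measurableSet hcm hcB
  intro ψ hψ
  -- With radii at most `δ`, mollification commutes with differentiation on the support of `ψ`.
  -- Outside this support the derivative of the mollified function is multiplied by zero.
  obtain ⟨δ, hδ, hδΩ⟩ := IsCompact.exists_cthickening_subset_open hψ.2.1 hΩ hψ.2.2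
  let φ (k : ℕ) : ContDiffBump (0 : Vec n) :=
    ⟨δ / (k + 1) / 2, δ / (k + 1), by positivity, half_lt_self (by positivity)⟩
  have hφ : Tendsto (fun k => (φ k).rOut) atTop (𝓝 0) := by
    have := (tendsto_one_div_add_atTop_nhds_zero_nat (𝕜 := ℝ)).const_mul δ
    rw [mul_zero] at this
    exact this.congr fun k => by rw [mul_one_div]
  have hφ2 : ∀ᶠ k in atTop, (φ k).rOut ≤ 2 * (φ k).rIn :=
    Eventually.of_forall fun k => show δ / (k + 1) ≤ 2 * (δ / (k + 1) / 2) by linarith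
  have hφδ (k : ℕ) : (φ k).rOut ≤ δ :=
    div_le_self hδ.le (by have : (0 : ℝ) ≤ k := k.cast_nonneg; linarith)
  have i1 : Integrable (fun x => ψ x * f' x) (volume.restrict Ω) := hψ.memLp.integrable_mul hf'
  have i2 : Integrable (fun x => pd j ψ x * f x) (volume.restrict Ω) :=
    (hψ.pd j).memLp.integrable_mul hf
  have i3 : Integrable (fun x => ψ x * f x) (volume.restrict Ω) := hψ.memLp.integrable_mul hf
  have bd {h d : Vec n → ℝ} (hh : Integrable h (volume.restrict Ω)) (hd : StronglyMeasurable d)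
      (hdB : ∀ x, |d x| ≤ B) : Integrable (fun x => h x * d x) (volume.restrict Ω) :=
    hh.mul_bdd (c := B) hd.aestronglyMeasurable (Eventually.of_forall hdB)
  have hl' := locallyIntegrable_indicator hΩ.measurableSet hcm' hcB'
  have hM {d : Vec n → ℝ} (hdm : StronglyMeasurable d) (hdB : ∀ x, |d x| ≤ B) (k : ℕ) :
      StronglyMeasurable (mollify (φ k) (Ω.indicator d)) ∧
        ∀ x, |mollify (φ k) (Ω.indicator d) x| ≤ B :=
    have hld := locallyIntegrable_indicator hΩ.measurableSet hdm hdB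
    ⟨(contDiff_mollify (φ k) hld).continuous.stronglyMeasurable,
      abs_mollify_le _ hld fun x => (norm_indicator_le_norm_self d x).trans (hdB x)⟩
  have key (k : ℕ) : ∫ x in Ω, ψ x * f' x * mollify (φ k) (Ω.indicator c) x =
      -((∫ x in Ω, pd j ψ x * f x * mollify (φ k) (Ω.indicator c) x) +
        ∫ x in Ω, ψ x * f x * mollify (φ k) (Ω.indicator c') x) := by
    have h1 := hfd _ (hψ.mul_smooth (contDiff_mollify (φ k) hl))
    rw [← integral_add (bd i2 (hM hcm hcB k).1 (hM hcm hcB k).2)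
      (bd i3 (hM hcm' hcB' k).1 (hM hcm' hcB' k).2)]
    refine Eq.trans ?_ (h1.trans (congrArg Neg.neg ?_))
    · exact integral_congr_ae (Eventually.of_forall fun x => by ring)
    · refine integral_congr_ae (Eventually.of_forall fun x => ?_)
      simp only
      rw [pd_mul hψ.1 (contDiff_mollify (φ k) hl)]
      by_cases hx : x ∈ tsupport ψ
      · rw [pd_mollify hΩ.measurableSet (φ k) hl hcd]
        · ring
        · refine ((Metric.closedBall_subset_closedBall (hφδ k)).trans ?_).trans hδΩ
          exact Metric.closedBall_subset_cthickening hx δ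
      · rw [image_eq_zero_of_notMem_tsupport hx]
        ring
  have t1 := tendsto_integral_mollify hΩ.measurableSet hφ hφ2 hcm hcB i1
  have t2 := tendsto_integral_mollify hΩ.measurableSet hφ hφ2 hcm hcB i2
  have t3 := tendsto_integral_mollify hΩ.measurableSet hφ hφ2 hcm' hcB' i3
  have h4 := tendsto_nhds_unique (t1.congr key) (t2.add t3).neg
  have e1 : ∫ x in Ω, ψ x * (c' x * f x + c x * f' x) =
      (∫ x in Ω, ψ x * f x * c' x) + ∫ x in Ω, ψ x * f' x * c x := by
    rw [← integral_add (bd i3 hcm' hcB') (bd i1 hcm hcB)]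
    exact integral_congr_ae (Eventually.of_forall fun x => by ring)
  have e2 : ∫ x in Ω, pd j ψ x * (c x * f x) = ∫ x in Ω, pd j ψ x * f x * c x :=
    integral_congr_ae (Eventually.of_forall fun x => by ring)
  rw [e1, e2, h4]
  ring

end ProductRule

/-! ### Quantitative weak regularity -/

section QuantitativeRegularity

variable {n : ℕ} {Ω : Set (Vec n)} {k : ℕ} {K K' B c : ℝ} {f f' b : Vec n → ℝ}

/-- `‖f‖₀ ≤ K`. -/
def SqBdd (Ω : Set (Vec n)) (K : ℝ) (f : Vec n → ℝ) : Prop :=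
  MemLp f 2 (volume.restrict Ω) ∧ eLpNorm f 2 (volume.restrict Ω) ≤ ENNReal.ofReal K

theorem SqBdd.mono (h : SqBdd Ω K f) (hK : K ≤ K') : SqBdd Ω K' f :=
  ⟨h.1, h.2.trans (ENNReal.ofReal_le_ofReal hK)⟩

theorem SqBdd.congr (h : SqBdd Ω K f) (hf : f =ᵐ[volume.restrict Ω] f') : SqBdd Ω K f' :=
  ⟨(memLp_congr_ae hf).1 h.1, (eLpNorm_congr_ae hf).symm.trans_le h.2⟩

theorem SqBdd.add (hK : 0 ≤ K) (hK' : 0 ≤ K') (h : SqBdd Ω K f) (h' : SqBdd Ω K' f') :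
    SqBdd Ω (K + K') fun x => f x + f' x := by
  refine ⟨h.1.add h'.1, (eLpNorm_add_le h.1.1 h'.1.1 (by norm_num)).trans ?_⟩
  rw [ENNReal.ofReal_add hK hK']
  exact add_le_add h.2 h'.2

theorem BddOn.mul_sqBdd (hB : 0 ≤ B) (hb : BddOn Ω B b) (h : SqBdd Ω K f) :
    SqBdd Ω (B * K) fun x => b x * f x := by
  have h1 : ∀ᵐ x ∂volume.restrict Ω, ‖b x * f x‖ ≤ B * ‖f x‖ := by
    filter_upwards [hb.2] with x hx
    rw [norm_mul]
    exact mul_le_mul_of_nonneg_right hx (norm_nonneg _)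
  refine ⟨h.1.of_le_mul (hb.1.mul h.1.1) h1, (eLpNorm_le_mul_eLpNorm_of_ae_le_mul h1 2).trans ?_⟩
  rw [ENNReal.ofReal_mul hB]
  exact mul_le_mul_right h.2 _

theorem WeakReg.congr (h : WeakReg Ω (SqBdd Ω K) k f) (hf : f =ᵐ[volume.restrict Ω] f') :
    WeakReg Ω (SqBdd Ω K) k f' := by
  cases k with
  | zero => exact SqBdd.congr h hf
  | succ k => exact ⟨h.1.congr hf, fun j => (h.2 j).imp fun d hd =>
      ⟨hd.1.congr hf EventuallyEq.rfl, hd.2⟩⟩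

theorem WeakReg.mono_const (h : WeakReg Ω (SqBdd Ω K) k f) (hK : K ≤ K') :
    WeakReg Ω (SqBdd Ω K') k f := h.mono fun _ h => h.mono hK

theorem HasWeakPd.add {j : Fin n} {d d' : Vec n → ℝ} (h : HasWeakPd Ω j f d)
    (h' : HasWeakPd Ω j f' d') (hf : MemLp f 2 (volume.restrict Ω))
    (hf' : MemLp f' 2 (volume.restrict Ω)) (hd : MemLp d 2 (volume.restrict Ω))
    (hd' : MemLp d' 2 (volume.restrict Ω)) :
    HasWeakPd Ω j (fun x => f x + f' x) fun x => d x + d' x := by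
  intro ψ hψ
  have i (g : Vec n → ℝ) (hg : MemLp g 2 (volume.restrict Ω)) :
      Integrable (fun x => ψ x * g x) (volume.restrict Ω) := hψ.memLp.integrable_mul hg
  have i' (g : Vec n → ℝ) (hg : MemLp g 2 (volume.restrict Ω)) :
      Integrable (fun x => pd j ψ x * g x) (volume.restrict Ω) :=
    (hψ.pd j).memLp.integrable_mul hg
  simp only [mul_add]
  rw [integral_add (i d hd) (i d' hd'), integral_add (i' f hf) (i' f' hf'), h ψ hψ, h' ψ hψ]
  ring

theorem WeakReg.add (hK : 0 ≤ K) (hK' : 0 ≤ K') (h : WeakReg Ω (SqBdd Ω K) k f)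
    (h' : WeakReg Ω (SqBdd Ω K') k f') :
    WeakReg Ω (SqBdd Ω (K + K')) k fun x => f x + f' x := by
  induction k generalizing f f' with
  | zero => exact SqBdd.add hK hK' h h'
  | succ k ih =>
    refine ⟨SqBdd.add hK hK' h.1 h'.1, fun j => ?_⟩
    obtain ⟨d, hd, hr⟩ := h.2 j
    obtain ⟨d', hd', hr'⟩ := h'.2 j
    exact ⟨_, hd.add hd' h.1.1 h'.1.1 hr.prop.1 hr'.prop.1, ih hr hr'⟩

theorem WeakReg.zero : WeakReg Ω (SqBdd Ω K) k fun _ => 0 := by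
  have h0 : SqBdd Ω K fun _ : Vec n => 0 := ⟨MemLp.zero', by simp⟩
  induction k with
  | zero => exact h0
  | succ k ih => exact ⟨h0, fun j => ⟨_, fun ψ _ => by simp, ih⟩⟩

theorem WeakReg.sum {ι : Type*} (s : Finset ι) {K : ι → ℝ} {f : ι → Vec n → ℝ}
    (hK : ∀ i, 0 ≤ K i) (h : ∀ i, WeakReg Ω (SqBdd Ω (K i)) k (f i)) :
    WeakReg Ω (SqBdd Ω (∑ i ∈ s, K i)) k fun x => ∑ i ∈ s, f i x := by
  classical
  induction s using Finset.induction_on with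
  | empty => simpa using WeakReg.zero (Ω := Ω) (k := k) (K := 0)
  | insert i s hi ih =>
    simp only [Finset.sum_insert hi]
    exact WeakReg.add (hK i) (Finset.sum_nonneg fun i _ => hK i) (h i) ih

/-- Each differentiation turns one product into two, and every resulting product is bounded by `B
K`; hence the factor `2 ^ k`. -/
theorem WeakReg.mul (hΩ : IsOpen Ω) (hB : 0 ≤ B) (hK : 0 ≤ K) (hb : WeakReg Ω (BddOn Ω B) k b)
    (h : WeakReg Ω (SqBdd Ω K) k f) :
    WeakReg Ω (SqBdd Ω (2 ^ k * (B * K))) k fun x => b x * f x := by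
  have hBK : 0 ≤ B * K := mul_nonneg hB hK
  induction k generalizing b f with
  | zero =>
    rw [pow_zero, one_mul]
    exact BddOn.mul_sqBdd hB hb h
  | succ k ih =>
    refine ⟨(BddOn.mul_sqBdd hB hb.1 h.1).mono
      (le_mul_of_one_le_left hBK (one_le_pow₀ (by norm_num))), fun j => ?_⟩
    obtain ⟨b', hb', hrb⟩ := hb.2 j
    obtain ⟨d, hd, hr⟩ := h.2 j
    refine ⟨_, HasWeakPd.mul hΩ hB hb.1 hrb.prop h.1.1 hr.prop.1 hb' hd, ?_⟩
    refine (WeakReg.add (by positivity) (by positivity) (ih hrb h.of_succ)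
      (ih hb.of_succ hr)).mono_const (le_of_eq ?_)
    ring

theorem WeakReg.const_mul (c : ℝ) (h : WeakReg Ω (SqBdd Ω K) k f) :
    WeakReg Ω (SqBdd Ω (|c| * K)) k fun x => c * f x := by
  have hb : BddOn Ω |c| fun _ => c :=
    ⟨aestronglyMeasurable_const, Eventually.of_forall fun _ => le_rfl⟩
  induction k generalizing f with
  | zero => exact hb.mul_sqBdd (abs_nonneg c) h
  | succ k ih =>
    refine ⟨hb.mul_sqBdd (abs_nonneg c) h.1, fun j => ?_⟩
    obtain ⟨d, hd, hr⟩ := h.2 j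
    refine ⟨_, fun ψ hψ => ?_, ih hr⟩
    simp only [mul_left_comm _ c, integral_const_mul, hd ψ hψ, mul_neg]

end QuantitativeRegularity

/-! ### Sobolev functions are weakly regular -/

section Sobolev

variable {n : ℕ} {Ω : Set (Vec n)} {m : ℕ}

/-- A multi-index of order at most `m`. -/
def MIdx.ofFun (a : Fin n → ℕ) (ha : ∑ i, a i ≤ m) : MIdx n m :=
  ⟨fun i => ⟨a i, Nat.lt_succ_of_le
    ((Finset.single_le_sum (fun i _ => Nat.zero_le (a i)) (Finset.mem_univ i)).trans ha)⟩, ha⟩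

theorem MemWInfty.exists_weakReg {b : Vec n → ℝ} {B : ℝ} (hb : BddOn Ω B b)
    (h : MemWInfty Ω m b) : ∃ B', 0 ≤ B' ∧ WeakReg Ω (BddOn Ω B') m b := by
  classical
  choose g hg hw using fun a : MIdx n m => h (fun i => a.1 i) a.2
  have hfin (a : MIdx n m) : 0 ≤ (eLpNorm (g a) ∞ (volume.restrict Ω)).toReal :=
    ENNReal.toReal_nonneg
  have hle (a : MIdx n m) : (eLpNorm (g a) ∞ (volume.restrict Ω)).toReal ≤
      |B| + ∑ a : MIdx n m, (eLpNorm (g a) ∞ (volume.restrict Ω)).toReal :=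
    (Finset.single_le_sum (fun a _ => hfin a) (Finset.mem_univ a)).trans
      (le_add_of_nonneg_left (abs_nonneg B))
  refine ⟨|B| + ∑ a : MIdx n m, (eLpNorm (g a) ∞ (volume.restrict Ω)).toReal,
    add_nonneg (abs_nonneg B) (Finset.sum_nonneg fun a _ => hfin a), ?_⟩
  -- For `a = 0` the family is given `b` itself, because the weak derivative of order zero supplied
  -- by the hypothesis may be a different function. The common bound is a sum over the finitely many
  -- multi-indices.
  have := weakReg_of_family (Ω := Ω) (m := m)
    (P := BddOn Ω (|B| + ∑ a : MIdx n m, (eLpNorm (g a) ∞ (volume.restrict Ω)).toReal)) b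
    (fun a => if a = 0 then b else if ha : ∑ i, a i ≤ m then g (MIdx.ofFun a ha) else 0) ?_
    (k := m) (a := 0) (by simp)
  · simpa using this
  intro a ha
  by_cases h0 : a = 0
  · subst h0
    rw [if_pos rfl]
    refine ⟨⟨hb.1, hb.2.mono fun x hx => (hx.trans (le_abs_self B)).trans ?_⟩, isWeakDeriv_zero b⟩
    exact le_add_of_nonneg_right (Finset.sum_nonneg fun a _ => hfin a)
  · rw [if_neg h0, dif_pos ha]
    refine ⟨⟨(hg _).1, ?_⟩, hw (MIdx.ofFun a ha)⟩
    have h1 := ae_le_eLpNormEssSup (f := g (MIdx.ofFun a ha)) (μ := volume.restrict Ω)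
    filter_upwards [h1] with x hx
    refine le_trans ?_ (hle (MIdx.ofFun a ha))
    have h2 := (hg (MIdx.ofFun a ha)).2.ne
    rw [eLpNorm_exponent_top] at h2 ⊢
    rw [← Real.norm_eq_abs, ← toReal_enorm]
    exact ENNReal.toReal_mono h2 hx

theorem sqBdd_coeFn {X : Type*} [NormedAddCommGroup X] [NormedSpace ℝ X] (ℓ : X →L[ℝ] ℝ)
    (f : L2 Ω X) : SqBdd Ω (‖ℓ‖ * ‖f‖) fun x => ℓ (f x) := by
  have h1 : ∀ᵐ x ∂volume.restrict Ω, ‖ℓ (f x)‖ ≤ ‖ℓ‖ * ‖f x‖ :=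
    Eventually.of_forall fun x => ℓ.le_opNorm _
  refine ⟨ℓ.comp_memLp' (Lp.memLp f), (eLpNorm_le_mul_eLpNorm_of_ae_le_mul h1 2).trans ?_⟩
  rw [ENNReal.ofReal_mul (norm_nonneg _), ← Lp.enorm_def, ofReal_norm, ofReal_norm]

theorem integral_mul_clm {X : Type*} [NormedAddCommGroup X] [NormedSpace ℝ X] [CompleteSpace X]
    (ℓ : X →L[ℝ] ℝ) (f : L2 Ω X) {φ : Vec n → ℝ} (hφ : IsTest Ω φ) :
    ∫ x in Ω, φ x • ℓ (f x) = ℓ (∫ x in Ω, φ x • f x) := by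
  rw [← ContinuousLinearMap.integral_comp_comm]
  · simp only [map_smul]
  · exact memLp_one_iff_integrable.1 ((Lp.memLp f).smul hφ.memLp)

theorem IsWeakDeriv.clm {X : Type*} [NormedAddCommGroup X] [NormedSpace ℝ X] [CompleteSpace X]
    (ℓ : X →L[ℝ] ℝ) {f g : L2 Ω X} {a : Fin n → ℕ} (h : IsWeakDeriv Ω a f g) :
    IsWeakDeriv Ω a (fun x => ℓ (f x)) fun x => ℓ (g x) := by
  intro φ hφ
  rw [integral_mul_clm ℓ f (hφ.mpd a), integral_mul_clm ℓ g hφ, h φ hφ, map_smul]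

theorem weakReg_hmFn {X : Type*} [NormedAddCommGroup X] [NormedSpace ℝ X] [CompleteSpace X]
    (ℓ : X →L[ℝ] ℝ) (F : Hm Ω m X) :
    WeakReg Ω (SqBdd Ω (‖ℓ‖ * ‖F‖)) m fun x => ℓ (hmFn F x) := by
  have := weakReg_of_family (Ω := Ω) (m := m) (P := SqBdd Ω (‖ℓ‖ * ‖F‖)) (fun x => ℓ (hmFn F x))
    (fun a => if ha : ∑ i, a i ≤ m then fun x => ℓ (F.1 (MIdx.ofFun a ha) x) else 0) ?_
    (k := m) (a := 0) (by simp)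
  · rw [dif_pos (by simp)] at this
    exact this
  intro a ha
  rw [dif_pos ha]
  exact ⟨(sqBdd_coeFn ℓ _).mono (mul_le_mul_of_nonneg_left (PiLp.norm_apply_le F.1 _)
    (norm_nonneg _)), IsWeakDeriv.clm ℓ (F.2 (MIdx.ofFun a ha))⟩

theorem memLp_of_components {f : Vec n → Vec n}
    (h : ∀ i, MemLp (fun x => f x i) 2 (volume.restrict Ω)) :
    MemLp f 2 (volume.restrict Ω) := by
  have : f = fun x => ∑ i, f x i • EuclideanSpace.single i (1 : ℝ) := by
    ext x j; simp [Pi.single_apply]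
  rw [this]
  exact memLp_finsetSum _ fun i _ =>
    ((ContinuousLinearMap.toSpanSingleton ℝ (EuclideanSpace.single i (1 : ℝ))).comp_memLp' (h i))

theorem norm_le_of_components {K : ℝ} (hK : 0 ≤ K) (f : L2 Ω (Vec n))
    (h : ∀ i, SqBdd Ω K fun x => f x i) : ‖f‖ ≤ n * K := by
  have h1 : ∀ᵐ x ∂volume.restrict Ω, ‖f x‖ ≤ ∑ i, ‖f x i‖ := by
    refine Eventually.of_forall fun x => ?_
    have : f x = ∑ i, f x i • EuclideanSpace.single i (1 : ℝ) := by
      ext j; simp [Pi.single_apply]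
    conv_lhs => rw [this]
    refine (norm_sum_le _ _).trans (Finset.sum_le_sum fun i _ => ?_)
    rw [norm_smul]; simp
  rw [Lp.norm_def]
  refine ENNReal.toReal_le_of_le_ofReal (by positivity)
    ((eLpNorm_mono_ae_real h1).trans ?_)
  have h2 : (fun x => ∑ i, ‖f x i‖) = ∑ i, fun x => ‖f x i‖ := by ext x; simp
  rw [h2]
  refine (eLpNorm_sum_le (fun i _ => (h i).1.1.norm) (by norm_num)).trans ?_
  refine (Finset.sum_le_sum (g := fun _ => ENNReal.ofReal K) fun i _ => ?_).trans_eq ?_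
  · rw [eLpNorm_norm]; exact (h i).2
  · rw [Finset.sum_const, Finset.card_univ, Fintype.card_fin, nsmul_eq_mul,
      ENNReal.ofReal_mul (Nat.cast_nonneg n), ENNReal.ofReal_natCast]

theorem isWeakDeriv_of_components {a : Fin n → ℕ} {f g : L2 Ω (Vec n)}
    (h : ∀ i, IsWeakDeriv Ω a (fun x => f x i) fun x => g x i) : IsWeakDeriv Ω a f g := by
  intro φ hφ
  ext i
  have h1 := integral_mul_clm (EuclideanSpace.proj (𝕜 := ℝ) i) f (hφ.mpd a)
  have h2 := integral_mul_clm (EuclideanSpace.proj (𝕜 := ℝ) i) g hφ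
  exact h1.symm.trans ((h i φ hφ).trans (congrArg _ h2))

/-- A field with weakly regular components belongs to `H^m`. -/
theorem exists_hm_of_weakReg {K : ℝ} (hK : 0 ≤ K) (u : L2 Ω (Vec n))
    (h : ∀ i, WeakReg Ω (SqBdd Ω K) m fun x => u x i) :
    ∃ F : Hm Ω m (Vec n), hmFn F = u ∧ ‖F‖ ≤ Fintype.card (MIdx n m) * (n * K) := by
  -- The component of order zero has to be `u` itself, since `hmFn` reads off that component.
  have hex (a : MIdx n m) : ∃ f : L2 Ω (Vec n), (a = MIdx.zero n m → f = u) ∧ ‖f‖ ≤ n * K ∧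
      IsWeakDeriv Ω (fun i => (a.1 i : ℕ)) u f := by
    by_cases ha : a = MIdx.zero n m
    · subst ha
      refine ⟨u, fun _ => rfl, norm_le_of_components hK u fun i => (h i).prop, ?_⟩
      exact isWeakDeriv_of_components fun i => isWeakDeriv_zero fun x => u x i
    choose g hg hw using fun i : Fin n => (h i).exists_isWeakDeriv (fun i => a.1 i) a.2
    have hm : MemLp (fun x => WithLp.toLp 2 fun i => g i x) 2 (volume.restrict Ω) :=
      memLp_of_components fun i => (hg i).1
    have hc (i : Fin n) : g i =ᵐ[volume.restrict Ω] fun x => hm.toLp _ x i :=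
      hm.coeFn_toLp.mono fun x hx => congrArg (fun v : Vec n => v i) hx.symm
    refine ⟨hm.toLp _, fun h => (ha h).elim,
      norm_le_of_components hK _ fun i => (hg i).congr (hc i), isWeakDeriv_of_components fun i => ?_⟩
    intro φ hφ
    rw [hw i φ hφ]
    exact congrArg _ (integral_congr_ae ((hc i).mono fun x hx => by simp only [hx]))
  choose f hf hn hw using hex
  have hf0 : f (MIdx.zero n m) = u := hf _ rfl
  refine ⟨⟨WithLp.toLp 2 f, fun a => ?_⟩, hf0, ?_⟩
  · change IsWeakDeriv Ω _ (f (MIdx.zero n m)) (f a)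
    rw [hf0]
    exact hw a
  · change ‖WithLp.toLp 2 f‖ ≤ _
    rw [PiLp.norm_eq_of_L2]
    have h1 : ∑ a, ‖f a‖ ≤ Fintype.card (MIdx n m) * (n * K) :=
      (Finset.sum_le_sum fun a _ => hn a).trans_eq (by simp)
    refine le_trans (Real.sqrt_le_iff.2 ⟨Finset.sum_nonneg fun a _ => norm_nonneg _, ?_⟩) h1
    exact Finset.sum_sq_le_sq_sum_of_nonneg fun a _ => norm_nonneg _

end Sobolev

/-! ### The weak gradient of the displacement -/

section Gradient

variable {n : ℕ} {Ω : Set (Vec n)}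

theorem integral_pd_eq_zero {φ : Vec n → ℝ} (h : IsTest Ω φ) (j : Fin n) :
    ∫ x in Ω, pd j φ x = 0 := by
  have hs : ∀ x, x ∉ Ω → pd j φ x = 0 := fun x hx =>
    image_eq_zero_of_notMem_tsupport fun hx' => hx ((h.pd j).2.2 hx')
  rw [setIntegral_eq_integral_of_forall_compl_eq_zero hs]
  have hc : Continuous (pd j φ) := (contDiff_pd j h.1).continuous
  have hi : Integrable (pd j φ) volume := hc.integrable_of_hasCompactSupport (h.pd j).2.1
  have hi' : Integrable φ volume := h.1.continuous.integrable_of_hasCompactSupport h.2.1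
  have := integral_mul_fderiv_eq_neg_fderiv_mul_of_integrable (μ := (volume : Measure (Vec n)))
    (f := fun _ => (1 : ℝ)) (g := φ) (v := EuclideanSpace.single j 1) (by simp)
    (by simp only [one_mul]; exact hi) (by simp only [one_mul]; exact hi')
    (fun x _ => differentiableAt_const _) fun x _ => h.1.differentiable (by simp) x
  simp only [one_mul, fderiv_fun_const, Pi.zero_apply, zero_apply, zero_mul, integral_zero,
    neg_zero] at this
  exact this

theorem hasWeakPd_of_isTest {φ : Vec n → ℝ} (h : IsTest Ω φ) (j : Fin n) :
    HasWeakPd Ω j φ (pd j φ) := by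
  intro ψ hψ
  have h1 := integral_pd_eq_zero (hψ.mul_smooth h.1) j
  have i1 : Integrable (fun x => pd j ψ x * φ x) (volume.restrict Ω) :=
    (hψ.pd j).memLp.integrable_mul h.memLp
  have i2 : Integrable (fun x => ψ x * pd j φ x) (volume.restrict Ω) :=
    hψ.memLp.integrable_mul (h.pd j).memLp
  simp only [pd_mul hψ.1 h.1] at h1
  rw [integral_add i1 i2] at h1
  linarith

/-- The coordinate is smooth and can be moved to the test function, so no mollification is needed.
-/
theorem HasWeakPd.coord_mul {j : Fin n} {f d : Vec n → ℝ} (h : HasWeakPd Ω j f d)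
    (hf : MemLp f 2 (volume.restrict Ω)) (hd : MemLp (fun x => x j * d x) 2 (volume.restrict Ω))
    (hf' : MemLp (fun x => x j * f x) 2 (volume.restrict Ω)) :
    HasWeakPd Ω j (fun x => x j * f x) fun x => f x + x j * d x := by
  intro ψ hψ
  have h1 := h _ (hψ.mul_smooth (contDiff_coord j))
  simp only [pd_mul hψ.1 (contDiff_coord j), pd_coord, mul_one] at h1
  simp only [mul_add, ← mul_assoc, add_mul] at h1 ⊢
  have i1 : Integrable (fun x => ψ x * f x) (volume.restrict Ω) := hψ.memLp.integrable_mul hf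
  have i2 : Integrable (fun x => pd j ψ x * x j * f x) (volume.restrict Ω) :=
    ((hψ.pd j).memLp.integrable_mul hf').congr (Eventually.of_forall fun x => by simp [mul_assoc])
  have i3 : Integrable (fun x => ψ x * x j * d x) (volume.restrict Ω) :=
    (hψ.memLp.integrable_mul hd).congr (Eventually.of_forall fun x => by simp [mul_assoc])
  rw [integral_add i2 i1] at h1
  rw [integral_add i1 i3, h1]
  ring

/-- The matrix field with the single entry `f` in position `(i, j)`. -/
theorem exists_hdivMat {j : Fin n} {f d : Vec n → ℝ} (h : HasWeakPd Ω j f d)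
    (hf : MemLp f 2 (volume.restrict Ω)) (hd : MemLp d 2 (volume.restrict Ω)) (i : Fin n) :
    ∃ τ : HdivMat Ω,
      (mfn Ω τ =ᵐ[volume.restrict Ω] fun x => f x • EuclideanSpace.single (i, j) (1 : ℝ)) ∧
      mdiv Ω τ =ᵐ[volume.restrict Ω] fun x => d x • EuclideanSpace.single i (1 : ℝ) := by
  have h1 : MemLp (fun x => f x • (EuclideanSpace.single (i, j) (1 : ℝ) : Mat n)) 2
      (volume.restrict Ω) :=
    ((ContinuousLinearMap.toSpanSingleton ℝ (EuclideanSpace.single (i, j) (1 : ℝ))).comp_memLp' hf)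
  have h2 : MemLp (fun x => d x • (EuclideanSpace.single i (1 : ℝ) : Vec n)) 2
      (volume.restrict Ω) :=
    ((ContinuousLinearMap.toSpanSingleton ℝ (EuclideanSpace.single i (1 : ℝ))).comp_memLp' hd)
  refine ⟨⟨WithLp.toLp 2 (h1.toLp _, h2.toLp _), fun φ hφ k => ?_⟩, h1.coeFn_toLp, h2.coeFn_toLp⟩
  have e1 (l : Fin n) : (∫ x in Ω, pd l φ x • h1.toLp _ x) =
      (∫ x in Ω, pd l φ x * f x) • (EuclideanSpace.single (i, j) (1 : ℝ) : Mat n) := by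
    rw [← integral_smul_const]
    refine integral_congr_ae (h1.coeFn_toLp.mono fun x hx => ?_)
    simp only
    rw [hx, smul_smul]
  have e2 : (∫ x in Ω, φ x • h2.toLp _ x) =
      (∫ x in Ω, φ x * d x) • (EuclideanSpace.single i (1 : ℝ) : Vec n) := by
    rw [← integral_smul_const]
    refine integral_congr_ae (h2.coeFn_toLp.mono fun x hx => ?_)
    simp only
    rw [hx, smul_smul]
  change (∫ x in Ω, φ x • h2.toLp _ x) k = -∑ l, (∫ x in Ω, pd l φ x • h1.toLp _ x) (k, l)
  simp only [e1, e2, h φ hφ]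
  by_cases hk : k = i
  · subst hk
    simp
  · simp [hk]

variable {G : L2 Ω (Mat n)} {u : L2 Ω (Vec n)}

/-- The identity is tested with the matrix field whose only entry is `f` in position `(i, j)`. No
boundary values are imposed on `f`, so the relation also expresses that `u` vanishes on the boundary
in the weak sense. -/
theorem integral_gradient (h : ∀ τ : HdivMat Ω, ⟪G, mfn Ω τ⟫_ℝ + ⟪u, mdiv Ω τ⟫_ℝ = 0)
    {j : Fin n} {f d : Vec n → ℝ} (hd : HasWeakPd Ω j f d) (hf2 : MemLp f 2 (volume.restrict Ω))
    (hd2 : MemLp d 2 (volume.restrict Ω)) (i : Fin n) :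
    (∫ x in Ω, f x * G x (i, j)) + ∫ x in Ω, d x * u x i = 0 := by
  obtain ⟨τ, h1, h2⟩ := exists_hdivMat hd hf2 hd2 i
  have h3 := h τ
  rw [L2.inner_def, L2.inner_def] at h3
  rw [← h3]
  congr 1
  · refine integral_congr_ae (h1.mono fun x hx => ?_)
    simp only
    rw [hx, inner_smul_right, EuclideanSpace.inner_single_right]
    simp
  · refine integral_congr_ae (h2.mono fun x hx => ?_)
    simp only
    rw [hx, inner_smul_right, EuclideanSpace.inner_single_right]
    simp

theorem hasWeakPd_displacement (h : ∀ τ : HdivMat Ω, ⟪G, mfn Ω τ⟫_ℝ + ⟪u, mdiv Ω τ⟫_ℝ = 0)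
    (i j : Fin n) : HasWeakPd Ω j (fun x => u x i) fun x => G x (i, j) := by
  intro ψ hψ
  have := integral_gradient h (hasWeakPd_of_isTest hψ j)
    hψ.memLp (hψ.pd j).memLp i
  linarith

/-- The Poincaré inequality for the displacement. -/
theorem sqBdd_displacement (h : ∀ τ : HdivMat Ω, ⟪G, mfn Ω τ⟫_ℝ + ⟪u, mdiv Ω τ⟫_ℝ = 0)
    {R : ℝ} (hR : 0 ≤ R) (hΩ : IsOpen Ω) (hΩR : ∀ x ∈ Ω, ‖x‖ ≤ R) (i j : Fin n) {K : ℝ}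
    (hK : 0 ≤ K) (hG : SqBdd Ω K fun x => G x (i, j)) : SqBdd Ω (2 * (R * K)) fun x => u x i := by
  have hb : BddOn Ω R fun x : Vec n => x j :=
    ⟨(contDiff_coord j).continuous.aestronglyMeasurable,
      (ae_restrict_mem hΩ.measurableSet).mono fun x hx =>
        (PiLp.norm_apply_le x j).trans (hΩR x hx)⟩
  have hu : MemLp (fun x => u x i) 2 (volume.restrict Ω) :=
    (EuclideanSpace.proj (𝕜 := ℝ) i).comp_memLp' (Lp.memLp u)
  have hu0 : SqBdd Ω (eLpNorm (fun x => u x i) 2 (volume.restrict Ω)).toReal fun x => u x i :=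
    ⟨hu, by rw [ENNReal.ofReal_toReal hu.2.ne]⟩
  have hxG := hb.mul_sqBdd hR hG
  have hxu := hb.mul_sqBdd hR hu0
  have hw := (hasWeakPd_displacement h i j).coord_mul hu hxG.1 hxu.1
  -- The choice `f = x_j u_i`, with derivative `u_i + x_j G_ij`, gives `‖u_i‖² = −2 ∫ u_i x_j G_ij`,
  -- and `|x_j| ≤ R` on `Ω`.
  have h1 := integral_gradient h hw hxu.1 (hu.add hxG.1) i
  have hU : hu.toLp _ =ᵐ[volume.restrict Ω] fun x => u x i := hu.coeFn_toLp
  have hV : hxG.1.toLp _ =ᵐ[volume.restrict Ω] fun x => x j * G x (i, j) := hxG.1.coeFn_toLp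
  have e1 : ⟪hu.toLp _, hu.toLp _⟫_ℝ = ∫ x in Ω, u x i * u x i := by
    rw [L2.inner_def]
    exact integral_congr_ae (hU.mono fun x hx => by simp only; rw [hx]; rfl)
  have e2 : ⟪hu.toLp _, hxG.1.toLp _⟫_ℝ = ∫ x in Ω, u x i * (x j * G x (i, j)) := by
    rw [L2.inner_def]
    refine integral_congr_ae ((hU.and hV).mono fun x hx => ?_)
    simp only
    rw [hx.1, hx.2]; exact mul_comm _ _
  have i1 : Integrable (fun x => u x i * u x i) (volume.restrict Ω) := hu.integrable_mul hu
  have i2 : Integrable (fun x => u x i * (x j * G x (i, j))) (volume.restrict Ω) :=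
    hu.integrable_mul hxG.1
  have e3 : ∫ x in Ω, (u x i + x j * G x (i, j)) * u x i =
      (∫ x in Ω, u x i * u x i) + ∫ x in Ω, u x i * (x j * G x (i, j)) := by
    rw [← integral_add i1 i2]
    exact integral_congr_ae (Eventually.of_forall fun x => by ring)
  have e4 : ∫ x in Ω, x j * u x i * G x (i, j) = ∫ x in Ω, u x i * (x j * G x (i, j)) :=
    integral_congr_ae (Eventually.of_forall fun x => by ring)
  rw [e3, e4, ← e1, ← e2, real_inner_self_eq_norm_sq] at h1
  have h2 := (abs_le.1 (abs_real_inner_le_norm (hu.toLp _) (hxG.1.toLp _))).1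
  have h3 : ‖hxG.1.toLp _‖ ≤ R * K := by
    rw [Lp.norm_toLp]
    exact ENNReal.toReal_le_of_le_ofReal (by positivity) hxG.2
  have h4 : ‖hu.toLp _‖ ≤ 2 * (R * K) := by
    by_contra! h4
    have h5 : 0 < ‖hu.toLp _‖ := lt_of_le_of_lt (by positivity) h4
    nlinarith
  refine ⟨hu, ?_⟩
  rw [Lp.norm_toLp] at h4
  exact ENNReal.le_ofReal_iff_toReal_le hu.2.ne (by positivity) |>.2 h4

/-- The first derivatives of `u` are the entries of `G`, and `u` itself is controlled by the
Poincaré inequality in any one coordinate direction, which exists because `n ≠ 0`. The factor `2R +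
1` covers both contributions. -/
theorem exists_hm_displacement (h : ∀ τ : HdivMat Ω, ⟪G, mfn Ω τ⟫_ℝ + ⟪u, mdiv Ω τ⟫_ℝ = 0)
    {R : ℝ} (hR : 0 ≤ R) (hΩ : IsOpen Ω) (hΩR : ∀ x ∈ Ω, ‖x‖ ≤ R) (hn : n ≠ 0) {K : ℝ} (hK : 0 ≤ K)
    {k : ℕ} (hG : ∀ i j, WeakReg Ω (SqBdd Ω K) k fun x => G x (i, j)) :
    ∃ F : Hm Ω (k + 1) (Vec n), hmFn F = u ∧
      ‖F‖ ≤ Fintype.card (MIdx n (k + 1)) * (n * ((2 * R + 1) * K)) := by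
  refine exists_hm_of_weakReg (by positivity) u fun i => ⟨?_, fun j => ⟨_,
    hasWeakPd_displacement h i j, (hG i j).mono_const ?_⟩⟩
  · exact (sqBdd_displacement h hR hΩ hΩR i ⟨0, Nat.pos_of_ne_zero hn⟩ hK (hG _ _).prop).mono
      (by nlinarith)
  · nlinarith [mul_nonneg hR hK]

end Gradient

/-! ### Regularity of the displacement -/

section Displacement

variable {n : ℕ} {Ω : Set (Vec n)} {D : Coeffs n} {k : ℕ}

theorem Coeffs.Admissible.bddOn_A (hΩ : IsOpen Ω) (hD : D.Admissible Ω) :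
    ∃ b, ∀ e e' : Fin n × Fin n, BddOn Ω b fun x => D.A x (EuclideanSpace.single e 1) e' := by
  obtain ⟨a, -, b, hb⟩ := hD.A_bounds
  refine ⟨b, fun e e' => ⟨?_, (ae_mem_of_isOpen hΩ).mono fun x hx => ?_⟩⟩
  · exact (EuclideanSpace.proj (𝕜 := ℝ) e').continuous.comp_aestronglyMeasurable
      (hD.meas_A _).aestronglyMeasurable
  · refine (PiLp.norm_apply_le (D.A x (EuclideanSpace.single e 1)) e').trans ?_
    refine ((D.A x).le_opNorm _).trans ?_
    rw [PiLp.norm_single, norm_one, mul_one]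
    exact (hb x hx).2.2

theorem Coeffs.Admissible.bddOn_α (hΩ : IsOpen Ω) (hD : D.Admissible Ω) : ∃ b, BddOn Ω b D.α := by
  obtain ⟨b, hb⟩ := hD.α_bounds
  refine ⟨b, hD.meas_α.aestronglyMeasurable, (ae_mem_of_isOpen hΩ).mono fun x hx => ?_⟩
  rw [abs_of_pos (hb x hx).1]
  exact (hb x hx).2

theorem Coeffs.RegularUpTo.exists_weakReg (hΩ : IsOpen Ω) (hD : D.Admissible Ω)
    (h : D.RegularUpTo Ω k) : ∃ B, 0 ≤ B ∧ WeakReg Ω (BddOn Ω B) k D.α ∧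
      ∀ e e', WeakReg Ω (BddOn Ω B) k fun x => D.A x (EuclideanSpace.single e 1) e' := by
  obtain ⟨bA, hA⟩ := hD.bddOn_A hΩ
  obtain ⟨bα, hα⟩ := hD.bddOn_α hΩ
  choose B hB0 hB using fun e e' => (h.1 e e').exists_weakReg (hA e e')
  obtain ⟨B', hB0', hB'⟩ := h.2.exists_weakReg hα
  have hs : 0 ≤ ∑ e, ∑ e', B e e' :=
    Finset.sum_nonneg fun e _ => Finset.sum_nonneg fun e' _ => hB0 e e'
  have hm {b b' : ℝ} (hb : b ≤ b') (f : Vec n → ℝ) (hf : BddOn Ω b f) : BddOn Ω b' f :=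
    ⟨hf.1, hf.2.mono fun x hx => hx.trans hb⟩
  refine ⟨B' + ∑ e, ∑ e', B e e', add_nonneg hB0' hs, hB'.mono (hm (by linarith)), fun e e' =>
    (hB e e').mono (hm ?_)⟩
  refine le_trans ?_ (le_add_of_nonneg_left hB0')
  refine (Finset.single_le_sum (f := fun e' => B e e') (fun e' _ => hB0 e e')
    (Finset.mem_univ e')).trans ?_
  exact Finset.single_le_sum (f := fun e => ∑ e', B e e')
    (fun e _ => Finset.sum_nonneg fun e' _ => hB0 e e') (Finset.mem_univ e)

/-- The weak regularity of `A (σ + α p I) + γ`. -/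
theorem weakReg_gradient (hΩ : IsOpen Ω) {B K : ℝ} (hB : 0 ≤ B) (hK : 0 ≤ K)
    (hα : WeakReg Ω (BddOn Ω B) k D.α)
    (hA : ∀ e e', WeakReg Ω (BddOn Ω B) k fun x => D.A x (EuclideanSpace.single e 1) e')
    {σ γ : Vec n → Mat n} {p : Vec n → ℝ} (hσ : ∀ e, WeakReg Ω (SqBdd Ω K) k fun x => σ x e)
    (hp : WeakReg Ω (SqBdd Ω K) k p) (hγ : ∀ e, WeakReg Ω (SqBdd Ω K) k fun x => γ x e)
    (e : Fin n × Fin n) :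
    WeakReg Ω (SqBdd Ω ((∑ e' : Fin n × Fin n, 2 ^ k * (B * (1 + |idMat n e'| * (2 ^ k * B))) + 1) * K)) k
      fun x => (D.A x (σ x + (D.α x * p x) • idMat n) + γ x) e := by
  have h1 := hα.mul hΩ hB hK hp
  have h2 (e' : Fin n × Fin n) := (hσ e').add hK (by positivity) (h1.const_mul (idMat n e'))
  have h3 (e' : Fin n × Fin n) := (hA e' e).mul hΩ hB (by positivity) (h2 e')
  have h4 := WeakReg.sum Finset.univ (fun e' => by positivity) h3
  have h5 := h4.add (Finset.sum_nonneg fun e' _ => by positivity) hK (hγ e)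
  have e1 : (fun x => (D.A x (σ x + (D.α x * p x) • idMat n) + γ x) e) = fun x =>
      (∑ e', D.A x (EuclideanSpace.single e' 1) e * (σ x e' + idMat n e' * (D.α x * p x)))
        + γ x e := by
    ext x
    have h6 (v : Mat n) : D.A x v e = ∑ e', D.A x (EuclideanSpace.single e' 1) e * v e' := by
      have h7 : v = ∑ e', v e' • EuclideanSpace.single e' (1 : ℝ) := by
        ext j; simp [Pi.single_apply]
      conv_lhs => rw [h7, map_sum]
      simp [mul_comm]
    rw [PiLp.add_apply, h6]
    simp [mul_comm]
  rw [e1]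
  refine h5.mono_const (le_of_eq ?_)
  rw [add_mul, one_mul, Finset.sum_mul]
  congr 1
  exact Finset.sum_congr rfl fun e' _ => by ring

/-- The stress equation says that A(σ + αpI) + γ is the weak gradient of `u`. Since `u` gains one
derivative over its gradient, coefficients in `W^{k,∞}` suffice for `u ∈ H^{k+1}`. -/
theorem exists_hm_displacement_of_rep (hΩ : IsOpen Ω) (hD : D.Admissible Ω) (hn : n ≠ 0) {B R K : ℝ}
    (hB : 0 ≤ B) (hα : WeakReg Ω (BddOn Ω B) k D.α)
    (hA : ∀ e e', WeakReg Ω (BddOn Ω B) k fun x => D.A x (EuclideanSpace.single e 1) e')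
    (hR : 0 ≤ R) (hΩR : ∀ x ∈ Ω, ‖x‖ ≤ R) (hK : 0 ≤ K)
    {σ γ : Hm Ω (k + 1) (Mat n)} {p : Hm Ω (k + 1) ℝ} (hσ : ‖σ‖ ≤ K) (hp : ‖p‖ ≤ K) (hγ : ‖γ‖ ≤ K)
    {σ₀ γ₀ : L2 Ω (Mat n)} {p₀ : L2 Ω ℝ} {u : L2 Ω (Vec n)} (hσ₀ : hmFn σ = σ₀) (hp₀ : hmFn p = p₀)
    (hγ₀ : hmFn γ = γ₀) (h : ∀ τ : HdivMat Ω,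
      formA D σ₀ p₀ (mfn Ω τ) 0 + ⟪u, mdiv Ω τ⟫_ℝ + ⟪γ₀, mfn Ω τ⟫_ℝ = 0) :
    ∃ F : Hm Ω (k + 1) (Vec n), hmFn F = u ∧ ‖F‖ ≤ Fintype.card (MIdx n (k + 1)) * (n * ((2 * R + 1) *
      ((∑ e' : Fin n × Fin n, 2 ^ k * (B * (1 + |idMat n e'| * (2 ^ k * B))) + 1) * K))) := by
  subst hσ₀ hp₀ hγ₀
  have hex := exists_operators hΩ hD
  obtain ⟨O, -, hF, -, -, hOA, hOP⟩ := hex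
  have hc (F : Hm Ω (k + 1) (Mat n)) (hF : ‖F‖ ≤ K) (e : Fin n × Fin n) :
      WeakReg Ω (SqBdd Ω K) k fun x => hmFn F x e := by
    -- Only `k` of the `k + 1` available derivatives enter the gradient.
    refine (weakReg_hmFn (EuclideanSpace.proj (𝕜 := ℝ) e) F).of_succ.mono_const ?_
    refine (mul_le_of_le_one_left (norm_nonneg F) ?_).trans hF
    exact ContinuousLinearMap.opNorm_le_bound _ zero_le_one fun v => by
      rw [one_mul]; exact PiLp.norm_apply_le v e
  have hcp : WeakReg Ω (SqBdd Ω K) k fun x => hmFn p x := by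
    refine (weakReg_hmFn (ContinuousLinearMap.id ℝ ℝ) p).of_succ.mono_const ?_
    rw [ContinuousLinearMap.norm_id, one_mul]
    exact hp
  have hG : (O.A (O.eff (hmFn σ) (hmFn p)) + hmFn γ : L2 Ω (Mat n)) =ᵐ[volume.restrict Ω]
      fun x => D.A x (hmFn σ x + (D.α x * hmFn p x) • idMat n) + hmFn γ x := by
    filter_upwards [Lp.coeFn_add (O.A (O.eff (hmFn σ) (hmFn p))) (hmFn γ),
      hOA (O.eff (hmFn σ) (hmFn p)), Lp.coeFn_add (hmFn σ) (O.P (hmFn p)), hOP (hmFn p)]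
      with x h1 h2 h3 h4
    have h5 : O.eff (hmFn σ) (hmFn p) x = hmFn σ x + (D.α x * hmFn p x) • idMat n :=
      h3.trans (congrArg (hmFn σ x + ·) h4)
    rw [h1, Pi.add_apply, h2, h5]
  refine exists_hm_displacement (G := O.A (O.eff (hmFn σ) (hmFn p)) + hmFn γ) (fun τ => ?_) hR hΩ hΩR
    hn (by positivity) fun i j => ?_
  · have h1 := h τ
    have e : O.eff (mfn Ω τ) 0 = mfn Ω τ := by unfold Operators.eff; rw [map_zero, add_zero]
    rw [hF, e] at h1
    rw [inner_add_left]
    linarith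
  · exact (weakReg_gradient hΩ hB hK hα hA (hc σ hσ) hcp (hc γ hγ) (i, j)).congr
      (hG.symm.mono fun x hx => congrArg (fun v : Mat n => v (i, j)) hx)

theorem exists_displacement_regularity {T : ℝ} (hΩ : IsOpen Ω) (hΩb : Bornology.IsBounded Ω)
    (hn : n ≠ 0) (hT : 0 < T) (hD : D.Admissible Ω) {m : ℕ} (hm : 1 ≤ m)
    (hreg : D.RegularUpTo Ω (m - 1)) :
    ∃ C : ℝ, 0 ≤ C ∧ ∀ (f : ℝ → L2 Ω (Vec n)) (g : ℝ → L2 Ω ℝ) (s : Fields Ω),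
      IsSolution D T (fullSpaces Ω) f g s → ∀ K : ℝ, 0 < K → boundMax T m s < ENNReal.ofReal K →
      ∀ t ∈ Icc 0 T, ∃ F : Hm Ω m (Vec n), hmFn F = s.u t ∧ ‖F‖ ≤ C * K := by
  obtain ⟨k, rfl⟩ := Nat.exists_eq_add_of_le' hm
  rw [Nat.add_sub_cancel] at hreg
  obtain ⟨B, hB, hα, hA⟩ := hreg.exists_weakReg hΩ hD
  obtain ⟨R, hR⟩ := hΩb.exists_norm_le
  have hT' := timeConst_pos hT
  refine ⟨Fintype.card (MIdx n (k + 1)) * (n * ((2 * |R| + 1) *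
    ((∑ e' : Fin n × Fin n, 2 ^ k * (B * (1 + |idMat n e'| * (2 ^ k * B))) + 1) * timeConst T))),
    by positivity, fun f g s hs K hK hKs t ht => ?_⟩
  have hb := lt_of_boundMax_lt hKs
  refine (exists_isRep (Or.inl rfl) hT hK hb.1).elim fun Fσ h1 => h1.elim fun Fσ' hσ => ?_
  refine (exists_isRep (Or.inl rfl) hT hK hb.2.1).elim fun Fp h1 => h1.elim fun Fp' hp => ?_
  refine (exists_isRep (Or.inl rfl) hT hK hb.2.2.1).elim fun Fγ h1 => h1.elim fun Fγ' hγ => ?_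
  have e1 : hmFn (Fσ t) = mfn Ω (s.σ t) := hσ.rep t ht
  have e2 : hmFn (Fp t) = s.p t := hp.rep t ht
  have e3 : hmFn (Fγ t) = s.γ t := hγ.rep t ht
  have n1 : ‖Fσ t‖ ≤ timeConst T * K := hσ.norm_le t ht
  have n2 : ‖Fp t‖ ≤ timeConst T * K := hp.norm_le t ht
  have n3 : ‖Fγ t‖ ≤ timeConst T * K := hγ.norm_le t ht
  have hF := exists_hm_displacement_of_rep (K := timeConst T * K) (u := s.u t) hΩ hD hn hB hα hA
    (abs_nonneg R) (fun x hx => (hR x hx).trans (le_abs_self R)) (by positivity) n1 n2 n3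
    e1 e2 e3 fun τ => hs.eq1 t ht τ Submodule.mem_top
  refine hF.imp fun F hF => ⟨hF.1, hF.2.trans_eq ?_⟩
  simp only [mul_assoc]

end Displacement

/-! ### Error bounds, uniform in time -/

section UniformBounds

theorem eLpNorm_top_le_mul {Z : Type*} [NormedAddCommGroup Z] {T h C c : ℝ} {m : ℕ} {f : ℝ → Z}
    {B : ℝ≥0∞} (hh : 0 < h) (hc : 0 < c) (hC : C ≤ c)
    (H : ∀ K : ℝ, 0 < K → B < ENNReal.ofReal K →
      ∀ᵐ t ∂(timeMeasure T), ‖f t‖ ≤ C * (h ^ m * K)) :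
    eLpNorm f ∞ (timeMeasure T) ≤ ENNReal.ofReal (c * h ^ m) * B := by
  refine le_mul_of_forall_lt (mul_pos hc (pow_pos hh m)) fun K hK hB => ?_
  refine (eLpNorm_le_of_ae_bound (H K hK hB)).trans ?_
  simp only [ENNReal.toReal_top, inv_zero, ENNReal.rpow_zero, one_mul]
  refine ENNReal.ofReal_le_ofReal ?_
  have : 0 ≤ h ^ m * K := by positivity
  calc C * (h ^ m * K) ≤ c * (h ^ m * K) := by gcongr
    _ = _ := by ring

theorem ae_norm_le_of_eLpNorm_top {Z : Type*} [NormedAddCommGroup Z] {T K : ℝ} {f : ℝ → Z}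
    (hK : 0 ≤ K) (hf : eLpNorm f ∞ (timeMeasure T) ≤ ENNReal.ofReal K) :
    ∀ᵐ t ∂(timeMeasure T), ‖f t‖ ≤ K := by
  rw [eLpNorm_exponent_top] at hf
  filter_upwards [ae_le_eLpNormEssSup (f := f) (μ := timeMeasure T)] with t ht
  have := ht.trans hf
  rw [← ofReal_norm] at this
  exact (ENNReal.ofReal_le_ofReal_iff hK).1 this

variable {n : ℕ} {Ω : Set (Vec n)} {D : Coeffs n} {T : ℝ} {Y : Spaces Ω} {h c : ℝ} {r r' m : ℕ}
  {O : Operators (L2 Ω (Mat n)) (L2 Ω (Vec n)) (L2 Ω ℝ)}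

/-- The factor in the bounds of the consistency errors. -/
def consistencyFactor (c c₀ T : ℝ) : ℝ := 3 * consistencyConst c c₀ * timeConst T

theorem consistencyFactor_nonneg (c c₀ : ℝ) (hT : 0 < T) : 0 ≤ consistencyFactor c c₀ T := by
  have := one_le_consistencyConst c c₀
  have := timeConst_pos hT
  unfold consistencyFactor; positivity

theorem mul_consistencyBound (X ε c c₀ T K : ℝ) :
    X * (ε * consistencyBound (consistencyConst c c₀) T K)
      = X * consistencyFactor c c₀ T * (ε * K) := by
  unfold consistencyBound consistencyFactor; ring

/-- The bound of `boundMax` in terms of `boundSum`. -/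
def sumConst (T : ℝ) : ℝ := 1 + √T + √T * timeConst T

theorem one_le_sumConst (hT : 0 < T) : 1 ≤ sumConst T := by
  have := timeConst_pos hT
  have := Real.sqrt_nonneg T
  unfold sumConst; nlinarith [mul_nonneg (Real.sqrt_nonneg T) (timeConst_pos hT).le]

/-- Enlarging `K` by the embedding constant places one number above both bounds, as required for
combining the two energy estimates. -/
theorem lt_sumConst_mul (hT : 0 < T) {s : Fields Ω} {K : ℝ} (hK : 0 < K)
    (hB : boundSum T m s < ENNReal.ofReal K) :
    boundMax T m s < ENNReal.ofReal (sumConst T * K) ∧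
      boundSum T m s < ENNReal.ofReal (sumConst T * K) := by
  have h1 := one_le_sumConst hT
  constructor
  · refine (boundMax_le hT s).trans_lt ?_
    rw [ENNReal.ofReal_mul (by linarith)]
    exact (ENNReal.mul_lt_mul_iff_right (by simp [sumConst] at h1 ⊢; linarith)
      ENNReal.ofReal_ne_top).2 hB
  · refine hB.trans_le (ENNReal.ofReal_le_ofReal ?_)
    nlinarith

theorem energyNorm_le (hA : ∀ σ p τ q, formA D σ p τ q = ⟪O.A (O.eff σ p), O.eff τ q⟫_ℝ)
    (σ : L2 Ω (Mat n)) (p : L2 Ω ℝ) : ‖energyNorm D σ p‖ ≤ √‖O.A‖ * ‖O.eff σ p‖ := by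
  unfold energyNorm
  rw [Real.norm_of_nonneg (Real.sqrt_nonneg _), hA]
  exact sqrt_inner_map_self_le O.A _

theorem Stable.norm_sub_V_le' (H : Stable Y h c r r') (hO : O.skew = skewFields Ω) (hh : 0 < h)
    (hm : 1 ≤ m) (hmr : m ≤ r') {F : Hm Ω m (Vec n)} {f : L2 Ω (Vec n)} (hF : hmFn F = f) :
    ‖f - (H.discretization hO).V.starProjection f‖ ≤ h ^ m * (|c| * ‖F‖) := by
  subst hF
  exact H.norm_sub_V_le hO hh hm hmr F

theorem norm_sub_le_add {Z : Type*} [NormedAddCommGroup Z] {x y z : Z} {a b : ℝ}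
    (h1 : ‖x - y‖ ≤ a) (h2 : ‖y - z‖ ≤ b) : ‖x - z‖ ≤ a + b :=
  (norm_sub_le_norm_sub_add_norm_sub x y z).trans (add_le_add h1 h2)

variable (H : Stable Y h c r r') (hO : O.skew = skewFields Ω)
    (hA : ∀ σ p τ q, formA D σ p τ q = ⟪O.A (O.eff σ p), O.eff τ q⟫_ℝ)
    (hK : ∀ z w, formκ D z w = ⟪O.K z, w⟫_ℝ) (hS : ∀ p q, formS D p q = ⟪O.S p, q⟫_ℝ)
    (hh : 0 < h) (hm : 1 ≤ m) (hmr : m ≤ r) (hT : 0 < T) {f : ℝ → L2 Ω (Vec n)} {g : ℝ → L2 Ω ℝ}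
    {s sh : Fields Ω} (hs : IsSolution D T (fullSpaces Ω) f g s) (hsh : IsSolution D T Y f g sh)
    {c₀ : ℝ} (hI : InitialAccuracy T h c₀ m s sh)
include H hO hA hK hS hh hm hmr hT hs hsh hI

/-- The projection of `u` onto the discrete displacements is inserted. Only its approximation error
depends on the regularity of `u`, through `F`. -/
theorem norm_displacement_le (hmr' : m ≤ r') {K K' : ℝ} (hK0 : 0 < K)
    (hB : boundMax T m s < ENNReal.ofReal K) {t : ℝ} (ht : t ∈ Icc 0 T) {F : Hm Ω m (Vec n)}
    (hF : hmFn F = s.u t) (hFK : ‖F‖ ≤ K' * K) :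
    ‖s.u t - sh.u t‖ ≤ (O.dispConst |c| * consistencyFactor c c₀ T + |c| * K') * (h ^ m * K) := by
  have h1 := (H.error_bounds hO hA hK hS hh hm hmr hT hs hsh hI hK0 hB ht).2.2
  have h2 := H.norm_sub_V_le' hO hh hm hmr' hF
  have h3 : h ^ m * (|c| * ‖F‖) ≤ h ^ m * (|c| * (K' * K)) :=
    mul_le_mul_of_nonneg_left (mul_le_mul_of_nonneg_left hFK (abs_nonneg c)) (pow_pos hh m).le
  refine (norm_sub_le_add (h2.trans h3) h1).trans_eq ?_
  rw [mul_consistencyBound]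
  ring

variable {C : ℝ} (hC : 0 < C)
include hC

theorem energyNorm_bound (hCle : √‖O.A‖ * O.effConst * consistencyFactor c c₀ T ≤ C) :
    eLpNorm (fun t => energyNorm D (mfn Ω (s.σ t) - mfn Ω (sh.σ t)) (s.p t - sh.p t)) ∞
      (timeMeasure T) ≤ ENNReal.ofReal (C * h ^ m) * boundMax T m s := by
  refine eLpNorm_top_le_mul hh hC hCle fun K hK0 hB => ae_timeMeasure.2 (ae_of_all _ fun t ht => ?_)
  have h1 := (H.error_bounds hO hA hK hS hh hm hmr hT hs hsh hI hK0 hB ht).1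
  rw [embeddings_ι_sub, mul_consistencyBound] at h1
  refine (energyNorm_le hA _ _).trans
    ((mul_le_mul_of_nonneg_left h1 (Real.sqrt_nonneg _)).trans_eq (by ring))

theorem rotation_bound (hCle : O.rotConst |c| * consistencyFactor c c₀ T ≤ C) :
    normLinftyL2 T (fun t => s.γ t - sh.γ t) ≤ ENNReal.ofReal (C * h ^ m) * boundMax T m s := by
  refine eLpNorm_top_le_mul hh hC hCle fun K hK0 hB => ae_timeMeasure.2 (ae_of_all _ fun t ht => ?_)
  have h1 := (H.error_bounds hO hA hK hS hh hm hmr hT hs hsh hI hK0 hB ht).2.1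
  rw [mul_consistencyBound] at h1
  exact h1

theorem displacement_bound (hmr' : m ≤ r')
    (hCle : O.dispConst |c| * consistencyFactor c c₀ T + |c| * 1 ≤ C) :
    normLinftyL2 T (fun t => s.u t - sh.u t)
      ≤ ENNReal.ofReal (C * h ^ m) * (boundMax T m s + normLqHm T ∞ m s.u) := by
  refine eLpNorm_top_le_mul hh hC hCle fun K hK0 hB => ?_
  -- A number above the sum of the two norms lies above each of them, so one `K` serves both, with
  -- `K' = 1`.
  have hB2 := exists_rep_of_normLqHm_lt (le_add_self.trans_lt hB)
  refine hB2.elim fun F hF => ?_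
  filter_upwards [ae_norm_le_of_eLpNorm_top hK0.le hF.2.2.le, hF.2.1,
    ae_timeMeasure.2 (ae_of_all _ fun t ht => ht)] with t h1 h2 ht
  exact norm_displacement_le H hO hA hK hS hh hm hmr hT hs hsh hI hmr' hK0
    (le_self_add.trans_lt hB) ht h2 (h1.trans_eq (one_mul K).symm)

theorem displacement_bound_of_regularity (hmr' : m ≤ r') {K' : ℝ}
    (hu : ∀ K : ℝ, 0 < K → boundMax T m s < ENNReal.ofReal K →
      ∀ t ∈ Icc 0 T, ∃ F : Hm Ω m (Vec n), hmFn F = s.u t ∧ ‖F‖ ≤ K' * K)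
    (hCle : O.dispConst |c| * consistencyFactor c c₀ T + |c| * K' ≤ C) :
    normLinftyL2 T (fun t => s.u t - sh.u t) ≤ ENNReal.ofReal (C * h ^ m) * boundMax T m s := by
  refine eLpNorm_top_le_mul hh hC hCle fun K hK0 hB => ae_timeMeasure.2 (ae_of_all _ fun t ht => ?_)
  exact (hu K hK0 hB t ht).elim fun F hF =>
    norm_displacement_le H hO hA hK hS hh hm hmr hT hs hsh hI hmr' hK0 hB ht hF.1 hF.2

theorem stress_bound (hCle : (O.effConst + ‖O.P‖ * O.presConst |c|) * consistencyFactor c c₀ T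
      * sumConst T ≤ C) :
    normLinftyL2 T (fun t => mfn Ω (s.σ t) - mfn Ω (sh.σ t))
      ≤ ENNReal.ofReal (C * h ^ m) * boundSum T m s := by
  refine eLpNorm_top_le_mul hh hC hCle fun K hK0 hB => ae_timeMeasure.2 (ae_of_all _ fun t ht => ?_)
  have hB' := lt_sumConst_mul hT hK0 hB
  have h1 := (H.flux_error_bounds hO hA hK hS hh hm hmr hT hs hsh hI
    (mul_pos (zero_lt_one.trans_le (one_le_sumConst hT)) hK0) hB'.1 hB'.2 ht).2.2
  rw [embeddings_ι_sub, mul_consistencyBound] at h1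
  exact h1.trans_eq (by ring)

theorem flux_bound (hCle : O.fluxConst * consistencyFactor c c₀ T * sumConst T ≤ C) :
    normLinftyL2 T (fun t => vfn Ω (s.z t) - vfn Ω (sh.z t))
      ≤ ENNReal.ofReal (C * h ^ m) * boundSum T m s := by
  refine eLpNorm_top_le_mul hh hC hCle fun K hK0 hB => ae_timeMeasure.2 (ae_of_all _ fun t ht => ?_)
  have hB' := lt_sumConst_mul hT hK0 hB
  have h1 := (H.flux_error_bounds hO hA hK hS hh hm hmr hT hs hsh hI
    (mul_pos (zero_lt_one.trans_le (one_le_sumConst hT)) hK0) hB'.1 hB'.2 ht).1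
  rw [embeddings_j_sub, mul_consistencyBound] at h1
  exact h1.trans_eq (by ring)

theorem pressure_bound (hCle : O.presConst |c| * consistencyFactor c c₀ T * sumConst T ≤ C) :
    normLinftyL2 T (fun t => s.p t - sh.p t) ≤ ENNReal.ofReal (C * h ^ m) * boundSum T m s := by
  refine eLpNorm_top_le_mul hh hC hCle fun K hK0 hB => ae_timeMeasure.2 (ae_of_all _ fun t ht => ?_)
  have hB' := lt_sumConst_mul hT hK0 hB
  have h1 := (H.flux_error_bounds hO hA hK hS hh hm hmr hT hs hsh hI
    (mul_pos (zero_lt_one.trans_le (one_le_sumConst hT)) hK0) hB'.1 hB'.2 ht).2.1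
  rw [mul_consistencyBound] at h1
  exact h1.trans_eq (by ring)

end UniformBounds

/-! ### Choice of a common constant -/

section Constants

variable {E F Q : Type*} [NormedAddCommGroup E] [InnerProductSpace ℝ E]
  [NormedAddCommGroup F] [InnerProductSpace ℝ F] [NormedAddCommGroup Q] [InnerProductSpace ℝ Q]

/-- A common constant for all error bounds. -/
theorem Operators.exists_uniform_const (O : Operators E F Q) (c c₀ : ℝ) {T : ℝ} (hT : 0 < T)
    (Cu : ℕ → ℝ) (hCu : ∀ m, 0 ≤ Cu m) (r : ℕ) :
    ∃ C : ℝ, 0 < C ∧ √‖O.A‖ * O.effConst * consistencyFactor c c₀ T ≤ C ∧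
      (O.effConst + ‖O.P‖ * O.presConst |c|) * consistencyFactor c c₀ T * sumConst T ≤ C ∧
      O.dispConst |c| * consistencyFactor c c₀ T + |c| * 1 ≤ C ∧
      (∀ m ≤ r, O.dispConst |c| * consistencyFactor c c₀ T + |c| * Cu m ≤ C) ∧
      O.rotConst |c| * consistencyFactor c c₀ T ≤ C ∧
      O.fluxConst * consistencyFactor c c₀ T * sumConst T ≤ C ∧
      O.presConst |c| * consistencyFactor c c₀ T * sumConst T ≤ C := by
  have hκ := consistencyFactor_nonneg c c₀ hT
  have hs : 0 ≤ sumConst T := zero_le_one.trans (one_le_sumConst hT)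
  have he := O.effConst_pos
  have hf := O.fluxConst_pos
  have hr1 : 0 ≤ O.rotConst |c| := by unfold rotConst; positivity
  have hp1 : 0 ≤ O.presConst |c| := by unfold presConst; positivity
  have hd1 : 0 ≤ O.dispConst |c| := by unfold dispConst; positivity
  -- The regularity constants depend on `m`; as `m ≤ r` takes finitely many values, their sum serves
  -- for all of them.
  have hU : ∀ m ≤ r, Cu m ≤ ∑ i ∈ Finset.range (r + 1), Cu i := fun m hm =>
    Finset.single_le_sum (fun i _ => hCu i) (Finset.mem_range.2 (Nat.lt_succ_of_le hm))
  have hU0 : 0 ≤ ∑ i ∈ Finset.range (r + 1), Cu i := Finset.sum_nonneg fun i _ => hCu i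
  generalize ∑ i ∈ Finset.range (r + 1), Cu i = U at hU hU0
  have n1 : 0 ≤ √‖O.A‖ * O.effConst * consistencyFactor c c₀ T := by positivity
  have n2 : 0 ≤ O.rotConst |c| * consistencyFactor c c₀ T := by positivity
  have n3 : 0 ≤ O.dispConst |c| * consistencyFactor c c₀ T := by positivity
  have n4 : 0 ≤ |c| * U := by positivity
  have n5 : 0 ≤ (O.effConst + ‖O.P‖ * O.presConst |c|) * consistencyFactor c c₀ T * sumConst T := by
    positivity
  have n6 : 0 ≤ O.fluxConst * consistencyFactor c c₀ T * sumConst T := by positivity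
  have n7 : 0 ≤ O.presConst |c| * consistencyFactor c c₀ T * sumConst T := by positivity
  have n8 : 0 ≤ |c| := abs_nonneg _
  refine ⟨√‖O.A‖ * O.effConst * consistencyFactor c c₀ T
    + O.rotConst |c| * consistencyFactor c c₀ T + O.dispConst |c| * consistencyFactor c c₀ T
    + |c| * U + (O.effConst + ‖O.P‖ * O.presConst |c|) * consistencyFactor c c₀ T * sumConst T
    + O.fluxConst * consistencyFactor c c₀ T * sumConst T
    + O.presConst |c| * consistencyFactor c c₀ T * sumConst T + |c| + 1, ?_, ?_, ?_, ?_,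
    fun m hm => ?_, ?_, ?_, ?_⟩
  all_goals first
    | linarith
    | linarith [mul_le_mul_of_nonneg_left (hU m hm) n8]

end Constants

end Biot

end

/-! ### The a priori error bounds -/

theorem corollary3p3 (n : ℕ) (hn : n = 2 ∨ n = 3)
    (Ω : Set (Biot.Vec n)) (hΩ : IsOpen Ω) (hΩb : Bornology.IsBounded Ω)
    (T : ℝ) (hT : 0 < T) (D : Biot.Coeffs n) (hD : D.Admissible Ω)
    (r r' : ℕ) (hr' : 1 ≤ r') (hrr' : r' = r ∨ r' + 1 = r) (cFE c₀ : ℝ) :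
    ∃ c : ℝ, 0 < c ∧
      ∀ (Y : Biot.Spaces Ω) (h : ℝ), 0 < h → Biot.Stable Y h cFE r r' →
      ∀ (f : ℝ → Biot.L2 Ω (Biot.Vec n)) (g : ℝ → Biot.L2 Ω ℝ) (s sh : Biot.Fields Ω),
      Biot.IsSolution D T (Biot.fullSpaces Ω) f g s → Biot.IsSolution D T Y f g sh →
      ∀ m : ℕ, 1 ≤ m → m ≤ r → Biot.InitialAccuracy T h c₀ m s sh →
        eLpNorm (fun t => Biot.energyNorm D (Biot.mfn Ω (s.σ t) - Biot.mfn Ω (sh.σ t))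
            (s.p t - sh.p t)) ∞ (Biot.timeMeasure T)
          ≤ ENNReal.ofReal (c * h ^ m) * Biot.boundMax T m s ∧
        Biot.normLinftyL2 T (fun t => Biot.mfn Ω (s.σ t) - Biot.mfn Ω (sh.σ t))
          ≤ ENNReal.ofReal (c * h ^ m) * Biot.boundSum T m s ∧
        (m ≤ r' → Biot.normLinftyL2 T (fun t => s.u t - sh.u t)
          ≤ ENNReal.ofReal (c * h ^ m) * (Biot.boundMax T m s + Biot.normLqHm T ∞ m s.u)) ∧
        (m ≤ r' → D.RegularUpTo Ω (m - 1) → Biot.normLinftyL2 T (fun t => s.u t - sh.u t)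
          ≤ ENNReal.ofReal (c * h ^ m) * Biot.boundMax T m s) ∧
        Biot.normLinftyL2 T (fun t => s.γ t - sh.γ t)
          ≤ ENNReal.ofReal (c * h ^ m) * Biot.boundMax T m s ∧
        Biot.normLinftyL2 T (fun t => Biot.vfn Ω (s.z t) - Biot.vfn Ω (sh.z t))
          ≤ ENNReal.ofReal (c * h ^ m) * Biot.boundSum T m s ∧
        Biot.normLinftyL2 T (fun t => s.p t - sh.p t)
          ≤ ENNReal.ofReal (c * h ^ m) * Biot.boundSum T m s := by
  have hop := Biot.exists_operators hΩ hD
  obtain ⟨O, hO, hA, hK, hS, -⟩ := hop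
  have hn0 : n ≠ 0 := by omega
  have hreg : ∀ m : ℕ, ∃ C : ℝ, 0 ≤ C ∧ (1 ≤ m → D.RegularUpTo Ω (m - 1) →
      ∀ (f : ℝ → Biot.L2 Ω (Biot.Vec n)) (g : ℝ → Biot.L2 Ω ℝ) (s : Biot.Fields Ω),
      Biot.IsSolution D T (Biot.fullSpaces Ω) f g s → ∀ K : ℝ, 0 < K →
      Biot.boundMax T m s < ENNReal.ofReal K → ∀ t ∈ Icc 0 T,
      ∃ F : Biot.Hm Ω m (Biot.Vec n), Biot.hmFn F = s.u t ∧ ‖F‖ ≤ C * K) := by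
    intro m
    -- The constant has to be fixed before the solutions and for every `m`. Where the coefficients
    -- lack the required regularity the claim is vacuous, and zero serves as a default.
    by_cases h : 1 ≤ m ∧ D.RegularUpTo Ω (m - 1)
    · have h1 := Biot.exists_displacement_regularity hΩ hΩb hn0 hT hD h.1 h.2
      exact h1.elim fun C hC => ⟨C, hC.1, fun _ _ => hC.2⟩
    · exact ⟨0, le_rfl, fun h1 h2 => absurd ⟨h1, h2⟩ h⟩
  choose Cu hCu0 hCu using hreg
  have hconst := O.exists_uniform_const cFE c₀ hT Cu hCu0 r
  refine hconst.elim fun c hc => ⟨c, hc.1, fun Y h hh H f g s sh hs hsh m hm hmr hI =>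
    ⟨?_, ?_, fun hmr' => ?_, fun hmr' hreg => ?_, ?_, ?_, ?_⟩⟩
  · exact Biot.energyNorm_bound H hO hA hK hS hh hm hmr hT hs hsh hI hc.1 hc.2.1
  · exact Biot.stress_bound H hO hA hK hS hh hm hmr hT hs hsh hI hc.1 hc.2.2.1
  · exact Biot.displacement_bound H hO hA hK hS hh hm hmr hT hs hsh hI hc.1 hmr' hc.2.2.2.1
  · exact Biot.displacement_bound_of_regularity H hO hA hK hS hh hm hmr hT hs hsh hI hc.1 hmr'
      (hCu m hm hreg f g s hs) (hc.2.2.2.2.1 m hmr)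
  · exact Biot.rotation_bound H hO hA hK hS hh hm hmr hT hs hsh hI hc.1 hc.2.2.2.2.2.1
  · exact Biot.flux_bound H hO hA hK hS hh hm hmr hT hs hsh hI hc.1 hc.2.2.2.2.2.2.1
  · exact Biot.pressure_bound H hO hA hK hS hh hm hmr hT hs hsh hI hc.1 hc.2.2.2.2.2.2.2
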